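/- **Corollary 1.5.** Write $\langle v\rangle=(1+|v|^2)^{1/2}$ for $v\in\mathbb R^3$, $\bm m_s(f)=\int_{\mathbb R^3}\langle v\rangle^s|f(v)|\,dv$, $L^1_s=\{f\in L^1(\mathbb R^3):\bm m_s(f)<\infty\}$, $H(f)=\int_{\mathbb R^3} f\log f\,dv$, and $\Pi(z)=\mathrm{Id}-\frac{z\otimes z}{|z|^2}$. Let $0\le f_{\rm in}\in L^1_2(\mathbb R^3)$ with $|H(f_{\rm in})|<\infty$ (that is, $f_{\rm in}\log f_{\rm in}\in L^1$), normalized by $$\int f_{\rm in}\,dv=1,\qquad \int f_{\rm in}\,v\,dv=0,\qquad \int f_{\rm in}\,|v|^2\,dv=3 .$$ Let $g\in\mathcal Y_0(f_{\rm in})$, i.e. $0\le g\in L^1_2(\mathbb R^3)$ has the same mass, momentum and energy ($\int g$, $\int g\,v$, $\int g|v|^2$) as $f_{\rm in}$ and satisfies $H(g)\le H(f_{\rm in})$ (in particular $g\log g\in L^1$). Assume that $g$ has a weak logarithmic gradient $\nabla\log g$, i.e. that the distributional gradient of $g$ is a locally integrable field of the form $g\,\nabla\log g$; this is the case, with the classical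 $\nabla\log g$, for every positive $g$ of class $C^1$. Let $\gamma\ge 0$ and let $$\mathscr D_0(g)=\frac12\int_{\mathbb R^6}|v-v_*|^{\gamma+2}\,g(v)\,g(v_*)\,\bigl|\Pi(v-v_*)\bigl(\nabla\log g(v)-\nabla\log g(v_*)\bigr)\bigr|^2\,dv\,dv_*\in[0,\infty]$$ be the Landau entropy production. Let $\mathcal M_0(v)=(2\pi)^{-3/2}e^{-|v|^2/2}$ and define $\lambda(g)$ by $$\frac1{\lambda(g)}=510\,\bm e_\gamma^{3}\,\max(1,\bm B_\gamma)\,\max\bigl(1,\bm m_{2+\gamma}(g)\bigr)\,\mathscr I_\gamma(g),$$ where $$\mathscr I_\gamma(g)=\sup_{v\in\mathbb R^3}\langle v\rangle^\gamma\int_{\mathbb R^3}g(w)|w-v|^{-\gamma}\langle w\rangle^2\,dw,\qquad \frac1{\bm e_\gamma}=\min_{i}\frac13\int_{\mathbb R^3}g(v)\,v_i^2\,dv,$$ $$\frac1{\bm B_\gamma}=\min_{i\ne j}\ \inf_{\sigma\in\mathbb S^1}\int_{\mathbb R^3}\Bigl|\sigma_1\frac{v_i}{\langle v\rangle}-\sigma_2\frac{v_j}{\langle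 v\rangle}\Bigr|^2g(v)\,dv ,$$ with $\lambda(g)=0$ if the right-hand side of the formula for $1/\lambda(g)$ is infinite. Then $g\log(g/\mathcal M_0)$ is integrable, $$\mathscr D_0(g)\ \ge\ \lambda(g)\int_{\mathbb R^3}g(v)\log\frac{g(v)}{\mathcal M_0(v)}\,dv ,$$ and $\lambda(g)>0$ whenever $\bm m_{2+\gamma}(g)<\infty$ and $\mathscr I_\gamma(g)<\infty$. -/

import Mathlib

open MeasureTheory
open scoped ENNReal ContDiff

noncomputable section

namespace Landau

/-- The velocity space `ℝ³` with its Euclidean norm. -/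
abbrev V : Type := EuclideanSpace ℝ (Fin 3)

/-- The bracket `⟨v⟩ = (1 + |v|²)^{1/2}`. -/
def bracket (v : V) : ℝ := Real.sqrt (1 + ‖v‖ ^ 2)

/-- The moment `m_s(f) = ∫ ⟨v⟩^s |f(v)| dv`, an element of `[0, ∞]`. -/
def moment (s : ℝ) (f : V → ℝ) : ℝ≥0∞ :=
  ∫⁻ v, ENNReal.ofReal (bracket v ^ s * |f v|)

/-- The weighted space `L¹_s(ℝ³)`. -/
def MemL1 (s : ℝ) (f : V → ℝ) : Prop :=
  Integrable f ∧ moment s f < ⊤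

/-- The Boltzmann entropy `H(f) = ∫ f log f dv`. It is only used for functions for which
`f log f` is integrable, which is always required separately. -/
def entropy (f : V → ℝ) : ℝ := ∫ v, f v * Real.log (f v)

/-- Standing assumptions on the initial datum in the classical case:
`0 ≤ f ∈ L¹_2(ℝ³)` with `|H(f)| < ∞`. -/
structure IsInitialDatum (f : V → ℝ) : Prop where
  nonneg : ∀ v, 0 ≤ f v
  memL1 : MemL1 2 f
  entropy_finite : Integrable (fun v => f v * Real.log (f v))

/-- The normalization `ϱ = E = 1`, `u = 0`: mass `1`, momentum `0`, and energy
`∫ f |v|² dv = 3 ϱ E + ϱ |u|² = 3`. -/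
structure IsNormalized (f : V → ℝ) : Prop where
  mass : ∫ v, f v = 1
  momentum : ∫ v, f v • v = 0
  energy : ∫ v, f v * ‖v‖ ^ 2 = 3

/-- The class `𝒴₀(f_in)`: nonnegative functions in `L¹_2` with the mass, momentum and energy of
`f_in` and with entropy `H(f) ≤ H(f_in)`. For `f ∈ L¹_2` the negative part of `f log f` is
integrable, so that `H(f) ≤ H(f_in) < ∞` entails the integrability of `f log f`; it is
recorded as a field since otherwise the Bochner integral would not be the entropy. -/
structure ClassY0 (fin f : V → ℝ) : Prop where
  nonneg : ∀ v, 0 ≤ f v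
  memL1 : MemL1 2 f
  mass : ∫ v, f v = ∫ v, fin v
  momentum : ∫ v, f v • v = ∫ v, fin v • v
  energy : ∫ v, f v * ‖v‖ ^ 2 = ∫ v, fin v * ‖v‖ ^ 2
  entropy_finite : Integrable (fun v => f v * Real.log (f v))
  entropy_le : entropy f ≤ entropy fin

/-- `ξ = ∇ log g` in the weak sense: the weak gradient of `g` is the locally integrable field
`g ξ`, i.e. `∫ g ∂ᵢφ dv = - ∫ φ g ξᵢ dv` for all test functions `φ ∈ C_c^∞(ℝ³)`. This determines
`ξ` almost everywhere on `{g > 0}`, where it is `∇g / g`; the values of `ξ` on `{g = 0}` play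
no role. For a positive `g` of class `C¹` the classical `∇ log g` is such a field. -/
def IsWeakLogGradient (g : V → ℝ) (ξ : V → V) : Prop :=
  LocallyIntegrable (fun v => g v • ξ v) ∧
    ∀ φ : V → ℝ, ContDiff ℝ ∞ φ → HasCompactSupport φ → ∀ i : Fin 3,
      ∫ v, g v * fderiv ℝ φ v (EuclideanSpace.single i 1) = - ∫ v, φ v * (g v * ξ v i)

/-- `Π(z) y`, where `Π(z)_{ij} = δ_{ij} - z_i z_j / |z|²` is the orthogonal projection onto
`(ℝ z)^⊥`. -/
def proj (z y : V) : V := y - (inner ℝ z y / ‖z‖ ^ 2) • z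

/-- The Landau entropy production, an element of `[0, ∞]`,
`𝒟₀(g) = ½ ∫_{ℝ⁶} |v - v⁎|^{γ+2} g g⁎ |Π(v - v⁎)(∇ log g - ∇ log g⁎)|² dv dv⁎`,
where `ξ` stands for `∇ log g`. -/
def entropyProduction (γ : ℝ) (g : V → ℝ) (ξ : V → V) : ℝ≥0∞ :=
  2⁻¹ * ∫⁻ p : V × V, ENNReal.ofReal
    (‖p.1 - p.2‖ ^ (γ + 2) * (g p.1 * g p.2 * ‖proj (p.1 - p.2) (ξ p.1 - ξ p.2)‖ ^ 2))

/-- The standard Gaussian `ℳ₀(v) = (2π)^{-3/2} exp(-|v|²/2)`. -/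
def maxwellian (v : V) : ℝ := (2 * Real.pi) ^ (-(3 / 2) : ℝ) * Real.exp (-(‖v‖ ^ 2 / 2))

/-- `e_γ`, given by `1 / e_γ = min_i (1/3) ∫ g(v) v_i² dv`. -/
def eConst (g : V → ℝ) : ℝ≥0∞ :=
  (⨅ i : Fin 3, 3⁻¹ * ∫⁻ v, ENNReal.ofReal (g v * v i ^ 2))⁻¹

/-- `B_γ`, given by
`1 / B_γ = min_{i ≠ j} inf_{σ ∈ 𝕊¹} ∫ |σ₁ v_i / ⟨v⟩ - σ₂ v_j / ⟨v⟩|² g(v) dv`. -/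
def bConst (g : V → ℝ) : ℝ≥0∞ :=
  (⨅ (i : Fin 3) (j : Fin 3) (_ : i ≠ j)
    (σ ∈ Metric.sphere (0 : EuclideanSpace ℝ (Fin 2)) 1),
      ∫⁻ v, ENNReal.ofReal
        (|σ 0 * (v i / bracket v) - σ 1 * (v j / bracket v)| ^ 2 * g v))⁻¹

/-- `ℐ_γ(g) = sup_v ⟨v⟩^γ ∫ g(w) |w - v|^{-γ} ⟨w⟩² dw`, an element of `[0, ∞]`. -/
def iConst (γ : ℝ) (g : V → ℝ) : ℝ≥0∞ :=
  ⨆ v : V, ENNReal.ofReal (bracket v ^ γ) *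
    ∫⁻ w, ENNReal.ofReal (g w * ‖w - v‖ ^ (-γ) * bracket w ^ 2)

/-- `λ(g)`, given by `1 / λ(g) = 510 e_γ³ max(1, B_γ) max(1, m_{2+γ}(g)) ℐ_γ(g)`, with the
convention `1 / ∞ = 0`. -/
def lam (γ : ℝ) (g : V → ℝ) : ℝ≥0∞ :=
  (510 * eConst g ^ 3 * max 1 (bConst g) * max 1 (moment (2 + γ) g) * iConst γ g)⁻¹

end Landau

end

/-! Write $\xi=\nabla\log g$. By Lagrange's identity the entropy production only sees the cross
product $(v-w)\times(\xi(v)-\xi(w))$, and averaging its components against linear weights recovers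
the score. Choose an orthonormal basis that diagonalizes the covariance of $g$, with eigenvalues
$t_0+t_1+t_2=3$. For two basis vectors $a,b$ with eigenvalues $t_a,t_b$, multiplying the $(a,b)$
component by $b\cdot w$ and integrating against $g(w)\,dw$ leaves exactly $t_b\,a\cdot\xi(v)+a\cdot
v$: the other terms vanish by centring, by diagonality or by integration by parts
(`tendsto_integral_crossTerm`). Cauchy–Schwarz with the weights $|v-w|^{\pm\gamma}$ bounds the
$L^2(g)$ norm of this function by $\mathscr I_\gamma$ times the part of the production carried by
$(a,b)$ (`lintegral_score_le`).

Since $\int g\,(a\cdot v)(a\cdot\xi)=-1$, expanding the square gives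
$t_b^2F_a-2t_b+t_a\le\kappa_{ab}$ for the directional Fisher informations $F_a=\int
g\,(a\cdot\xi)^2$, where the $\kappa_{ab}$ sum to $2X$ with $X=\mathscr D_0(g)\,\mathscr
I_\gamma(g)$ (`score_bound`). In particular the Fisher information is finite, so the Gaussian
logarithmic Sobolev inequality applies (`IsFisherDensity.logSobolev`); with covariance
$\tau\,\mathrm{Id}$ it bounds the relative entropy $H$ to $\mathcal M_0$ by $\frac\tau2\sum_a
F_a-\frac32-\frac32\log\tau$ for every $\tau>0$. An elementary argument then gives $H\le 510\,X$
(`le_mul_of_score_bounds`): $\tau=1$ suffices unless one eigenvalue is close to $3$, and then $\tau$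
is taken as the square of the sum of the other two. As $\bm e_\gamma\ge1$, the other factors in
$1/\lambda(g)$ are at least $1$ and only make $\lambda(g)$ smaller (`lam_le`); they are finite
because $g$ has a density (`lam_pos`).

The logarithmic Sobolev inequality is proved by rotating two independent Gaussian variables: the
averages $u_\theta(x)=\int u(\cos\theta\,x+\sin\theta\,z)$ join $u$ to its mean, and the entropy
decreases at a rate controlled by the Fisher information of $u$ (`IsRegularDensity.entropy_le`).
Truncation, mollification and Fatou's lemma extend it to weak gradients. -/

namespace Landau
open Filter Topology

/-! ### Gaussian densities and Gaussian integration by parts -/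

/-- The density of the centred Gaussian on `V` with covariance `τ Id`. -/
noncomputable def gaussDensity (τ : ℝ) (x : V) : ℝ :=
  (2 * Real.pi * τ) ^ (-(3 / 2) : ℝ) * Real.exp (-(2 * τ)⁻¹ * ‖x‖ ^ 2)

lemma gaussDensity_pos {τ : ℝ} (hτ : 0 < τ) (x : V) : 0 < gaussDensity τ x := by
  unfold gaussDensity; positivity

lemma gaussDensity_one : gaussDensity 1 = maxwellian := by
  ext x; unfold gaussDensity maxwellian; congr 2
  · ring
  · ring

lemma contDiff_gaussDensity (τ : ℝ) : ContDiff ℝ ∞ (gaussDensity τ) := by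
  unfold gaussDensity
  exact contDiff_const.mul ((contDiff_const.mul (contDiff_norm_sq ℝ)).exp)

lemma measurable_gaussDensity (τ : ℝ) : Measurable (gaussDensity τ) :=
  (contDiff_gaussDensity τ).continuous.measurable

lemma hasFDerivAt_gaussDensity {τ : ℝ} (hτ : 0 < τ) (x : V) :
    HasFDerivAt (gaussDensity τ) ((-(gaussDensity τ x / τ)) • innerSL ℝ x) x := by
  have h := ((((hasStrictFDerivAt_norm_sq x).hasFDerivAt).const_mul (-(2 * τ)⁻¹)).exp).const_mul
    ((2 * Real.pi * τ) ^ (-(3 / 2) : ℝ))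
  refine h.congr_fderiv ?_
  ext y
  simp [gaussDensity]
  field_simp

lemma integral_exp_neg_mul_sq_norm {b : ℝ} (hb : 0 < b) :
    Integrable (fun x : V => Real.exp (-b * ‖x‖ ^ 2)) := by
  have := GaussianFourier.integrable_cexp_neg_mul_sq_norm_add (V := V) (b := (b : ℂ))
    (by simpa using hb) 0 0
  refine (this.norm).congr (Eventually.of_forall fun x => ?_)
  simp [Complex.norm_exp, ← Complex.ofReal_pow]

lemma integral_gaussDensity {τ : ℝ} (hτ : 0 < τ) : ∫ x, gaussDensity τ x = 1 := by
  unfold gaussDensity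
  rw [integral_const_mul, GaussianFourier.integral_rexp_neg_mul_sq_norm (by positivity)]
  rw [Real.rpow_neg (by positivity)]
  have : Real.pi / (2 * τ)⁻¹ = 2 * Real.pi * τ := by field_simp
  rw [this]
  simp
  exact inv_mul_cancel₀ (by positivity)

lemma integrable_gaussDensity {τ : ℝ} (hτ : 0 < τ) : Integrable (gaussDensity τ) :=
  (integral_exp_neg_mul_sq_norm (by positivity)).const_mul _

lemma integrable_norm_mul_gaussDensity {τ : ℝ} (hτ : 0 < τ) :
    Integrable (fun x => ‖x‖ * gaussDensity τ x) := by
  have h := ((integral_exp_neg_mul_sq_norm (b := (4 * τ)⁻¹) (by positivity)).const_mul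
    ((2 * Real.pi * τ) ^ (-(3 / 2) : ℝ) * (1 + 4 * τ)))
  refine h.mono' (by
    exact (continuous_norm.mul (contDiff_gaussDensity τ).continuous).aestronglyMeasurable)
    (Eventually.of_forall fun x => ?_)
  have hM := gaussDensity_pos hτ x
  rw [Real.norm_of_nonneg (by positivity)]
  unfold gaussDensity
  -- Half of the Gaussian decay absorbs the factor $|x|$; the other half stays integrable.
  have h1 : Real.exp (-(2 * τ)⁻¹ * ‖x‖ ^ 2)
      = Real.exp (-(4 * τ)⁻¹ * ‖x‖ ^ 2) * Real.exp (-(4 * τ)⁻¹ * ‖x‖ ^ 2) := by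
    rw [← Real.exp_add]; congr 1; field_simp; ring
  rw [h1]
  set e := Real.exp (-(4 * τ)⁻¹ * ‖x‖ ^ 2) with he
  have he0 : 0 < e := Real.exp_pos _
  have h2 : ‖x‖ * e ≤ 1 + 4 * τ := by
    have h3 : (4 * τ)⁻¹ * ‖x‖ ^ 2 + 1 ≤ e⁻¹ := by
      rw [he, ← Real.exp_neg]
      have := Real.add_one_le_exp (-(-(4 * τ)⁻¹ * ‖x‖ ^ 2))
      linarith
    have h4 : ‖x‖ ≤ (1 + 4 * τ) * ((4 * τ)⁻¹ * ‖x‖ ^ 2 + 1) := by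
      have : (1 + 4 * τ) * ((4 * τ)⁻¹ * ‖x‖ ^ 2 + 1)
        = (4 * τ)⁻¹ * ‖x‖ ^ 2 + 1 + ‖x‖ ^ 2 + 4 * τ := by field_simp; ring
      rw [this]
      have : 0 < (4 * τ)⁻¹ * ‖x‖ ^ 2 + 4 * τ := by positivity
      nlinarith [sq_nonneg (‖x‖ - 1)]
    calc ‖x‖ * e ≤ ((1 + 4 * τ) * e⁻¹) * e := by gcongr; exact h4.trans (by gcongr)
      _ = 1 + 4 * τ := by field_simp
  calc _ = (2 * Real.pi * τ) ^ (-(3 / 2) : ℝ) * (‖x‖ * e) * e := by ring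
    _ ≤ _ := by gcongr

/-- The centred Gaussian measure on `V` with covariance `τ Id`. -/
noncomputable def gaussMeasure (τ : ℝ) : Measure V :=
  volume.withDensity fun x => ENNReal.ofReal (gaussDensity τ x)

lemma isProbabilityMeasure_gaussMeasure {τ : ℝ} (hτ : 0 < τ) :
    IsProbabilityMeasure (gaussMeasure τ) := by
  constructor
  rw [gaussMeasure, withDensity_apply _ MeasurableSet.univ, setLIntegral_univ,
    ← ofReal_integral_eq_lintegral_ofReal (integrable_gaussDensity hτ)
      (Eventually.of_forall fun x => (gaussDensity_pos hτ x).le), integral_gaussDensity hτ]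
  simp

lemma integral_gaussMeasure {τ : ℝ} (hτ : 0 < τ) (f : V → ℝ) :
    ∫ x, f x ∂gaussMeasure τ = ∫ x, gaussDensity τ x * f x := by
  rw [gaussMeasure, integral_withDensity_eq_integral_toReal_smul
    (measurable_gaussDensity τ).ennreal_ofReal (by simp)]
  simp [ENNReal.toReal_ofReal (gaussDensity_pos hτ _).le]

lemma integrable_gaussMeasure {τ : ℝ} (hτ : 0 < τ) (f : V → ℝ) :
    Integrable f (gaussMeasure τ) ↔ Integrable fun x => gaussDensity τ x * f x := by
  rw [gaussMeasure, integrable_withDensity_iff_integrable_smul'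
    (measurable_gaussDensity τ).ennreal_ofReal (by simp)]
  simp [ENNReal.toReal_ofReal (gaussDensity_pos hτ _).le]

lemma integrable_norm_gaussMeasure {τ : ℝ} (hτ : 0 < τ) :
    Integrable (fun x => ‖x‖) (gaussMeasure τ) := by
  rw [integrable_gaussMeasure hτ]
  simpa [mul_comm] using integrable_norm_mul_gaussDensity hτ

/-- Gaussian integration by parts in the direction `a`. -/
lemma integral_inner_mul_gaussMeasure {τ : ℝ} (hτ : 0 < τ) {f : V → ℝ} (hf : ContDiff ℝ 1 f)
    {C L : ℝ} (hC : ∀ x, |f x| ≤ C) (hL : ∀ x, ‖fderiv ℝ f x‖ ≤ L) (a : V) :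
    ∫ x, inner ℝ a x * f x ∂gaussMeasure τ = τ * ∫ x, fderiv ℝ f x a ∂gaussMeasure τ := by
  rw [integral_gaussMeasure hτ, integral_gaussMeasure hτ]
  have hM : ∀ x, fderiv ℝ (gaussDensity τ) x a = -(τ⁻¹) * (gaussDensity τ x * inner ℝ a x) := by
    intro x
    rw [(hasFDerivAt_gaussDensity hτ x).fderiv]
    simp [real_inner_comm]; ring
  have hMc := (contDiff_gaussDensity τ).continuous
  have hfc := hf.continuous
  have hf' : Continuous fun x => fderiv ℝ f x a :=
    (hf.continuous_fderiv (by simp)).clm_apply continuous_const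
  have h1 : Integrable fun x => gaussDensity τ x * fderiv ℝ f x a := by
    refine ((integrable_gaussDensity hτ).mul_const (L * ‖a‖)).mono'
      (hMc.mul hf').aestronglyMeasurable (Eventually.of_forall fun x => ?_)
    rw [norm_mul, Real.norm_of_nonneg (gaussDensity_pos hτ x).le]
    gcongr
    · exact (gaussDensity_pos hτ x).le
    · exact (ContinuousLinearMap.le_opNorm _ _).trans (by gcongr; exact hL x)
  have h2 : Integrable fun x => (gaussDensity τ x * inner ℝ a x) * f x := by
    have hc : Continuous fun x : V => inner ℝ a x := by fun_prop
    refine ((integrable_norm_mul_gaussDensity hτ).mul_const (‖a‖ * C)).mono'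
      ((hMc.mul hc).mul hfc).aestronglyMeasurable
      (Eventually.of_forall fun x => ?_)
    rw [norm_mul, norm_mul, Real.norm_of_nonneg (gaussDensity_pos hτ x).le]
    have h3 := norm_inner_le_norm (𝕜 := ℝ) a x
    have hC0 : 0 ≤ C := (abs_nonneg _).trans (hC x)
    have hp := (gaussDensity_pos hτ x).le
    calc _ ≤ gaussDensity τ x * (‖a‖ * ‖x‖) * C := by gcongr; exact hC x
      _ = _ := by ring
  have h3 : Integrable fun x => gaussDensity τ x * f x := by
    refine ((integrable_gaussDensity hτ).mul_const C).mono'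
      (hMc.mul hfc).aestronglyMeasurable (Eventually.of_forall fun x => ?_)
    rw [norm_mul, Real.norm_of_nonneg (gaussDensity_pos hτ x).le]
    have hp := (gaussDensity_pos hτ x).le
    gcongr
    exact hC x
  have key := integral_mul_fderiv_eq_neg_fderiv_mul_of_integrable (μ := (volume : Measure V))
    (f := gaussDensity τ) (g := f) (v := a) (by
      simp_rw [hM]
      refine (h2.const_mul (-τ⁻¹)).congr (Eventually.of_forall fun x => ?_)
      simp only; ring) h1 h3 (fun x _ => (contDiff_gaussDensity τ).differentiable (by simp) x)
      (fun x _ => hf.differentiable (by simp) x)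
  rw [key]
  simp_rw [hM]
  rw [← integral_neg, ← integral_const_mul]
  congr 1; ext x; field_simp

/-! ### Rotation invariance of pairs of Gaussian variables -/

/-- The planar rotation of angle `θ` with cosine `c` and sine `s`, acting on pairs of velocities. -/
def pairRotation (c s : ℝ) (p : V × V) : V × V := (c • p.1 + s • p.2, -(s • p.1) + c • p.2)

/-- A planar rotation is a product of three shears with coefficients $\tan(\theta/2)$,
$-\sin\theta$, $\tan(\theta/2)$, where $\tan(\theta/2)=(1-c)/s$. Each shear translates one variable
by an amount depending on the other, so it preserves volume by Fubini. -/
lemma measurePreserving_pairRotation_volume {c s : ℝ} (hcs : c ^ 2 + s ^ 2 = 1) (hs : s ≠ 0) :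
    MeasurePreserving (pairRotation c s) := by
  have hB : ∀ r : ℝ, MeasurePreserving (fun p : V × V => (p.1, p.2 + r • p.1)) := by
    intro r
    refine (MeasurePreserving.id (volume : Measure V)).skew_product
      (g := fun x z => z + r • x) (by fun_prop) (Eventually.of_forall fun x => ?_)
    exact (measurePreserving_add_right (volume : Measure V) (r • x)).map_eq
  have hA : ∀ r : ℝ, MeasurePreserving (fun p : V × V => (p.1 + r • p.2, p.2)) := by
    intro r
    have hsw : MeasurePreserving (Prod.swap : V × V → V × V) := Measure.measurePreserving_swap
    exact hsw.comp ((hB r).comp hsw)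
  have h := (hA ((1 - c) / s)).comp ((hB (-s)).comp (hA ((1 - c) / s)))
  convert h using 1
  ext p : 1
  have e1 : s * ((1 - c) / s) = 1 - c := by field_simp
  have e2 : (1 - c) / s * c + (1 - c) / s = s := by field_simp; nlinarith
  simp only [pairRotation, Function.comp]
  have e3 : p.2 + -s • (p.1 + ((1 - c) / s) • p.2) = -(s • p.1) + c • p.2 := by
    rw [smul_add, smul_smul, neg_mul, e1]; module
  rw [e3]
  congr 1
  rw [smul_add, smul_neg, smul_smul, smul_smul, mul_comm _ s, e1]
  have : s • p.2 = ((1 - c) / s * c + (1 - c) / s) • p.2 := by rw [e2]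
  rw [this]; module

lemma measurable_pairRotation (c s : ℝ) : Measurable (pairRotation c s) := by
  unfold pairRotation; fun_prop

/-- The product density depends only on $|x|^2+|y|^2$, which the rotation preserves. -/
lemma measurePreserving_pairRotation {τ c s : ℝ} (hcs : c ^ 2 + s ^ 2 = 1)
    (hs : s ≠ 0) : MeasurePreserving (pairRotation c s)
      ((gaussMeasure τ).prod (gaussMeasure τ)) ((gaussMeasure τ).prod (gaussMeasure τ)) := by
  have hm := (measurable_gaussDensity τ).ennreal_ofReal
  refine ⟨measurable_pairRotation c s, ?_⟩
  have h0 : (gaussMeasure τ).prod (gaussMeasure τ) = (volume : Measure (V × V)).withDensity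
      (fun p => ENNReal.ofReal (gaussDensity τ p.1) * ENNReal.ofReal (gaussDensity τ p.2)) := by
    rw [gaussMeasure, prod_withDensity hm hm]; rfl
  have hinv : ∀ p : V × V,
      ENNReal.ofReal (gaussDensity τ (pairRotation c s p).1)
        * ENNReal.ofReal (gaussDensity τ (pairRotation c s p).2)
      = ENNReal.ofReal (gaussDensity τ p.1) * ENNReal.ofReal (gaussDensity τ p.2) := by
    intro p
    have hn : ‖(pairRotation c s p).1‖ ^ 2 + ‖(pairRotation c s p).2‖ ^ 2
        = ‖p.1‖ ^ 2 + ‖p.2‖ ^ 2 := by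
      simp only [pairRotation]
      rw [neg_add_eq_sub, norm_sub_sq_real, norm_add_sq_real, norm_smul, norm_smul, norm_smul,
        norm_smul, real_inner_smul_left, real_inner_smul_left, real_inner_smul_right,
        real_inner_smul_right, real_inner_comm p.1 p.2]
      simp only [mul_pow, Real.norm_eq_abs, sq_abs]
      linear_combination (‖p.1‖ ^ 2 + ‖p.2‖ ^ 2) * hcs
    have hg : ∀ x y : V, gaussDensity τ x * gaussDensity τ y
        = ((2 * Real.pi * τ) ^ (-(3 / 2) : ℝ)) ^ 2
          * Real.exp (-(2 * τ)⁻¹ * (‖x‖ ^ 2 + ‖y‖ ^ 2)) := by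
      intro x y
      rw [mul_add, Real.exp_add]; unfold gaussDensity; ring
    -- The sign of $\tau$ is not prescribed. If the normalizing factor is not positive,
    -- `ENNReal.ofReal` turns the density into $0$ and invariance is trivial.
    by_cases hτ : 0 ≤ gaussDensity τ 0
    · have hK : 0 ≤ (2 * Real.pi * τ) ^ (-(3 / 2) : ℝ) := by simpa [gaussDensity] using hτ
      have hpos : ∀ x, 0 ≤ gaussDensity τ x := fun x => by unfold gaussDensity; positivity
      rw [← ENNReal.ofReal_mul (hpos _), ← ENNReal.ofReal_mul (hpos _), hg, hg, hn]
    · have hK : (2 * Real.pi * τ) ^ (-(3 / 2) : ℝ) ≤ 0 := by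
        have := (not_le.1 hτ).le
        simpa [gaussDensity] using this
      have hneg : ∀ x, ENNReal.ofReal (gaussDensity τ x) = 0 := fun x => by
        rw [ENNReal.ofReal_eq_zero]
        exact mul_nonpos_of_nonpos_of_nonneg hK (Real.exp_pos _).le
      simp [hneg]
  rw [h0]
  ext S hS
  have hvol := measurePreserving_pairRotation_volume hcs hs
  have hp := hvol.setLIntegral_comp_preimage hS (f := fun p : V × V =>
    ENNReal.ofReal (gaussDensity τ p.1) * ENNReal.ofReal (gaussDensity τ p.2))
    ((hm.comp measurable_fst).mul (hm.comp measurable_snd))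
  rw [Measure.map_apply (measurable_pairRotation c s) hS, withDensity_apply _ hS,
    withDensity_apply _ (measurable_pairRotation c s hS), ← hp]
  simp_rw [hinv]

/-! ### The logarithmic Sobolev inequality for regular densities -/

/-- Data for the Gaussian logarithmic Sobolev inequality in the regular case: a function of class
`C¹` with gradient `G`, bounded above and away from `0`, with bounded gradient. -/
structure IsRegularDensity (u : V → ℝ) (G : V → V) (c₀ C L : ℝ) : Prop where
  hasFDerivAt : ∀ x, HasFDerivAt u (innerSL ℝ (G x)) x
  continuous_grad : Continuous G
  pos : 0 < c₀
  lower : ∀ x, c₀ ≤ u x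
  upper : ∀ x, u x ≤ C
  grad_le : ∀ x, ‖G x‖ ≤ L

/-- The Gaussian average `x ↦ ∫ u (c x + s z) dπ(z)`. -/
noncomputable def gaussAverage {E : Type*} [NormedAddCommGroup E] [NormedSpace ℝ E] (τ : ℝ)
    (u : V → E) (c s : ℝ) (x : V) : E :=
  ∫ z, u (c • x + s • z) ∂gaussMeasure τ

lemma integral_pairRotation {τ c s : ℝ} (hcs : c ^ 2 + s ^ 2 = 1) (hs : s ≠ 0)
    {f : V × V → ℝ} (hf : Continuous f) :
    ∫ p, f (pairRotation c s p) ∂(gaussMeasure τ).prod (gaussMeasure τ)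
      = ∫ p, f p ∂(gaussMeasure τ).prod (gaussMeasure τ) := by
  have h := measurePreserving_pairRotation (τ := τ) hcs hs
  conv_rhs => rw [← h.map_eq]
  rw [integral_map (measurable_pairRotation c s).aemeasurable hf.aestronglyMeasurable]

lemma integrable_pair_of_bound {τ : ℝ} (hτ : 0 < τ) {f : V × V → ℝ} (hf : Continuous f) {K : ℝ}
    (hK : ∀ p, |f p| ≤ K * (1 + ‖p.1‖ + ‖p.2‖)) :
    Integrable f ((gaussMeasure τ).prod (gaussMeasure τ)) := by
  have := isProbabilityMeasure_gaussMeasure hτ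
  have h1 := integrable_norm_gaussMeasure hτ
  have h2 : Integrable (fun p : V × V => K * (1 + ‖p.1‖ + ‖p.2‖))
      ((gaussMeasure τ).prod (gaussMeasure τ)) :=
    (((integrable_const _).add (h1.comp_fst _)).add (h1.comp_snd _)).const_mul K
  exact h2.mono' hf.aestronglyMeasurable (Eventually.of_forall hK)

namespace IsRegularDensity

variable {u : V → ℝ} {G : V → V} {c₀ C L τ : ℝ}

lemma bound_nonneg (h : IsRegularDensity u G c₀ C L) : 0 ≤ L := (norm_nonneg _).trans (h.grad_le 0)

lemma continuous (h : IsRegularDensity u G c₀ C L) : Continuous u :=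
  continuous_iff_continuousAt.2 fun x => (h.hasFDerivAt x).continuousAt

lemma abs_le (h : IsRegularDensity u G c₀ C L) (x : V) : |u x| ≤ C := by
  rw [abs_of_pos (h.pos.trans_le (h.lower x))]; exact h.upper x

lemma integrable_comp (h : IsRegularDensity u G c₀ C L) (hτ : 0 < τ) (c s : ℝ) (x : V) :
    Integrable (fun z => u (c • x + s • z)) (gaussMeasure τ) := by
  have := isProbabilityMeasure_gaussMeasure hτ
  refine (integrable_const C).mono' (h.continuous.comp (by fun_prop)).aestronglyMeasurable
    (Eventually.of_forall fun z => h.abs_le _)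

lemma integrable_grad_comp (h : IsRegularDensity u G c₀ C L) (hτ : 0 < τ) (c s : ℝ) (x : V) :
    Integrable (fun z => G (c • x + s • z)) (gaussMeasure τ) := by
  have := isProbabilityMeasure_gaussMeasure hτ
  refine (integrable_const L).mono' (h.continuous_grad.comp (by fun_prop)).aestronglyMeasurable
    (Eventually.of_forall fun z => h.grad_le _)

lemma le_average (h : IsRegularDensity u G c₀ C L) (hτ : 0 < τ) (c s : ℝ) (x : V) :
    c₀ ≤ gaussAverage τ u c s x := by
  have := isProbabilityMeasure_gaussMeasure hτ
  simpa [gaussAverage] using integral_mono (integrable_const c₀) (h.integrable_comp hτ c s x) fun z => h.lower _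

lemma average_le (h : IsRegularDensity u G c₀ C L) (hτ : 0 < τ) (c s : ℝ) (x : V) :
    gaussAverage τ u c s x ≤ C := by
  have := isProbabilityMeasure_gaussMeasure hτ
  simpa [gaussAverage] using integral_mono (h.integrable_comp hτ c s x) (integrable_const C) fun z => h.upper _

lemma norm_average_grad_le (h : IsRegularDensity u G c₀ C L) (hτ : 0 < τ) (c s : ℝ) (x : V) :
    ‖gaussAverage τ G c s x‖ ≤ L := by
  have := isProbabilityMeasure_gaussMeasure hτ
  simpa [gaussAverage] using norm_integral_le_of_norm_le_const (μ := gaussMeasure τ)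
    (f := fun z => G (c • x + s • z)) (C := L) (Eventually.of_forall fun z => h.grad_le _)

lemma continuous_average_grad (h : IsRegularDensity u G c₀ C L) (hτ : 0 < τ) (c s : ℝ) :
    Continuous (gaussAverage τ G c s) := by
  have := isProbabilityMeasure_gaussMeasure hτ
  refine continuous_of_dominated (bound := fun _ => L) (fun x => ?_) (fun x => ?_)
    (integrable_const L) ?_
  · exact (h.continuous_grad.comp (by fun_prop)).aestronglyMeasurable
  · exact Eventually.of_forall fun z => h.grad_le _
  · exact Eventually.of_forall fun z => h.continuous_grad.comp (by fun_prop)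

lemma hasFDerivAt_average (h : IsRegularDensity u G c₀ C L) (hτ : 0 < τ) (c s : ℝ) (x : V) :
    HasFDerivAt (gaussAverage τ u c s) (c • innerSL ℝ (gaussAverage τ G c s x)) x := by
  have := isProbabilityMeasure_gaussMeasure hτ
  have key := hasFDerivAt_integral_of_dominated_of_fderiv_le (𝕜 := ℝ) (μ := gaussMeasure τ)
    (F := fun x z => u (c • x + s • z)) (F' := fun x z => c • innerSL ℝ (G (c • x + s • z)))
    (x₀ := x) (s := Set.univ) (bound := fun _ => |c| * L) univ_mem
    (Eventually.of_forall fun x => (h.integrable_comp hτ c s x).aestronglyMeasurable)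
    (h.integrable_comp hτ c s x)
    (by
      have := h.continuous_grad
      exact (Continuous.const_smul ((innerSL ℝ).continuous.comp (this.comp (by fun_prop)))
        c).aestronglyMeasurable)
    (Eventually.of_forall fun z y _ => by
      rw [norm_smul, Real.norm_eq_abs, innerSL_apply_norm]
      gcongr; exact h.grad_le _)
    (integrable_const _)
    (Eventually.of_forall fun z y _ => by
      have h1 : HasFDerivAt (fun y : V => c • y + s • z) (c • ContinuousLinearMap.id ℝ V) y :=
        ((hasFDerivAt_id y).const_smul c).add_const _
      refine ((h.hasFDerivAt _).comp y h1).congr_fderiv ?_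
      ext v; simp)
  refine key.congr_fderiv ?_
  rw [integral_smul]
  congr 1
  exact (innerSL ℝ (E := V)).integral_comp_comm (h.integrable_grad_comp hτ c s x)

lemma integrable_directional (h : IsRegularDensity u G c₀ C L) (hτ : 0 < τ) (c s : ℝ) (x : V) :
    Integrable (fun z => inner ℝ (G (c • x + s • z)) (-(s • x) + c • z)) (gaussMeasure τ) := by
  have := isProbabilityMeasure_gaussMeasure hτ
  have hG := h.continuous_grad
  refine ((integrable_const (L * (|s| * ‖x‖))).add
    ((integrable_norm_gaussMeasure hτ).const_mul (L * |c|))).mono'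
    (Continuous.aestronglyMeasurable (by fun_prop)) (Eventually.of_forall fun z => ?_)
  have hL := h.bound_nonneg
  refine (norm_inner_le_norm _ _).trans ?_
  calc _ ≤ L * (|s| * ‖x‖ + |c| * ‖z‖) := by
        gcongr
        · exact h.grad_le _
        · refine (norm_add_le _ _).trans (by simp [norm_smul])
    _ = _ := by simp only [Pi.add_apply]; ring

lemma hasDerivAt_average (h : IsRegularDensity u G c₀ C L) (hτ : 0 < τ) (θ : ℝ) (x : V) :
    HasDerivAt (fun θ => gaussAverage τ u (Real.cos θ) (Real.sin θ) x)
      (∫ z, inner ℝ (G (Real.cos θ • x + Real.sin θ • z)) (-(Real.sin θ • x) + Real.cos θ • z)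
        ∂gaussMeasure τ) θ := by
  have := isProbabilityMeasure_gaussMeasure hτ
  have hL := h.bound_nonneg
  refine (hasDerivAt_integral_of_dominated_loc_of_deriv_le (𝕜 := ℝ) (μ := gaussMeasure τ)
    (F := fun θ z => u (Real.cos θ • x + Real.sin θ • z))
    (F' := fun θ z => inner ℝ (G (Real.cos θ • x + Real.sin θ • z))
      (-(Real.sin θ • x) + Real.cos θ • z))
    (x₀ := θ) (s := Set.univ) (bound := fun z => L * (‖x‖ + ‖z‖)) univ_mem
    (Eventually.of_forall fun θ => (h.integrable_comp hτ _ _ x).aestronglyMeasurable)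
    (h.integrable_comp hτ _ _ x) (h.integrable_directional hτ _ _ x).aestronglyMeasurable
    (Eventually.of_forall fun z φ _ => ?_)
    (((integrable_const _).add (integrable_norm_gaussMeasure hτ)).const_mul L)
    (Eventually.of_forall fun z φ _ => ?_)).2
  · refine (norm_inner_le_norm _ _).trans ?_
    gcongr
    · exact h.grad_le _
    · refine (norm_add_le _ _).trans ?_
      rw [norm_neg, norm_smul, norm_smul]
      have h1 := Real.abs_sin_le_one φ
      have h2 := Real.abs_cos_le_one φ
      simp only [Real.norm_eq_abs]
      nlinarith [norm_nonneg x, norm_nonneg z]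
  · have h1 : HasDerivAt (fun φ : ℝ => Real.cos φ • x + Real.sin φ • z)
        (-(Real.sin φ • x) + Real.cos φ • z) φ := by
      simpa using ((Real.hasDerivAt_cos φ).smul_const x).fun_add ((Real.hasDerivAt_sin φ).smul_const z)
    exact (h.hasFDerivAt _).comp_hasDerivAt φ h1

end IsRegularDensity
namespace IsRegularDensity

variable {u : V → ℝ} {G : V → V} {c₀ C L τ : ℝ}

lemma continuous_average (h : IsRegularDensity u G c₀ C L) (hτ : 0 < τ) (c s : ℝ) :
    Continuous (gaussAverage τ u c s) :=
  continuous_iff_continuousAt.2 fun x => (h.hasFDerivAt_average hτ c s x).continuousAt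

lemma average_pos (h : IsRegularDensity u G c₀ C L) (hτ : 0 < τ) (c s : ℝ) (x : V) :
    0 < gaussAverage τ u c s x := h.pos.trans_le (h.le_average hτ c s x)

lemma hasFDerivAt_log_average (h : IsRegularDensity u G c₀ C L) (hτ : 0 < τ) (c s : ℝ) (x : V) :
    HasFDerivAt (fun x => Real.log (gaussAverage τ u c s x) + 1)
      (innerSL ℝ ((c / gaussAverage τ u c s x) • gaussAverage τ G c s x)) x := by
  refine (((h.hasFDerivAt_average hτ c s x).log (h.average_pos hτ c s x).ne').add_const 1
    ).congr_fderiv ?_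
  ext v
  simp [div_eq_mul_inv]
  ring

lemma continuous_log_grad (h : IsRegularDensity u G c₀ C L) (hτ : 0 < τ) (c s : ℝ) :
    Continuous fun x => (c / gaussAverage τ u c s x) • gaussAverage τ G c s x :=
  (continuous_const.div (h.continuous_average hτ c s)
    fun x => (h.average_pos hτ c s x).ne').smul (h.continuous_average_grad hτ c s)

lemma norm_log_grad_le (h : IsRegularDensity u G c₀ C L) (hτ : 0 < τ) (c s : ℝ) (x : V) :
    ‖(c / gaussAverage τ u c s x) • gaussAverage τ G c s x‖ ≤ |c| / c₀ * L := by
  rw [norm_smul, norm_div, Real.norm_eq_abs, Real.norm_of_nonneg (h.average_pos hτ c s x).le]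
  have := h.pos
  gcongr
  · exact h.le_average hτ c s x
  · exact h.norm_average_grad_le hτ c s x

lemma abs_log_le_of_mem (h : IsRegularDensity u G c₀ C L) {r : ℝ} (h1 : c₀ ≤ r) (h2 : r ≤ C) :
    |Real.log r| ≤ |Real.log c₀| + |Real.log C| := by
  have a1 := Real.log_le_log h.pos h1
  have a2 := Real.log_le_log (h.pos.trans_le h1) h2
  have a3 := neg_abs_le (Real.log c₀)
  have a4 := le_abs_self (Real.log C)
  have a5 := abs_nonneg (Real.log c₀)
  have a6 := abs_nonneg (Real.log C)
  rw [_root_.abs_le]; constructor <;> linarith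

lemma abs_log_average_le (h : IsRegularDensity u G c₀ C L) (hτ : 0 < τ) (c s : ℝ) (x : V) :
    |Real.log (gaussAverage τ u c s x) + 1| ≤ |Real.log c₀| + |Real.log C| + 1 :=
  (abs_add_le _ _).trans (by
    rw [abs_one]
    gcongr
    exact h.abs_log_le_of_mem (h.le_average hτ c s x) (h.average_le hτ c s x))

/-- The derivative of the entropy along the rotation is minus a multiple of the Fisher
information of the Gaussian average. -/
lemma integral_deriv_mul_log (h : IsRegularDensity u G c₀ C L) (hτ : 0 < τ) {c s : ℝ}
    (hcs : c ^ 2 + s ^ 2 = 1) (hs : s ≠ 0) :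
    ∫ x, (∫ z, inner ℝ (G (c • x + s • z)) (-(s • x) + c • z) ∂gaussMeasure τ) *
        (Real.log (gaussAverage τ u c s x) + 1) ∂gaussMeasure τ
      = -(τ * s * c) * ∫ x, ‖gaussAverage τ G c s x‖ ^ 2 / gaussAverage τ u c s x
          ∂gaussMeasure τ := by
  have := isProbabilityMeasure_gaussMeasure hτ
  set ℓ : V → ℝ := fun x => Real.log (gaussAverage τ u c s x) + 1 with hℓ
  set D : V → V := fun x => (c / gaussAverage τ u c s x) • gaussAverage τ G c s x with hD
  set K := |Real.log c₀| + |Real.log C| + 1 with hK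
  have hK0 : 0 ≤ K := by positivity
  have hL := h.bound_nonneg
  have hG := h.continuous_grad
  have hDc : Continuous D := h.continuous_log_grad hτ c s
  have hℓd : ∀ x, HasFDerivAt ℓ (innerSL ℝ (D x)) x := h.hasFDerivAt_log_average hτ c s
  have hℓ1 : ContDiff ℝ 1 ℓ :=
    contDiff_one_iff_hasFDerivAt.2 ⟨_, (innerSL ℝ).continuous.comp hDc, hℓd⟩
  have hℓc : Continuous ℓ := hℓ1.continuous
  have hℓK : ∀ x, |ℓ x| ≤ K := h.abs_log_average_le hτ c s
  have hDK : ∀ x, ‖D x‖ ≤ |c| / c₀ * L := h.norm_log_grad_le hτ c s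
  have hc₀ := h.pos
  -- In the rotated variables $(y,w)=(cx+sz,\,-sx+cz)$ the old variable is $x=cy-sw$ and the
  -- directional derivative becomes $G(y)\cdot w$. It is linear in $w$, which prepares a Gaussian
  -- integration by parts in $w$ alone.
  let H : V × V → ℝ := fun p => inner ℝ (G p.1) p.2 * ℓ (c • p.1 - s • p.2)
  have hHc : Continuous H := by fun_prop
  have hHi : Integrable H ((gaussMeasure τ).prod (gaussMeasure τ)) := by
    refine integrable_pair_of_bound hτ hHc (K := L * K) fun p => ?_
    simp only [H]
    rw [abs_mul]
    have h1 : |inner ℝ (G p.1) p.2| ≤ L * (1 + ‖p.1‖ + ‖p.2‖) := by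
      refine (abs_real_inner_le_norm _ _).trans ?_
      gcongr
      · exact h.grad_le _
      · have := norm_nonneg p.1; linarith
    calc _ ≤ (L * (1 + ‖p.1‖ + ‖p.2‖)) * K := by gcongr; exact hℓK _
      _ = _ := by ring
  have hH'i : Integrable (fun p => H (pairRotation c s p))
      ((gaussMeasure τ).prod (gaussMeasure τ)) :=
    (measurePreserving_pairRotation hcs hs).integrable_comp_of_integrable hHi
  let H' : V × V → ℝ := fun p => inner ℝ (G p.1) (D (c • p.1 - s • p.2))
  have hH'c : Continuous H' := by fun_prop
  have hH'i' : Integrable H' ((gaussMeasure τ).prod (gaussMeasure τ)) := by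
    refine integrable_pair_of_bound hτ hH'c (K := L * (|c| / c₀ * L)) fun p => ?_
    refine (abs_real_inner_le_norm _ _).trans ?_
    calc _ ≤ L * (|c| / c₀ * L) * 1 := by
          rw [mul_one]; gcongr
          · exact h.grad_le _
          · exact hDK _
      _ ≤ _ := by gcongr; have := norm_nonneg p.1; have := norm_nonneg p.2; linarith
  have hback : ∀ p : V × V,
      c • (pairRotation c s p).1 - s • (pairRotation c s p).2 = p.1 := by
    intro p
    simp only [pairRotation]
    have : p.1 = (c ^ 2 + s ^ 2) • p.1 := by rw [hcs, one_smul]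
    conv_rhs => rw [this]
    module
  calc
    _ = ∫ x, ∫ z, H (pairRotation c s (x, z)) ∂gaussMeasure τ ∂gaussMeasure τ := by
        congr 1; ext x
        rw [← integral_mul_const]
        congr 1; ext z
        simp only [H, hback]
        rfl
    _ = ∫ p, H (pairRotation c s p) ∂(gaussMeasure τ).prod (gaussMeasure τ) :=
        (integral_prod _ hH'i).symm
    _ = ∫ p, H p ∂(gaussMeasure τ).prod (gaussMeasure τ) := integral_pairRotation hcs hs hHc
    _ = ∫ y, ∫ w, H (y, w) ∂gaussMeasure τ ∂gaussMeasure τ := integral_prod _ hHi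
    -- Integration by parts in $w$: the factor $w$ costs $\tau$, and differentiating $\ell(cy-sw)$
    -- in $w$ produces $-s$.
    _ = ∫ y, ∫ w, (-(τ * s)) * H' (y, w) ∂gaussMeasure τ ∂gaussMeasure τ := by
        congr 1; ext y
        have hcomp : ∀ w, HasFDerivAt (fun w => ℓ (c • y - s • w))
            (innerSL ℝ ((-s) • D (c • y - s • w))) w := by
          intro w
          have h1 : HasFDerivAt (fun w : V => c • y - s • w)
              (-(s • ContinuousLinearMap.id ℝ V)) w :=
            ((hasFDerivAt_id w).const_smul s).const_sub _
          refine ((hℓd _).comp w h1).congr_fderiv ?_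
          ext v; simp
        have h1 := integral_inner_mul_gaussMeasure hτ (f := fun w => ℓ (c • y - s • w))
          (hℓ1.comp (by fun_prop)) (C := K) (L := |s| * (|c| / c₀ * L)) (fun w => hℓK _)
          (fun w => by
            rw [(hcomp w).fderiv, innerSL_apply_norm, norm_smul, norm_neg, Real.norm_eq_abs]
            gcongr; exact hDK _) (G y)
        simp only [H]
        rw [h1, ← integral_const_mul]
        congr 1; ext w
        rw [(hcomp w).fderiv]
        simp only [innerSL_apply_apply, H', real_inner_smul_left]
        rw [real_inner_comm]; ring
    _ = ∫ p, (-(τ * s)) * H' p ∂(gaussMeasure τ).prod (gaussMeasure τ) :=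
        (integral_prod _ (hH'i'.const_mul _)).symm
    _ = -(τ * s) * ∫ p, H' (pairRotation c s p) ∂(gaussMeasure τ).prod (gaussMeasure τ) := by
        rw [integral_const_mul, integral_pairRotation hcs hs hH'c]
    _ = -(τ * s) * ∫ x, ∫ z, inner ℝ (G (c • x + s • z)) (D x)
          ∂gaussMeasure τ ∂gaussMeasure τ := by
        rw [integral_prod (fun p => H' (pairRotation c s p))
          ((measurePreserving_pairRotation hcs hs).integrable_comp_of_integrable hH'i')]
        simp only [H', hback]
        rfl
    _ = _ := by
        rw [neg_mul, neg_mul, neg_inj, mul_assoc (τ * s), ← integral_const_mul c]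
        congr 2; ext x
        -- Back in the variables $(x,z)$, the vector $D(x)$ does not depend on $z$, so only the
        -- average of $G$ remains; $D$ is itself a multiple of that average, whence the square.
        have h1 : ∫ z, inner ℝ (G (c • x + s • z)) (D x) ∂gaussMeasure τ
            = inner ℝ (gaussAverage τ G c s x) (D x) := by
          rw [real_inner_comm, gaussAverage, ← integral_inner (h.integrable_grad_comp hτ c s x)]
          congr 1; ext z; rw [real_inner_comm]
        rw [h1]
        simp only [hD, real_inner_smul_right, real_inner_self_eq_norm_sq]
        ring

/-- Jensen's inequality for $(y,r)\mapsto|y|^2/r$, which is jointly convex on $r>0$. -/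
lemma norm_sq_average_grad_le (h : IsRegularDensity u G c₀ C L) (hτ : 0 < τ) (c s : ℝ) (x : V) :
    ‖gaussAverage τ G c s x‖ ^ 2 / gaussAverage τ u c s x
      ≤ ∫ z, ‖G (c • x + s • z)‖ ^ 2 / u (c • x + s • z) ∂gaussMeasure τ := by
  have := isProbabilityMeasure_gaussMeasure hτ
  set a := gaussAverage τ G c s x
  set m := gaussAverage τ u c s x with hm
  have hm0 : 0 < m := h.average_pos hτ c s x
  have hG := h.continuous_grad
  have hu := h.continuous
  have hpos : ∀ y, 0 < u y := fun y => h.pos.trans_le (h.lower y)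
  have i1 : Integrable (fun z => ‖G (c • x + s • z)‖ ^ 2 / u (c • x + s • z))
      (gaussMeasure τ) := by
    refine (integrable_const (L ^ 2 / c₀)).mono' (Continuous.aestronglyMeasurable
      (Continuous.div (by fun_prop) (by fun_prop) fun z => (hpos _).ne'))
      (Eventually.of_forall fun z => ?_)
    rw [Real.norm_of_nonneg (div_nonneg (sq_nonneg _) (hpos _).le)]
    have := h.pos
    gcongr
    · exact h.grad_le _
    · exact h.lower _
  have i2 : Integrable (fun z => inner ℝ a (G (c • x + s • z))) (gaussMeasure τ) :=
    (h.integrable_grad_comp hτ c s x).const_inner a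
  have i3 := h.integrable_comp hτ c s x
  -- The graph of $|y|^2/r$ lies above its tangent plane at the averaged point $(a,m)$.
  have hpt : ∀ z, (2 / m) * inner ℝ a (G (c • x + s • z)) - ‖a‖ ^ 2 / m ^ 2 * u (c • x + s • z)
      ≤ ‖G (c • x + s • z)‖ ^ 2 / u (c • x + s • z) := by
    intro z
    set y := c • x + s • z
    have huy := hpos y
    rw [le_div_iff₀ huy]
    have hi := abs_real_inner_le_norm a (G y)
    have h1 : inner ℝ a (G y) ≤ ‖a‖ * ‖G y‖ := (le_abs_self _).trans hi
    have h2 : (2 / m) * inner ℝ a (G y) * u y ≤ (2 / m) * (‖a‖ * ‖G y‖) * u y := by gcongr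
    have h3 : (2 / m) * (‖a‖ * ‖G y‖) * u y - ‖a‖ ^ 2 / m ^ 2 * u y * u y
        = ‖G y‖ ^ 2 - (‖G y‖ - ‖a‖ * u y / m) ^ 2 := by field_simp; ring
    nlinarith [sq_nonneg (‖G y‖ - ‖a‖ * u y / m)]
  have h1 := integral_mono ((i2.const_mul (2 / m)).sub (i3.const_mul (‖a‖ ^ 2 / m ^ 2))) i1 hpt
  simp only [Pi.sub_apply] at h1
  rw [integral_sub (i2.const_mul _) (i3.const_mul _), integral_const_mul, integral_const_mul,
    integral_inner (h.integrable_grad_comp hτ c s x)] at h1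
  have e1 : ∫ z, G (c • x + s • z) ∂gaussMeasure τ = a := rfl
  have e2 : ∫ z, u (c • x + s • z) ∂gaussMeasure τ = m := rfl
  rw [e1, e2, real_inner_self_eq_norm_sq] at h1
  calc _ = 2 / m * ‖a‖ ^ 2 - ‖a‖ ^ 2 / m ^ 2 * m := by field_simp; ring
    _ ≤ _ := h1

/-- The pointwise Jensen bound is integrated in $x$; by rotation invariance its right-hand side
becomes the Fisher information of $u$, whatever the angle. -/
lemma integral_norm_sq_average_grad_le (h : IsRegularDensity u G c₀ C L) (hτ : 0 < τ) {c s : ℝ}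
    (hcs : c ^ 2 + s ^ 2 = 1) (hs : s ≠ 0) :
    ∫ x, ‖gaussAverage τ G c s x‖ ^ 2 / gaussAverage τ u c s x ∂gaussMeasure τ
      ≤ ∫ x, ‖G x‖ ^ 2 / u x ∂gaussMeasure τ := by
  have := isProbabilityMeasure_gaussMeasure hτ
  have hG := h.continuous_grad
  have hu := h.continuous
  have hL := h.bound_nonneg
  have hc₀ := h.pos
  have hpos : ∀ y, 0 < u y := fun y => h.pos.trans_le (h.lower y)
  let f : V × V → ℝ := fun p => ‖G p.1‖ ^ 2 / u p.1
  have hf : Continuous f := Continuous.div (by fun_prop) (by fun_prop) fun z => (hpos _).ne'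
  have hb : ∀ p, |f p| ≤ L ^ 2 / c₀ * (1 + ‖p.1‖ + ‖p.2‖) := by
    intro p
    rw [abs_of_nonneg (div_nonneg (sq_nonneg _) (hpos _).le)]
    calc _ ≤ L ^ 2 / c₀ * 1 := by
          rw [mul_one]; gcongr
          · exact h.grad_le _
          · exact h.lower _
      _ ≤ _ := by gcongr; have := norm_nonneg p.1; have := norm_nonneg p.2; linarith
  have hfi := integrable_pair_of_bound hτ hf hb
  have hfi' := (measurePreserving_pairRotation (τ := τ) hcs hs).integrable_comp_of_integrable hfi
  calc _ ≤ ∫ x, ∫ z, f (pairRotation c s (x, z)) ∂gaussMeasure τ ∂gaussMeasure τ := by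
        refine integral_mono ?_ hfi'.integral_prod_left fun x => h.norm_sq_average_grad_le hτ c s x
        refine (integrable_const (L ^ 2 / c₀)).mono' (Continuous.aestronglyMeasurable
          (Continuous.div ((h.continuous_average_grad hτ c s).norm.pow 2)
            (h.continuous_average hτ c s) fun z => (h.average_pos hτ c s _).ne'))
          (Eventually.of_forall fun z => ?_)
        rw [Real.norm_of_nonneg (div_nonneg (sq_nonneg _) (h.average_pos hτ c s _).le)]
        gcongr
        · exact h.norm_average_grad_le hτ c s _
        · exact h.le_average hτ c s _
    _ = ∫ p, f (pairRotation c s p) ∂(gaussMeasure τ).prod (gaussMeasure τ) :=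
        (integral_prod _ hfi').symm
    _ = ∫ p, f p ∂(gaussMeasure τ).prod (gaussMeasure τ) := integral_pairRotation hcs hs hf
    _ = _ := by rw [integral_prod _ hfi]; simp [f]

/-- Differentiation under the integral: $(r\log r)'=\log r+1$ is bounded on $[c_0,C]$, and the
angular derivative of the average grows at most linearly in $x$. -/
lemma hasDerivAt_entropy (h : IsRegularDensity u G c₀ C L) (hτ : 0 < τ) (θ : ℝ) :
    HasDerivAt (fun θ => ∫ x, gaussAverage τ u (Real.cos θ) (Real.sin θ) x *
        Real.log (gaussAverage τ u (Real.cos θ) (Real.sin θ) x) ∂gaussMeasure τ)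
      (∫ x, (∫ z, inner ℝ (G (Real.cos θ • x + Real.sin θ • z))
        (-(Real.sin θ • x) + Real.cos θ • z) ∂gaussMeasure τ) *
        (Real.log (gaussAverage τ u (Real.cos θ) (Real.sin θ) x) + 1) ∂gaussMeasure τ) θ := by
  have := isProbabilityMeasure_gaussMeasure hτ
  have hG := h.continuous_grad
  have hL := h.bound_nonneg
  have hlogc : ∀ c s, Continuous fun x => Real.log (gaussAverage τ u c s x) := fun c s =>
    (h.continuous_average hτ c s).log fun x => (h.average_pos hτ c s x).ne'
  set K := |Real.log c₀| + |Real.log C| + 1 with hK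
  set E := ∫ z, ‖z‖ ∂gaussMeasure τ with hE
  have hdir : ∀ φ x, ‖∫ z, inner ℝ (G (Real.cos φ • x + Real.sin φ • z))
        (-(Real.sin φ • x) + Real.cos φ • z) ∂gaussMeasure τ‖ ≤ L * (‖x‖ + E) := by
    intro φ x
    have h1 : ∫ z, L * (‖x‖ + ‖z‖) ∂gaussMeasure τ = L * (‖x‖ + E) := by
      rw [integral_const_mul, integral_add (integrable_const _) (integrable_norm_gaussMeasure hτ)]
      simp [hE]
    rw [← h1]
    refine norm_integral_le_of_norm_le
      (((integrable_const _).add (integrable_norm_gaussMeasure hτ)).const_mul L)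
      (Eventually.of_forall fun z => ?_)
    refine (norm_inner_le_norm _ _).trans ?_
    gcongr
    · exact h.grad_le _
    · refine (norm_add_le _ _).trans ?_
      rw [norm_neg, norm_smul, norm_smul]
      have h1 := Real.abs_sin_le_one φ
      have h2 := Real.abs_cos_le_one φ
      simp only [Real.norm_eq_abs]
      nlinarith [norm_nonneg x, norm_nonneg z]
  refine (hasDerivAt_integral_of_dominated_loc_of_deriv_le (𝕜 := ℝ) (μ := gaussMeasure τ)
    (x₀ := θ) (s := Set.univ) (bound := fun x => L * (‖x‖ + E) * K) univ_mem
    (F := fun θ x => gaussAverage τ u (Real.cos θ) (Real.sin θ) x *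
        Real.log (gaussAverage τ u (Real.cos θ) (Real.sin θ) x))
    (F' := fun θ x => (∫ z, inner ℝ (G (Real.cos θ • x + Real.sin θ • z))
        (-(Real.sin θ • x) + Real.cos θ • z) ∂gaussMeasure τ) *
        (Real.log (gaussAverage τ u (Real.cos θ) (Real.sin θ) x) + 1))
    (Eventually.of_forall fun φ => ?_) ?_ ?_ (Eventually.of_forall fun x φ _ => ?_)
    ((((integrable_norm_gaussMeasure hτ).add (integrable_const _)).const_mul L).mul_const K)
    (Eventually.of_forall fun x φ _ => ?_)).2
  · exact ((h.continuous_average hτ _ _).mul (hlogc _ _)).aestronglyMeasurable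
  · refine (integrable_const (C * K)).mono'
      ((h.continuous_average hτ _ _).mul (hlogc _ _)).aestronglyMeasurable
      (Eventually.of_forall fun x => ?_)
    rw [norm_mul, Real.norm_of_nonneg (h.average_pos hτ _ _ x).le, Real.norm_eq_abs]
    have h1 := h.abs_log_le_of_mem (h.le_average hτ (Real.cos θ) (Real.sin θ) x)
      (h.average_le hτ (Real.cos θ) (Real.sin θ) x)
    have h2 := h.average_le hτ (Real.cos θ) (Real.sin θ) x
    have h3 := h.average_pos hτ (Real.cos θ) (Real.sin θ) x
    have : 0 ≤ C := h3.le.trans h2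
    gcongr
    linarith
  · refine AEStronglyMeasurable.mul ?_ ((hlogc _ _).add continuous_const).aestronglyMeasurable
    refine (StronglyMeasurable.integral_prod_right (ν := gaussMeasure τ)
      (f := fun x z => inner ℝ (G (Real.cos θ • x + Real.sin θ • z))
        (-(Real.sin θ • x) + Real.cos θ • z)) ?_).aestronglyMeasurable
    exact Continuous.stronglyMeasurable (by fun_prop)
  · rw [norm_mul]
    have hE0 : 0 ≤ E := integral_nonneg fun z => norm_nonneg z
    gcongr
    · exact hdir φ x
    · exact h.abs_log_average_le hτ _ _ x
  · have hd := h.hasDerivAt_average hτ φ x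
    have hp := (h.average_pos hτ (Real.cos φ) (Real.sin φ) x).ne'
    refine (hd.mul (hd.log hp)).congr_deriv ?_
    field_simp

/-- The Gaussian logarithmic Sobolev inequality for regular densities. -/
theorem entropy_le (h : IsRegularDensity u G c₀ C L) (hτ : 0 < τ) :
    ∫ x, u x * Real.log (u x) ∂gaussMeasure τ
      ≤ (∫ x, u x ∂gaussMeasure τ) * Real.log (∫ x, u x ∂gaussMeasure τ)
        + τ / 2 * ∫ x, ‖G x‖ ^ 2 / u x ∂gaussMeasure τ := by
  have := isProbabilityMeasure_gaussMeasure hτ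
  set I := ∫ x, ‖G x‖ ^ 2 / u x ∂gaussMeasure τ
  -- The added term has derivative $\tau I\sin\theta\cos\theta$, the largest rate at which the
  -- entropy can decrease, so $\Phi$ is nondecreasing. At $\theta=0$ the average is $u$, at
  -- $\theta=\pi/2$ it is the mean of $u$, and $\Phi(0)\le\Phi(\pi/2)$ is the claim.
  let Φ : ℝ → ℝ := fun θ => (∫ x, gaussAverage τ u (Real.cos θ) (Real.sin θ) x *
        Real.log (gaussAverage τ u (Real.cos θ) (Real.sin θ) x) ∂gaussMeasure τ)
        + τ / 2 * I * Real.sin θ ^ 2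
  have hd : ∀ θ, HasDerivAt Φ ((∫ x, (∫ z, inner ℝ (G (Real.cos θ • x + Real.sin θ • z))
        (-(Real.sin θ • x) + Real.cos θ • z) ∂gaussMeasure τ) *
        (Real.log (gaussAverage τ u (Real.cos θ) (Real.sin θ) x) + 1) ∂gaussMeasure τ)
        + τ / 2 * I * (2 * Real.sin θ * Real.cos θ)) θ := by
    intro θ
    refine (h.hasDerivAt_entropy hτ θ).add (HasDerivAt.const_mul _ ?_)
    simpa using (Real.hasDerivAt_sin θ).fun_pow 2
  have hmono : MonotoneOn Φ (Set.Icc 0 (Real.pi / 2)) := by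
    refine monotoneOn_of_deriv_nonneg (convex_Icc _ _)
      (fun θ _ => (hd θ).continuousAt.continuousWithinAt)
      (fun θ _ => (hd θ).differentiableAt.differentiableWithinAt) fun θ hθ => ?_
    rw [interior_Icc] at hθ
    have hs : 0 < Real.sin θ := Real.sin_pos_of_pos_of_lt_pi hθ.1 (by linarith [hθ.2, Real.pi_pos])
    have hc : 0 < Real.cos θ := Real.cos_pos_of_mem_Ioo ⟨by linarith [hθ.1, Real.pi_pos], hθ.2⟩
    have hcs := Real.cos_sq_add_sin_sq θ
    rw [(hd θ).deriv, h.integral_deriv_mul_log hτ hcs hs.ne']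
    have h1 := h.integral_norm_sq_average_grad_le hτ hcs hs.ne'
    have h2 : 0 < τ * Real.sin θ * Real.cos θ := by positivity
    have h3 := mul_le_mul_of_nonneg_left h1 h2.le
    have h4 : τ / 2 * I * (2 * Real.sin θ * Real.cos θ) = τ * Real.sin θ * Real.cos θ * I := by ring
    rw [h4]; linarith
  have hle := hmono ⟨le_rfl, by positivity⟩ ⟨by positivity, le_rfl⟩
    (show (0 : ℝ) ≤ Real.pi / 2 by positivity)
  simpa [Φ, gaussAverage] using hle

end IsRegularDensity

/-- Cauchy–Schwarz from the discriminant of the nonnegative polynomial $t\mapsto\int(tf+h)^2$. -/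
lemma sq_integral_mul_le {α : Type*} [MeasurableSpace α] {μ : Measure α} {f h : α → ℝ}
    (hf : Integrable (fun x => f x ^ 2) μ) (hh : Integrable (fun x => h x ^ 2) μ)
    (hfh : Integrable (fun x => f x * h x) μ) :
    (∫ x, f x * h x ∂μ) ^ 2 ≤ (∫ x, f x ^ 2 ∂μ) * ∫ x, h x ^ 2 ∂μ := by
  have key : ∀ t : ℝ, 0 ≤ (∫ x, f x ^ 2 ∂μ) * (t * t) + (2 * ∫ x, f x * h x ∂μ) * t
      + ∫ x, h x ^ 2 ∂μ := by
    intro t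
    have h1 : ∫ x, (t * f x + h x) ^ 2 ∂μ = (∫ x, f x ^ 2 ∂μ) * (t * t)
        + (2 * ∫ x, f x * h x ∂μ) * t + ∫ x, h x ^ 2 ∂μ := by
      have e : ∀ x, (t * f x + h x) ^ 2 = (t * t * f x ^ 2 + 2 * t * (f x * h x)) + h x ^ 2 :=
        fun x => by ring
      simp_rw [e]
      have i1 : Integrable (fun x => t * t * f x ^ 2 + 2 * t * (f x * h x)) μ :=
        (hf.const_mul _).add (hfh.const_mul _)
      rw [integral_add i1 hh, integral_add (hf.const_mul _) (hfh.const_mul _),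
        integral_const_mul, integral_const_mul]
      ring
    rw [← h1]
    exact integral_nonneg fun x => sq_nonneg _
  have := discrim_le_zero key
  unfold discrim at this
  nlinarith

/-! ### Cutoffs and weak gradients -/

/-- A smooth cutoff on `V`: `1` on the ball of radius `n + 1`, `0` off the ball of radius
`2 (n + 1)`. -/
noncomputable def cutoff (n : ℕ) (x : V) : ℝ :=
  (⟨1, 2, one_pos, one_lt_two⟩ : ContDiffBump (0 : V)) ((n + 1 : ℝ)⁻¹ • x)

lemma contDiff_cutoff (n : ℕ) : ContDiff ℝ ∞ (cutoff n) :=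
  (ContDiffBump.contDiff _).comp (contDiff_const_smul _)

lemma cutoff_nonneg (n : ℕ) (x : V) : 0 ≤ cutoff n x := ContDiffBump.nonneg _

lemma cutoff_le_one (n : ℕ) (x : V) : cutoff n x ≤ 1 := ContDiffBump.le_one _

lemma cutoff_eq_one {n : ℕ} {x : V} (hx : ‖x‖ ≤ n + 1) : cutoff n x = 1 := by
  apply ContDiffBump.one_of_mem_closedBall
  have : (0 : ℝ) < n + 1 := by positivity
  rw [mem_closedBall_zero_iff, norm_smul, norm_inv, Real.norm_of_nonneg this.le,
    inv_mul_le_iff₀ this]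
  simpa using hx

lemma hasCompactSupport_cutoff (n : ℕ) : HasCompactSupport (cutoff n) := by
  have : (n + 1 : ℝ)⁻¹ ≠ 0 := by positivity
  exact (ContDiffBump.hasCompactSupport _).comp_smul this

/-- All cutoffs are dilations of one bump function, so one constant serves every $n$, with a gain
$1/(n+1)$ from the dilation. -/
lemma exists_norm_fderiv_cutoff_le :
    ∃ K : ℝ, 0 ≤ K ∧ ∀ (n : ℕ) (x : V), ‖fderiv ℝ (cutoff n) x‖ ≤ K / (n + 1) := by
  set b : ContDiffBump (0 : V) := ⟨1, 2, one_pos, one_lt_two⟩ with hb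
  have hbd : ContDiff ℝ ∞ b := b.contDiff
  obtain ⟨K, hK⟩ := (hbd.continuous_fderiv (by simp)).bounded_above_of_compact_support
    (b.hasCompactSupport.fderiv (𝕜 := ℝ))
  refine ⟨K, (norm_nonneg _).trans (hK 0), fun n x => ?_⟩
  have h0 : (0 : ℝ) < n + 1 := by positivity
  have h1 : HasFDerivAt (fun x : V => (n + 1 : ℝ)⁻¹ • x)
      ((n + 1 : ℝ)⁻¹ • ContinuousLinearMap.id ℝ V) x := (hasFDerivAt_id x).fun_const_smul _
  have h2 := ((hbd.differentiable (by simp) ((n + 1 : ℝ)⁻¹ • x)).hasFDerivAt.comp x h1).fderiv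
  have h3 : fderiv ℝ (cutoff n) x = _ := h2
  rw [h3, ContinuousLinearMap.comp_smul, ContinuousLinearMap.comp_id, norm_smul, norm_inv,
    Real.norm_of_nonneg h0.le, div_eq_inv_mul]
  gcongr
  exact hK _

lemma eventually_cutoff_eq_one (x : V) (r : ℝ) :
    ∀ᶠ n : ℕ in atTop, ∀ y ∈ Metric.ball x r, cutoff n y = 1 := by
  obtain ⟨N, hN⟩ := exists_nat_ge (‖x‖ + r)
  filter_upwards [eventually_ge_atTop N] with n hn y hy
  apply cutoff_eq_one
  have h1 : ‖y - x‖ < r := by simpa [dist_eq_norm] using hy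
  have h2 : ‖y‖ ≤ ‖x‖ + ‖y - x‖ := by
    simpa using norm_add_le x (y - x)
  have : (N : ℝ) ≤ n := by exact_mod_cast hn
  linarith

lemma tendsto_cutoff (x : V) : Tendsto (fun n => cutoff n x) atTop (𝓝 1) := by
  refine tendsto_const_nhds.congr' ?_
  filter_upwards [eventually_cutoff_eq_one x 1] with n hn
  exact (hn x (Metric.mem_ball_self one_pos)).symm

/-- `Ξ` is the weak gradient of `h`, tested against `C_c^∞`. -/
structure HasWeakGradient (h : V → ℝ) (Ξ : V → V) : Prop where
  locallyIntegrable : LocallyIntegrable h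
  locallyIntegrable_grad : LocallyIntegrable Ξ
  integral_eq : ∀ φ : V → ℝ, ContDiff ℝ ∞ φ → HasCompactSupport φ → ∀ a : V,
    ∫ v, h v * fderiv ℝ φ v a = - ∫ v, φ v * inner ℝ a (Ξ v)

lemma locallyIntegrable_clm_comp {E F : Type*} [NormedAddCommGroup E] [NormedSpace ℝ E]
    [NormedAddCommGroup F] [NormedSpace ℝ F] (A : E →L[ℝ] F) {f : V → E}
    (hf : LocallyIntegrable f) : LocallyIntegrable fun v => A (f v) := fun x => by
  obtain ⟨s, hs, hi⟩ := hf x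
  exact ⟨s, hs, A.integrable_comp hi⟩

lemma integrable_mul_of_compactSupport {h φ : V → ℝ} (hh : LocallyIntegrable h)
    (hφ : Continuous φ) (hφc : HasCompactSupport φ) : Integrable fun v => φ v * h v := by
  simpa using hh.integrable_smul_left_of_hasCompactSupport hφ hφc

/-- Passage from coordinate directions to an arbitrary direction $a$ by linearity. Local
integrability of both fields makes the finite sums of integrals legitimate. -/
lemma IsWeakLogGradient.hasWeakGradient {g : V → ℝ} {ξ : V → V} (hg : LocallyIntegrable g)
    (hξ : IsWeakLogGradient g ξ) : HasWeakGradient g (fun v => g v • ξ v) := by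
  refine ⟨hg, hξ.1, fun φ hφ hφc a => ?_⟩
  have ha : a = ∑ i, a i • EuclideanSpace.single i (1 : ℝ) := by
    ext j; simp [Pi.single_apply]
  have hcomp : ∀ i : Fin 3, LocallyIntegrable (fun v => g v * ξ v i) := by
    intro i
    have := locallyIntegrable_clm_comp (EuclideanSpace.proj (𝕜 := ℝ) i) hξ.1
    simpa [Function.comp_def] using this
  have hφ' := hφ.continuous_fderiv (by simp)
  have h1 : ∀ v, g v * fderiv ℝ φ v a
      = ∑ i, a i * (g v * fderiv ℝ φ v (EuclideanSpace.single i 1)) := by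
    intro v
    conv_lhs => rw [ha]
    rw [map_sum, Finset.mul_sum]
    refine Finset.sum_congr rfl fun i _ => ?_
    rw [map_smul, smul_eq_mul]; ring
  have h2 : ∀ v, φ v * inner ℝ a (g v • ξ v) = ∑ i, a i * (φ v * (g v * ξ v i)) := by
    intro v
    rw [PiLp.inner_apply, Finset.mul_sum]
    refine Finset.sum_congr rfl fun i _ => ?_
    simp; ring
  simp_rw [h1, h2]
  rw [integral_finsetSum, integral_finsetSum, ← Finset.sum_neg_distrib]
  · refine Finset.sum_congr rfl fun i _ => ?_
    rw [integral_const_mul, integral_const_mul, hξ.2 φ hφ hφc i, mul_neg]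
  · intro i _
    exact (integrable_mul_of_compactSupport (hcomp i) hφ.continuous hφc).const_mul _
  · intro i _
    have := integrable_mul_of_compactSupport hg
      (φ := fun v => fderiv ℝ φ v (EuclideanSpace.single i 1)) (hφ'.clm_apply continuous_const)
      (hφc.fderiv_apply (𝕜 := ℝ) _)
    exact (this.congr (Eventually.of_forall fun v => mul_comm _ _)).const_mul _

namespace HasWeakGradient
variable {h : V → ℝ} {Ξ : V → V}

lemma integrable_mul (hw : HasWeakGradient h Ξ) {φ : V → ℝ} (hφ : Continuous φ)
    (hφc : HasCompactSupport φ) (a : V) : Integrable fun v => φ v * inner ℝ a (Ξ v) := by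
  have h1 : LocallyIntegrable fun v => inner ℝ a (Ξ v) :=
    locallyIntegrable_clm_comp (innerSL ℝ a) hw.locallyIntegrable_grad
  exact integrable_mul_of_compactSupport h1 hφ hφc

/-- The product rule for weak gradients. -/
lemma mul_smooth (hw : HasWeakGradient h Ξ) {κ : V → ℝ} (hκ : ContDiff ℝ ∞ κ) {D : V → V}
    (hD : ∀ v, HasFDerivAt κ (innerSL ℝ (D v)) v) (hDc : Continuous D) :
    HasWeakGradient (fun v => κ v * h v) (fun v => κ v • Ξ v + h v • D v) := by
  have hl : LocallyIntegrable fun v => κ v * h v := by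
    simpa [mul_comm] using hw.locallyIntegrable.smul_continuous hκ.continuous
  refine ⟨hl, (hw.locallyIntegrable_grad.continuous_smul hκ.continuous).add
    (hw.locallyIntegrable.smul_continuous hDc), fun φ hφ hφc a => ?_⟩
  have hφ' : Continuous fun v => fderiv ℝ φ v a :=
    (hφ.continuous_fderiv (by simp)).clm_apply continuous_const
  have hφ'c : HasCompactSupport fun v => fderiv ℝ φ v a := hφc.fderiv_apply (𝕜 := ℝ) a
  have hprod : ∀ v, fderiv ℝ (fun v => κ v * φ v) v a
      = κ v * fderiv ℝ φ v a + φ v * inner ℝ (D v) a := by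
    intro v
    rw [((hD v).fun_mul (hφ.differentiable (by simp) v).hasFDerivAt).fderiv]
    simp
  have i1 : Integrable fun v => κ v * h v * fderiv ℝ φ v a :=
    (integrable_mul_of_compactSupport hl hφ' hφ'c).congr
      (Eventually.of_forall fun v => mul_comm _ _)
  have i2 : Integrable fun v => h v * (φ v * inner ℝ (D v) a) :=
    (integrable_mul_of_compactSupport hw.locallyIntegrable
      (φ := fun v => φ v * inner ℝ (D v) a)
      (hφ.continuous.mul (by fun_prop)) hφc.mul_right).congr
      (Eventually.of_forall fun v => mul_comm _ _)
  have i3 : Integrable fun v => κ v * φ v * inner ℝ a (Ξ v) :=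
    hw.integrable_mul (hκ.continuous.mul hφ.continuous) hφc.mul_left a
  have h1 := hw.integral_eq (fun v => κ v * φ v) (hκ.mul hφ) hφc.mul_left a
  have e1 : ∀ v, h v * fderiv ℝ (fun v => κ v * φ v) v a
      = κ v * h v * fderiv ℝ φ v a + h v * (φ v * inner ℝ (D v) a) := by
    intro v; rw [hprod]; ring
  have e2 : ∀ v, φ v * inner ℝ a (κ v • Ξ v + h v • D v)
      = κ v * φ v * inner ℝ a (Ξ v) + h v * (φ v * inner ℝ (D v) a) := by
    intro v
    rw [inner_add_right, real_inner_smul_right, real_inner_smul_right, real_inner_comm (D v) a]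
    ring
  simp_rw [e1] at h1
  simp_rw [e2]
  rw [integral_add i1 i2] at h1
  rw [integral_add i3 i2]
  linarith

open scoped Convolution in
/-- Mollification turns a weak gradient into a classical one. -/
lemma hasFDerivAt_convolution (hw : HasWeakGradient h Ξ) {η : V → ℝ} (hη : ContDiff ℝ ∞ η)
    (hηc : HasCompactSupport η) (x : V) :
    HasFDerivAt (fun x => ∫ y, η (x - y) * h y)
      (innerSL ℝ (∫ y, η (x - y) • Ξ y)) x := by
  have h1 := hηc.hasFDerivAt_convolution_left (ContinuousLinearMap.lsmul ℝ ℝ)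
    (μ := (volume : Measure V)) (hη.of_le (by simp)) hw.locallyIntegrable x
  have h2 : (η ⋆[ContinuousLinearMap.lsmul ℝ ℝ] h) = fun x => ∫ y, η (x - y) * h y := by
    ext x; rw [convolution_lsmul_swap]; simp
  rw [h2] at h1
  refine h1.congr_fderiv ?_
  have hsm : ContDiff ℝ ∞ fun y => η (x - y) := hη.comp (contDiff_const.sub contDiff_id)
  have hsc : HasCompactSupport fun y => η (x - y) :=
    hηc.comp_homeomorph (Homeomorph.subLeft x)
  ext a
  have i1 : Integrable fun y => ((ContinuousLinearMap.lsmul ℝ ℝ).precompL V)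
      (fderiv ℝ η (x - y)) (h y) :=
    ((hηc.fderiv (𝕜 := ℝ)).convolutionExists_left _ (hη.continuous_fderiv (by simp))
      hw.locallyIntegrable x).integrable_swap
  rw [convolution_eq_swap, ContinuousLinearMap.integral_apply i1]
  have i2 : Integrable fun y => η (x - y) • Ξ y :=
    hw.locallyIntegrable_grad.integrable_smul_left_of_hasCompactSupport hsm.continuous hsc
  rw [innerSL_apply_apply, real_inner_comm, ← integral_inner i2]
  have h3 := hw.integral_eq _ hsm hsc a
  have h4 : ∀ y, fderiv ℝ (fun y => η (x - y)) y a = - fderiv ℝ η (x - y) a := by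
    intro y
    have h5 : HasFDerivAt (fun y => x - y) (-ContinuousLinearMap.id ℝ V) y :=
      (hasFDerivAt_id y).const_sub x
    have h6 : fderiv ℝ (fun y => η (x - y)) y = _ :=
      ((hη.differentiable (by simp) (x - y)).hasFDerivAt.comp y h5).fderiv
    rw [h6]
    simp
  simp_rw [h4, mul_neg, integral_neg, neg_inj] at h3
  simp_rw [real_inner_smul_right]
  rw [← h3]
  congr 1; ext y
  simp [ContinuousLinearMap.precompL_apply, mul_comm]

end HasWeakGradient
-- The logarithmic Sobolev inequality for weakly differentiable densities
open scoped Convolution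

/-- Probability densities with finite second moment, finite entropy, and a weak logarithmic
gradient of finite Fisher information. -/
structure IsFisherDensity (g : V → ℝ) (ξ : V → V) : Prop where
  nonneg : ∀ v, 0 ≤ g v
  integrable : Integrable g
  mass : ∫ v, g v = 1
  integrable_norm_sq : Integrable fun v => g v * ‖v‖ ^ 2
  integrable_entropy : Integrable fun v => g v * Real.log (g v)
  aestronglyMeasurable : AEStronglyMeasurable ξ
  weak : IsWeakLogGradient g ξ
  integrable_fisher : Integrable fun v => g v * ‖ξ v‖ ^ 2

lemma hasFDerivAt_gradient {f : V → ℝ} {x : V} (hf : DifferentiableAt ℝ f x) :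
    HasFDerivAt f (innerSL ℝ (gradient f x)) x :=
  hasGradientAt_iff_hasFDerivAt.1 hf.hasGradientAt

lemma norm_gradient (f : V → ℝ) (x : V) : ‖gradient f x‖ = ‖fderiv ℝ f x‖ := by
  simp [gradient]

lemma continuous_gradient {f : V → ℝ} (hf : ContDiff ℝ ∞ f) : Continuous (gradient f) :=
  (InnerProductSpace.toDual ℝ V).symm.continuous.comp (hf.continuous_fderiv (by simp))

/-- A smooth nonnegative mollifier of mass one supported in the ball of radius `δ`. -/
structure IsMollifier (η : V → ℝ) (δ : ℝ) : Prop where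
  contDiff : ContDiff ℝ ∞ η
  hasCompactSupport : HasCompactSupport η
  nonneg : ∀ x, 0 ≤ η x
  integral : ∫ x, η x = 1
  eq_zero : ∀ x, δ ≤ ‖x‖ → η x = 0

namespace IsMollifier
variable {η : V → ℝ} {δ : ℝ} {f : V → ℝ}

lemma integrable_self (h : IsMollifier η δ) : Integrable η :=
  h.contDiff.continuous.integrable_of_hasCompactSupport h.hasCompactSupport

lemma contDiff_sub (h : IsMollifier η δ) (x : V) : ContDiff ℝ ∞ fun y => η (x - y) :=
  h.contDiff.comp (contDiff_const.sub contDiff_id)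

lemma hasCompactSupport_sub (h : IsMollifier η δ) (x : V) :
    HasCompactSupport fun y => η (x - y) :=
  h.hasCompactSupport.comp_homeomorph (Homeomorph.subLeft x)

lemma integrable_mul (h : IsMollifier η δ) (hf : LocallyIntegrable f) (x : V) :
    Integrable fun y => η (x - y) * f y :=
  integrable_mul_of_compactSupport hf (h.contDiff_sub x).continuous (h.hasCompactSupport_sub x)

lemma convolution_eq : (η ⋆[ContinuousLinearMap.lsmul ℝ ℝ] f) = fun x => ∫ y, η (x - y) * f y := by
  ext x; rw [convolution_lsmul_swap]; simp

lemma integrable_convolution (h : IsMollifier η δ) (hf : Integrable f) :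
    Integrable fun x => ∫ y, η (x - y) * f y := by
  rw [← convolution_eq]
  exact h.integrable_self.integrable_convolution _ hf

lemma integral_convolution (h : IsMollifier η δ) (hf : Integrable f) :
    ∫ x, ∫ y, η (x - y) * f y = ∫ y, f y := by
  rw [← convolution_eq (η := η), MeasureTheory.integral_convolution _ h.integrable_self hf,
    h.integral]
  simp

end IsMollifier

namespace IsFisherDensity

variable {g : V → ℝ} {ξ : V → V} {τ : ℝ}

lemma aestronglyMeasurable_density (h : IsFisherDensity g ξ) : AEStronglyMeasurable g :=
  h.integrable.aestronglyMeasurable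

lemma integrable_sq_add (h : IsFisherDensity g ξ) (τ ε : ℝ) :
    Integrable fun v => g v * (‖ξ v + τ⁻¹ • v‖ + ε) ^ 2 := by
  have hξ := h.aestronglyMeasurable
  have hid : AEStronglyMeasurable (fun v : V => τ⁻¹ • v) volume :=
    (continuous_const_smul τ⁻¹).aestronglyMeasurable
  refine (((h.integrable_fisher.const_mul 3).add (h.integrable_norm_sq.const_mul (3 * τ⁻¹ ^ 2))).add
    (h.integrable.const_mul (3 * ε ^ 2))).mono'
    (h.aestronglyMeasurable_density.mul (((hξ.add hid).norm.add aestronglyMeasurable_const).pow 2))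
    (Eventually.of_forall fun v => ?_)
  have hg := h.nonneg v
  rw [Real.norm_of_nonneg (by positivity)]
  have h1 : ‖ξ v + τ⁻¹ • v‖ ≤ ‖ξ v‖ + |τ⁻¹| * ‖v‖ := (norm_add_le _ _).trans (by simp [norm_smul])
  have h2 : (‖ξ v + τ⁻¹ • v‖ + ε) ^ 2 ≤ 3 * ‖ξ v‖ ^ 2 + 3 * τ⁻¹ ^ 2 * ‖v‖ ^ 2 + 3 * ε ^ 2 := by
    have h3 : (‖ξ v + τ⁻¹ • v‖ + ε) ^ 2 ≤ (‖ξ v‖ + |τ⁻¹| * ‖v‖ + |ε|) ^ 2 := by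
      rw [sq_le_sq]
      refine (abs_add_le _ _).trans ?_
      rw [abs_norm]
      exact (add_le_add_left h1 _).trans (le_abs_self _)
    have h4 : τ⁻¹ ^ 2 * ‖v‖ ^ 2 = (|τ⁻¹| * ‖v‖) ^ 2 := by rw [mul_pow, sq_abs]
    have h5 : ε ^ 2 = |ε| ^ 2 := (sq_abs ε).symm
    rw [mul_assoc, h4, h5]
    nlinarith [sq_nonneg (‖ξ v‖ - |τ⁻¹| * ‖v‖), sq_nonneg (‖ξ v‖ - |ε|),
      sq_nonneg (|τ⁻¹| * ‖v‖ - |ε|)]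
  simp only [Pi.add_apply]
  nlinarith [mul_le_mul_of_nonneg_left h2 hg]

/-- The weighted Cauchy–Schwarz estimate for the mollified and truncated relative gradient. -/
lemma norm_sq_mollified_le (h : IsFisherDensity g ξ) {η : V → ℝ} {δ : ℝ} (hη : IsMollifier η δ)
    (hτ : 0 < τ) {χ : V → ℝ} (hχ : Continuous χ) (hχ0 : ∀ v, 0 ≤ χ v) (hχ1 : ∀ v, χ v ≤ 1)
    {D : V → V} {ε : ℝ} (hD : ∀ v, 2 * ‖D v‖ + δ / τ ≤ ε)
    (hi : LocallyIntegrable fun y => χ y ^ 2 • (g y • ξ y) + g y • ((2 * χ y) • D y)) (x : V) :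
    ‖(∫ y, η (x - y) • (χ y ^ 2 • (g y • ξ y) + g y • ((2 * χ y) • D y)))
        + ((∫ y, η (x - y) * (χ y ^ 2 * g y)) / τ) • x‖ ^ 2
      ≤ (∫ y, η (x - y) * (χ y ^ 2 * g y)) *
        ∫ y, η (x - y) * (g y * (‖ξ y + τ⁻¹ • y‖ + ε) ^ 2) := by
  set W : V → ℝ := fun y => ‖ξ y + τ⁻¹ • y‖ + ε with hW
  have hχg : LocallyIntegrable fun y => χ y ^ 2 * g y := by
    simpa [mul_comm] using h.integrable.locallyIntegrable.smul_continuous (hχ.pow 2)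
  have hsub := (hη.contDiff_sub x).continuous
  have i1 : Integrable fun y => η (x - y) • (χ y ^ 2 • (g y • ξ y) + g y • ((2 * χ y) • D y)) :=
    hi.integrable_smul_left_of_hasCompactSupport hsub (hη.hasCompactSupport_sub x)
  have i2 := hη.integrable_mul hχg x
  have i3 := hη.integrable_mul (h.integrable_sq_add τ ε).locallyIntegrable x
  -- Cauchy–Schwarz is applied to $\sqrt{\eta g}\,\chi$ and $\sqrt{\eta g}\,W$. Truncating by
  -- $\chi^2$ rather than $\chi$ leaves a factor $\chi$ in its gradient $2\chi\nabla\chi$, so the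
  -- first factor reproduces exactly the truncated mass.
  have hsq1 : ∀ y, (Real.sqrt (η (x - y) * g y) * χ y) ^ 2 = η (x - y) * (χ y ^ 2 * g y) := by
    intro y
    rw [mul_pow, Real.sq_sqrt (mul_nonneg (hη.nonneg _) (h.nonneg y))]; ring
  have hsq2 : ∀ y, (Real.sqrt (η (x - y) * g y) * W y) ^ 2
      = η (x - y) * (g y * (‖ξ y + τ⁻¹ • y‖ + ε) ^ 2) := by
    intro y
    rw [mul_pow, Real.sq_sqrt (mul_nonneg (hη.nonneg _) (h.nonneg y))]; ring
  have hmul : ∀ y, (Real.sqrt (η (x - y) * g y) * χ y) * (Real.sqrt (η (x - y) * g y) * W y)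
      = η (x - y) * (g y * χ y * W y) := by
    intro y
    have := Real.mul_self_sqrt (mul_nonneg (hη.nonneg (x - y)) (h.nonneg y))
    linear_combination (χ y * W y) * this
  have hsm : AEStronglyMeasurable (fun y => Real.sqrt (η (x - y) * g y)) volume :=
    Real.continuous_sqrt.comp_aestronglyMeasurable
      (hsub.aestronglyMeasurable.mul h.aestronglyMeasurable_density)
  have hid : AEStronglyMeasurable (fun v : V => τ⁻¹ • v) volume :=
    (continuous_const_smul τ⁻¹).aestronglyMeasurable
  have hWm : AEStronglyMeasurable W volume :=
    (h.aestronglyMeasurable.add hid).norm.add aestronglyMeasurable_const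
  have i4 : Integrable fun y =>
      (Real.sqrt (η (x - y) * g y) * χ y) * (Real.sqrt (η (x - y) * g y) * W y) := by
    refine (i2.add i3).mono' ((hsm.mul hχ.aestronglyMeasurable).mul (hsm.mul hWm))
      (Eventually.of_forall fun y => ?_)
    simp only [Pi.add_apply]
    rw [← hsq1, ← hsq2, Real.norm_eq_abs, abs_mul]
    set a := Real.sqrt (η (x - y) * g y) * χ y
    set b := Real.sqrt (η (x - y) * g y) * W y
    rw [← sq_abs a, ← sq_abs b]
    nlinarith [sq_nonneg (|a| - |b|), sq_nonneg |a|, sq_nonneg |b|]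
  have hcs := sq_integral_mul_le (by simpa only [hsq1] using i2) (by simpa only [hsq2] using i3) i4
  simp_rw [hsq1, hsq2, hmul] at hcs
  simp_rw [hmul] at i4
  refine le_trans ?_ hcs
  rw [sq_le_sq, abs_norm]
  refine le_trans ?_ (le_abs_self _)
  have e1 : ((∫ y, η (x - y) * (χ y ^ 2 * g y)) / τ) • x
      = ∫ y, (η (x - y) * (χ y ^ 2 * g y)) • (τ⁻¹ • x) := by
    rw [integral_smul_const, smul_smul, div_eq_mul_inv]
  rw [e1, ← integral_add i1 (i2.smul_const _)]
  refine (norm_integral_le_integral_norm _).trans ?_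
  refine integral_mono_of_nonneg (Eventually.of_forall fun y => norm_nonneg _) i4
    (Eventually.of_forall fun y => ?_)
  simp only
  by_cases hy : δ ≤ ‖x - y‖
  · simp [hη.eq_zero _ hy]
  · push Not at hy
    -- Writing $x=y+(x-y)$ isolates $\xi(y)+y/\tau$. The rest consists of the gradient of the cutoff
    -- and of $(x-y)/\tau$, which is at most $\delta/\tau$ on the support of the mollifier; `hD`
    -- bounds their sum by $\varepsilon$.
    have e2 : η (x - y) • (χ y ^ 2 • (g y • ξ y) + g y • ((2 * χ y) • D y))
        + (η (x - y) * (χ y ^ 2 * g y)) • (τ⁻¹ • x)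
        = (η (x - y) * (g y * χ y)) •
          (χ y • (ξ y + τ⁻¹ • y) + ((2 : ℝ) • D y + χ y • (τ⁻¹ • (x - y)))) := by
      module
    have hη0 := hη.nonneg (x - y)
    have hg0 := h.nonneg y
    have hc0 := hχ0 y
    rw [e2, norm_smul, Real.norm_of_nonneg (by positivity), mul_assoc]
    gcongr
    refine (norm_add_le _ _).trans ?_
    have b1 : ‖χ y • (ξ y + τ⁻¹ • y)‖ ≤ ‖ξ y + τ⁻¹ • y‖ := by
      rw [norm_smul, Real.norm_of_nonneg hc0]
      exact mul_le_of_le_one_left (norm_nonneg _) (hχ1 y)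
    have b2 : ‖(2 : ℝ) • D y‖ = 2 * ‖D y‖ := by rw [norm_smul]; simp
    have b3 : ‖χ y • (τ⁻¹ • (x - y))‖ ≤ δ / τ := by
      rw [norm_smul, norm_smul, Real.norm_of_nonneg hc0, norm_inv, Real.norm_of_nonneg hτ.le,
        div_eq_inv_mul]
      calc _ ≤ 1 * (τ⁻¹ * δ) := by gcongr; exact hχ1 y
        _ = _ := one_mul _
    have b4 := norm_add_le ((2 : ℝ) • D y) (χ y • (τ⁻¹ • (x - y)))
    have b5 := hD y
    simp only [hW]
    linarith

end IsFisherDensity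

/-- The affine correction makes the entropy integrand nonnegative, as Fatou's lemma requires. -/
lemma mul_log_sub_add_one_nonneg {r : ℝ} (hr : 0 ≤ r) : 0 ≤ r * Real.log r - r + 1 := by
  rcases hr.eq_or_lt with rfl | hr
  · simp
  · have h := Real.one_sub_inv_le_log_of_pos hr
    have : r * (1 - r⁻¹) = r - 1 := by field_simp
    nlinarith [mul_le_mul_of_nonneg_left h hr.le]

lemma hasFDerivAt_inv_gaussDensity {τ : ℝ} (hτ : 0 < τ) (x : V) :
    HasFDerivAt (fun x => (gaussDensity τ x)⁻¹)
      (((gaussDensity τ x)⁻¹ / τ) • innerSL ℝ x) x := by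
  have hM := (gaussDensity_pos hτ x).ne'
  refine ((hasDerivAt_inv hM).comp_hasFDerivAt x (hasFDerivAt_gaussDensity hτ x)).congr_fderiv ?_
  ext y; simp; field_simp

/-- The regular inequality rewritten for the nonnegative integrand $u\log u-u+1$, the form that
passes to the limit by Fatou. -/
lemma IsRegularDensity.lintegral_le {u : V → ℝ} {G : V → V} {c₀ C L τ : ℝ}
    (h : IsRegularDensity u G c₀ C L) (hτ : 0 < τ) {J : ℝ}
    (hJ : ∫ x, ‖G x‖ ^ 2 / u x ∂gaussMeasure τ ≤ J) {m : ℝ}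
    (hm : ∫ x, u x ∂gaussMeasure τ = m) :
    ∫⁻ x, ENNReal.ofReal (u x * Real.log (u x) - u x + 1) ∂gaussMeasure τ
      ≤ ENNReal.ofReal (m * Real.log m - m + 1 + τ / 2 * J) := by
  have := isProbabilityMeasure_gaussMeasure hτ
  have hpos : ∀ x, 0 < u x := fun x => h.pos.trans_le (h.lower x)
  have hC : 0 ≤ C := (hpos 0).le.trans (h.upper 0)
  have hu := h.continuous
  have i1 : Integrable u (gaussMeasure τ) := (integrable_const C).mono' hu.aestronglyMeasurable
    (Eventually.of_forall h.abs_le)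
  have i2 : Integrable (fun x => u x * Real.log (u x)) (gaussMeasure τ) := by
    refine (integrable_const (C * (|Real.log c₀| + |Real.log C|))).mono'
      (hu.mul (hu.log fun x => (hpos x).ne')).aestronglyMeasurable
      (Eventually.of_forall fun x => ?_)
    rw [norm_mul]
    gcongr
    · exact h.abs_le x
    · exact h.abs_log_le_of_mem (h.lower x) (h.upper x)
  have i3 : Integrable (fun x => u x * Real.log (u x) - u x + 1) (gaussMeasure τ) :=
    (i2.sub i1).add (integrable_const 1)
  rw [← ofReal_integral_eq_lintegral_ofReal i3
    (Eventually.of_forall fun x => mul_log_sub_add_one_nonneg (hpos x).le)]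
  apply ENNReal.ofReal_le_ofReal
  have i4 : Integrable (fun x => u x * Real.log (u x) - u x) (gaussMeasure τ) := i2.sub i1
  rw [integral_add i4 (integrable_const 1), integral_sub i2 i1, hm]
  have h1 := h.entropy_le hτ
  rw [hm] at h1
  have h2 : τ / 2 * ∫ x, ‖G x‖ ^ 2 / u x ∂gaussMeasure τ ≤ τ / 2 * J := by gcongr
  simp only [integral_const, probReal_univ, smul_eq_mul, mul_one]
  linarith

lemma log_gaussDensity {τ : ℝ} (hτ : 0 < τ) (v : V) : Real.log (gaussDensity τ v)
    = -(3 / 2) * Real.log (2 * Real.pi * τ) - (2 * τ)⁻¹ * ‖v‖ ^ 2 := by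
  have := Real.pi_pos
  rw [gaussDensity, Real.log_mul (by positivity) (by positivity), Real.log_exp,
    Real.log_rpow (by positivity)]
  ring

lemma mul_log_div_gaussDensity {τ x : ℝ} (hτ : 0 < τ) (hx : 0 ≤ x) (v : V) :
    x * Real.log (x / gaussDensity τ v) = x * Real.log x
      + (3 / 2) * Real.log (2 * Real.pi * τ) * x + (2 * τ)⁻¹ * (x * ‖v‖ ^ 2) := by
  rcases hx.eq_or_lt with h0 | h0
  · simp [← h0]
  · rw [Real.log_div h0.ne' (gaussDensity_pos hτ v).ne', log_gaussDensity hτ]; ring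

lemma integrable_mul_log_div_gaussDensity {τ : ℝ} {g : V → ℝ} (hτ : 0 < τ) (hg : ∀ v, 0 ≤ g v)
    (hi : Integrable g) (h2 : Integrable fun v => g v * ‖v‖ ^ 2)
    (he : Integrable fun v => g v * Real.log (g v)) :
    Integrable fun v => g v * Real.log (g v / gaussDensity τ v) := by
  simp_rw [fun v => mul_log_div_gaussDensity hτ (hg v) v]
  exact (he.add (hi.const_mul _)).add (h2.const_mul _)

namespace IsFisherDensity

variable {g : V → ℝ} {ξ : V → V} {τ : ℝ}

/-- The logarithmic Sobolev inequality for the truncated and mollified density. -/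
lemma lintegral_mollified_le (h : IsFisherDensity g ξ) {η : V → ℝ} {δ : ℝ}
    (hη : IsMollifier η δ) (hτ : 0 < τ) (n : ℕ) {ε : ℝ}
    (hε : ∀ v, 2 * ‖fderiv ℝ (cutoff n) v‖ + δ / τ ≤ ε) {c : ℝ} (hc : 0 < c) :
    ∫⁻ x, ENNReal.ofReal
      (((∫ y, η (x - y) * (cutoff n y ^ 2 * g y)) * (gaussDensity τ x)⁻¹ + c) *
        Real.log ((∫ y, η (x - y) * (cutoff n y ^ 2 * g y)) * (gaussDensity τ x)⁻¹ + c)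
        - ((∫ y, η (x - y) * (cutoff n y ^ 2 * g y)) * (gaussDensity τ x)⁻¹ + c) + 1)
          ∂gaussMeasure τ
      ≤ ENNReal.ofReal (((∫ y, cutoff n y ^ 2 * g y) + c) *
          Real.log ((∫ y, cutoff n y ^ 2 * g y) + c) - ((∫ y, cutoff n y ^ 2 * g y) + c) + 1
          + τ / 2 * ∫ y, g y * (‖ξ y + τ⁻¹ • y‖ + ε) ^ 2) := by
  have := isProbabilityMeasure_gaussMeasure hτ
  set χ := cutoff n with hχ
  have hχs := contDiff_cutoff n
  have hχc : Continuous χ := hχs.continuous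
  set D := gradient χ with hD
  have hDc : Continuous D := continuous_gradient hχs
  have hχD : ∀ v, HasFDerivAt (fun v => χ v ^ 2) (innerSL ℝ ((2 * χ v) • D v)) v := by
    intro v
    have h1 := hasFDerivAt_gradient (hχs.differentiable (by simp) v)
    simp_rw [pow_two]
    refine (h1.fun_mul h1).congr_fderiv ?_
    ext y; simp [hD]; ring
  have hw := (h.weak.hasWeakGradient h.integrable.locallyIntegrable).mul_smooth
    (hχs.pow 2) hχD (by fun_prop)
  set p : V → ℝ := fun x => ∫ y, η (x - y) * (χ y ^ 2 * g y) with hp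
  set Ξ : V → V := fun y => χ y ^ 2 • (g y • ξ y) + g y • ((2 * χ y) • D y) with hΞ
  set P : V → V := fun x => ∫ y, η (x - y) • Ξ y with hP
  set M := gaussDensity τ with hM
  have hM0 : ∀ x, 0 < M x := gaussDensity_pos hτ
  have hMc : Continuous M := (contDiff_gaussDensity τ).continuous
  have hMi : Continuous fun x => (M x)⁻¹ := hMc.inv₀ fun x => (hM0 x).ne'
  have hpd : ∀ x, HasFDerivAt p (innerSL ℝ (P x)) x :=
    hw.hasFDerivAt_convolution hη.contDiff hη.hasCompactSupport
  have hpc : Continuous p := continuous_iff_continuousAt.2 fun x => (hpd x).continuousAt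
  have hp0 : ∀ x, 0 ≤ p x := fun x => integral_nonneg fun y =>
    mul_nonneg (hη.nonneg _) (mul_nonneg (sq_nonneg _) (h.nonneg y))
  have hχsupp : HasCompactSupport χ := hasCompactSupport_cutoff n
  have hκg : HasCompactSupport fun y => χ y ^ 2 * g y :=
    hχsupp.mono fun y hy hc => hy (by simp [hc])
  have hpsupp : HasCompactSupport p := by
    rw [hp, ← IsMollifier.convolution_eq (η := η)]
    exact hη.hasCompactSupport.convolution _ hκg
  have hΞsupp : HasCompactSupport Ξ := hχsupp.mono fun y hy hc => hy (by simp [hΞ, hc])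
  have hPconv : (η ⋆[ContinuousLinearMap.lsmul ℝ ℝ] Ξ) = P := by
    ext1 x; rw [convolution_lsmul_swap]
  have hPsupp : HasCompactSupport P := by
    rw [← hPconv]; exact hη.hasCompactSupport.convolution _ hΞsupp
  have hPc : Continuous P := by
    rw [← hPconv]
    exact hη.hasCompactSupport.continuous_convolution_left _ hη.contDiff.continuous
      hw.locallyIntegrable_grad
  -- The constant $c$ keeps $u$ away from $0$. Since $p$ has compact support, $u$ and its gradient
  -- $G$ are bounded although $1/M$ is not.
  let u : V → ℝ := fun x => p x * (M x)⁻¹ + c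
  let G : V → V := fun x => (M x)⁻¹ • (P x + (p x / τ) • x)
  have hud : ∀ x, HasFDerivAt u (innerSL ℝ (G x)) x := by
    intro x
    refine (((hpd x).fun_mul (hasFDerivAt_inv_gaussDensity hτ x)).add_const c).congr_fderiv ?_
    ext y
    simp [G]
    ring
  have hGc : Continuous G := by fun_prop
  obtain ⟨C, hC⟩ := (hpc.mul hMi).bounded_above_of_compact_support hpsupp.mul_right
  have hpx : HasCompactSupport fun x : V => (p x / τ) • x :=
    hpsupp.mono fun y hy hc => hy (by simp [hc])
  have hGsupp : HasCompactSupport G :=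
    (hPsupp.add hpx).mono fun y hy hc => hy (by
      simp only [Pi.add_apply] at hc
      simp only [G, hc, smul_zero])
  obtain ⟨L, hL⟩ := hGc.bounded_above_of_compact_support hGsupp
  have hreg : IsRegularDensity u G c (C + c) L :=
    ⟨hud, hGc, hc, fun x => le_add_of_nonneg_left (mul_nonneg (hp0 x) (inv_nonneg.2 (hM0 x).le)),
      fun x => by simp only [u]; gcongr; exact (le_abs_self _).trans (hC x), hL⟩
  have hκi : Integrable fun y => χ y ^ 2 * g y := by
    refine h.integrable.bdd_mul (c := 1) (hχc.pow 2).aestronglyMeasurable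
      (Eventually.of_forall fun y => ?_)
    rw [norm_pow, Real.norm_of_nonneg (cutoff_nonneg n y)]
    exact pow_le_one₀ (cutoff_nonneg n y) (cutoff_le_one n y)
  have hpi : Integrable p := hη.integrable_convolution hκi
  refine hreg.lintegral_le hτ ?_ ?_
  · have hQi := hη.integrable_convolution (h.integrable_sq_add τ ε)
    rw [integral_gaussMeasure hτ, ← hη.integral_convolution (h.integrable_sq_add τ ε)]
    refine integral_mono_of_nonneg (Eventually.of_forall fun x => ?_) hQi
      (Eventually.of_forall fun x => ?_)
    · exact mul_nonneg (hM0 x).le (div_nonneg (sq_nonneg _) (hc.le.trans (hreg.lower x)))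
    · have hb := h.norm_sq_mollified_le hη hτ hχc (cutoff_nonneg n) (cutoff_le_one n) (D := D)
        (ε := ε) (fun v => by rw [hD, norm_gradient]; exact hε v) hw.locallyIntegrable_grad x
      set Q := ∫ y, η (x - y) * (g y * (‖ξ y + τ⁻¹ • y‖ + ε) ^ 2)
      have hQ0 : 0 ≤ Q := integral_nonneg fun y =>
        mul_nonneg (hη.nonneg _) (mul_nonneg (h.nonneg y) (sq_nonneg _))
      have hM0x := hM0 x
      have hp0x := hp0 x
      -- The weights $M$ cancel. The denominator $p+cM$ stays positive where $p$ vanishes, and it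
      -- exceeds $p$, so the factor $p$ of the Cauchy–Schwarz bound divides out.
      have e : M x * (‖G x‖ ^ 2 / u x) = ‖P x + (p x / τ) • x‖ ^ 2 / (p x + c * M x) := by
        simp only [G, u]
        rw [norm_smul, norm_inv, Real.norm_of_nonneg hM0x.le]
        field_simp
      simp only
      rw [e, div_le_iff₀ (by positivity)]
      calc _ ≤ p x * Q := hb
        _ ≤ _ := by nlinarith [mul_nonneg hQ0 (mul_nonneg hc.le hM0x.le)]
  · rw [integral_gaussMeasure hτ]
    have e : ∀ x, M x * u x = p x + c * M x := by
      intro x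
      have := (hM0 x).ne'
      simp only [u]; field_simp
    have e' : ∫ x, gaussDensity τ x * u x = ∫ x, p x + c * M x := integral_congr_ae
      (Eventually.of_forall e)
    rw [e', integral_add hpi ((integrable_gaussDensity hτ).const_mul c), integral_const_mul,
      integral_gaussDensity hτ, hη.integral_convolution hκi, mul_one]

lemma integrable_mul_log_div (h : IsFisherDensity g ξ) (hτ : 0 < τ) :
    Integrable fun v => g v * Real.log (g v / gaussDensity τ v) :=
  integrable_mul_log_div_gaussDensity hτ h.nonneg h.integrable h.integrable_norm_sq
    h.integrable_entropy

/-- Both $g$ and the Gaussian have mass $1$, so the affine correction contributes nothing. -/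
lemma lintegral_relative_entropy (h : IsFisherDensity g ξ) (hτ : 0 < τ) :
    ∫⁻ x, ENNReal.ofReal (g x * (gaussDensity τ x)⁻¹ * Real.log (g x * (gaussDensity τ x)⁻¹)
        - g x * (gaussDensity τ x)⁻¹ + 1) ∂gaussMeasure τ
      = ENNReal.ofReal (∫ v, g v * Real.log (g v / gaussDensity τ v)) := by
  have hM0 := gaussDensity_pos hτ
  have i1 : Integrable fun x => g x * Real.log (g x / gaussDensity τ x) - g x :=
    (h.integrable_mul_log_div hτ).sub h.integrable
  have e : ∀ x, gaussDensity τ x * (g x * (gaussDensity τ x)⁻¹ *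
      Real.log (g x * (gaussDensity τ x)⁻¹) - g x * (gaussDensity τ x)⁻¹ + 1)
      = g x * Real.log (g x / gaussDensity τ x) - g x + gaussDensity τ x := by
    intro x
    have := (hM0 x).ne'
    rw [← div_eq_mul_inv]; field_simp
  rw [← ofReal_integral_eq_lintegral_ofReal]
  · rw [integral_gaussMeasure hτ]
    simp_rw [e]
    rw [integral_add i1 (integrable_gaussDensity hτ),
      integral_sub (h.integrable_mul_log_div hτ) h.integrable, h.mass, integral_gaussDensity hτ]
    ring_nf
  · rw [integrable_gaussMeasure hτ]
    simp_rw [e]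
    exact i1.add (integrable_gaussDensity hτ)
  · exact Eventually.of_forall fun x => mul_log_sub_add_one_nonneg
      (mul_nonneg (h.nonneg x) (inv_nonneg.2 (hM0 x).le))

/-- The Gaussian logarithmic Sobolev inequality for weakly differentiable densities. -/
theorem logSobolev (h : IsFisherDensity g ξ) (hτ : 0 < τ) :
    ∫ v, g v * Real.log (g v / gaussDensity τ v)
      ≤ τ / 2 * ∫ v, g v * ‖ξ v + τ⁻¹ • v‖ ^ 2 := by
  have := isProbabilityMeasure_gaussMeasure hτ
  obtain ⟨K, hK0, hK⟩ := exists_norm_fderiv_cutoff_le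
  let φ : ℕ → ContDiffBump (0 : V) := fun n =>
    ⟨(n + 1 : ℝ)⁻¹, 2 * (n + 1 : ℝ)⁻¹, by positivity, by
      have : (0 : ℝ) < (n + 1 : ℝ)⁻¹ := by positivity
      linarith⟩
  let δ : ℕ → ℝ := fun n => 2 * (n + 1 : ℝ)⁻¹
  have hη : ∀ n, IsMollifier ((φ n).normed volume) (δ n) := fun n =>
    ⟨(φ n).contDiff_normed, (φ n).hasCompactSupport_normed, (φ n).nonneg_normed,
      (φ n).integral_normed, fun x hx => by
        rw [← Function.notMem_support, (φ n).support_normed_eq, mem_ball_zero_iff, not_lt]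
        exact hx⟩
  -- The part $2K$ pays for the gradient of the cutoff, the part $2/\tau$ for the mollification
  -- radius $\delta_n=2/(n+1)$.
  let ε : ℕ → ℝ := fun n => (2 * K + 2 / τ) * (n + 1 : ℝ)⁻¹
  have hε : ∀ n v, 2 * ‖fderiv ℝ (cutoff n) v‖ + δ n / τ ≤ ε n := by
    intro n v
    have h1 := hK n v
    have h2 : ε n = 2 * (K / (n + 1)) + δ n / τ := by simp only [ε, δ]; field_simp
    rw [h2]; linarith
  have hinv : Tendsto (fun n : ℕ => (n + 1 : ℝ)⁻¹) atTop (𝓝 0) := by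
    simpa using tendsto_one_div_add_atTop_nhds_zero_nat (𝕜 := ℝ)
  have hδ0 : Tendsto δ atTop (𝓝 0) := by simpa using hinv.const_mul 2
  have hε0 : Tendsto ε atTop (𝓝 0) := by simpa using hinv.const_mul (2 * K + 2 / τ)
  let p : ℕ → V → ℝ := fun n x => ∫ y, (φ n).normed volume (x - y) * (cutoff n y ^ 2 * g y)
  let u : ℕ → V → ℝ := fun n x => p n x * (gaussDensity τ x)⁻¹ + (n + 1 : ℝ)⁻¹
  let m : ℕ → ℝ := fun n => (∫ y, cutoff n y ^ 2 * g y) + (n + 1 : ℝ)⁻¹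
  let J : ℕ → ℝ := fun n => ∫ y, g y * (‖ξ y + τ⁻¹ • y‖ + ε n) ^ 2
  have hle : ∀ n, ∫⁻ x, ENNReal.ofReal (u n x * Real.log (u n x) - u n x + 1) ∂gaussMeasure τ
      ≤ ENNReal.ofReal (m n * Real.log (m n) - m n + 1 + τ / 2 * J n) := fun n =>
    h.lintegral_mollified_le (hη n) hτ n (hε n) (by positivity)
  have hm : Tendsto m atTop (𝓝 1) := by
    have h1 : Tendsto (fun n => ∫ y, cutoff n y ^ 2 * g y) atTop (𝓝 (∫ y, g y)) := by
      refine tendsto_integral_of_dominated_convergence g (fun n =>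
        ((contDiff_cutoff n).continuous.pow 2).aestronglyMeasurable.mul
          h.aestronglyMeasurable_density) h.integrable
        (fun n => Eventually.of_forall fun y => ?_) (Eventually.of_forall fun y => ?_)
      · rw [norm_mul, norm_pow, Real.norm_of_nonneg (cutoff_nonneg n y),
          Real.norm_of_nonneg (h.nonneg y)]
        exact mul_le_of_le_one_left (h.nonneg y)
          (pow_le_one₀ (cutoff_nonneg n y) (cutoff_le_one n y))
      · simpa using ((tendsto_cutoff y).pow 2).mul_const (g y)
    simpa [m, h.mass] using h1.add hinv
  have hJ : Tendsto J atTop (𝓝 (∫ v, g v * ‖ξ v + τ⁻¹ • v‖ ^ 2)) := by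
    have i0 : Integrable fun v => g v * ‖ξ v + τ⁻¹ • v‖ ^ 2 := by
      simpa using h.integrable_sq_add τ 0
    -- From $2r=(r+1)^2-r^2-1$ with $r=|\xi+v/\tau|$.
    have i1 : Integrable fun v => g v * ‖ξ v + τ⁻¹ • v‖ := by
      have := ((h.integrable_sq_add τ 1).sub i0).sub h.integrable
      refine (this.const_mul (1 / 2)).congr (Eventually.of_forall fun v => ?_)
      simp only [Pi.sub_apply]; ring
    have e : ∀ n, J n = (∫ v, g v * ‖ξ v + τ⁻¹ • v‖ ^ 2)
        + (2 * ε n) * (∫ v, g v * ‖ξ v + τ⁻¹ • v‖) + ε n ^ 2 := by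
      intro n
      have e1 : ∀ v, g v * (‖ξ v + τ⁻¹ • v‖ + ε n) ^ 2 = g v * ‖ξ v + τ⁻¹ • v‖ ^ 2
        + (2 * ε n) * (g v * ‖ξ v + τ⁻¹ • v‖) + ε n ^ 2 * g v := fun v => by ring
      have i2 : Integrable fun v => g v * ‖ξ v + τ⁻¹ • v‖ ^ 2
        + (2 * ε n) * (g v * ‖ξ v + τ⁻¹ • v‖) := i0.add (i1.const_mul _)
      simp only [J]
      simp_rw [e1]
      rw [integral_add i2 (h.integrable.const_mul _), integral_add i0 (i1.const_mul _),
        integral_const_mul, integral_const_mul, h.mass, mul_one]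
    rw [show J = _ from funext e]
    simpa using (((hε0.const_mul 2).mul_const (∫ v, g v * ‖ξ v + τ⁻¹ • v‖)).const_add
      (∫ v, g v * ‖ξ v + τ⁻¹ • v‖ ^ 2)).add (hε0.pow 2)
  have hlim : Tendsto (fun n => ENNReal.ofReal (m n * Real.log (m n) - m n + 1 + τ / 2 * J n))
      atTop (𝓝 (ENNReal.ofReal (τ / 2 * ∫ v, g v * ‖ξ v + τ⁻¹ • v‖ ^ 2))) := by
    apply ENNReal.tendsto_ofReal
    have h1 := (Real.continuous_mul_log.tendsto 1).comp hm
    simpa using ((h1.sub hm).add_const 1).add (hJ.const_mul (τ / 2))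
  have hae : ∀ᵐ x ∂gaussMeasure τ, Tendsto (fun n => u n x) atTop
      (𝓝 (g x * (gaussDensity τ x)⁻¹)) := by
    refine (withDensity_absolutelyContinuous _ _).ae_le ?_
    have h1 := ContDiffBump.ae_convolution_tendsto_right_of_locallyIntegrable
      (μ := (volume : Measure V)) (φ := φ) (K := 2) hδ0 (Eventually.of_forall fun n => le_rfl)
      h.integrable.locallyIntegrable
    filter_upwards [h1] with x hx
    have h2 : Tendsto (fun n => p n x) atTop (𝓝 (g x)) := by
      refine hx.congr' ?_
      -- The mollifiers are supported in balls of radius at most $2$, so for large $n$ the cutoff is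
      -- invisible near $x$ and Lebesgue differentiation for $g$ itself gives the limit.
      filter_upwards [eventually_cutoff_eq_one x 2] with n hn
      rw [IsMollifier.convolution_eq]
      simp only [p]
      congr 1; ext y
      by_cases hy : δ n ≤ ‖x - y‖
      · simp [(hη n).eq_zero _ hy]
      · have hδ2 : δ n ≤ 2 := by
          have : (n + 1 : ℝ)⁻¹ ≤ 1 := inv_le_one_of_one_le₀ (by simp)
          simp only [δ]; linarith
        rw [hn y (by rw [Metric.mem_ball, dist_comm, dist_eq_norm]; linarith)]
        simp
    simpa [u] using (h2.mul_const (gaussDensity τ x)⁻¹).add hinv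
  have hpm : ∀ n, Measurable (u n) := by
    intro n
    have hκg : LocallyIntegrable fun y => cutoff n y ^ 2 * g y := by
      simpa [mul_comm] using h.integrable.locallyIntegrable.smul_continuous
        ((contDiff_cutoff n).continuous.pow 2)
    have hc := (hη n).hasCompactSupport.continuous_convolution_left
      (ContinuousLinearMap.lsmul ℝ ℝ) (hη n).contDiff.continuous hκg
    rw [IsMollifier.convolution_eq] at hc
    exact (hc.measurable.mul (measurable_gaussDensity τ).inv).add_const _
  have hfatou : ENNReal.ofReal (∫ v, g v * Real.log (g v / gaussDensity τ v))
      ≤ ENNReal.ofReal (τ / 2 * ∫ v, g v * ‖ξ v + τ⁻¹ • v‖ ^ 2) := by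
    rw [← h.lintegral_relative_entropy hτ]
    -- Continuity of $r\log r$ up to $r=0$ gives the pointwise limit also where $g$ vanishes.
    calc _ = ∫⁻ x, liminf (fun n => ENNReal.ofReal
            (u n x * Real.log (u n x) - u n x + 1)) atTop ∂gaussMeasure τ := by
          refine lintegral_congr_ae ?_
          filter_upwards [hae] with x hx
          refine (Tendsto.liminf_eq ?_).symm
          apply ENNReal.tendsto_ofReal
          exact (((Real.continuous_mul_log.tendsto _).comp hx).sub hx).add_const 1
      _ ≤ liminf (fun n => ∫⁻ x, ENNReal.ofReal
            (u n x * Real.log (u n x) - u n x + 1) ∂gaussMeasure τ) atTop := by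
          refine lintegral_liminf_le fun n => ?_
          exact ((((hpm n).mul (hpm n).log).sub (hpm n)).add_const 1).ennreal_ofReal
      _ ≤ liminf (fun n => ENNReal.ofReal
            (m n * Real.log (m n) - m n + 1 + τ / 2 * J n)) atTop :=
          liminf_le_liminf (Eventually.of_forall hle)
      _ = _ := hlim.liminf_eq
  have hnn : 0 ≤ τ / 2 * ∫ v, g v * ‖ξ v + τ⁻¹ • v‖ ^ 2 :=
    mul_nonneg (by positivity) (integral_nonneg fun v => mul_nonneg (h.nonneg v) (sq_nonneg _))
  exact (ENNReal.ofReal_le_ofReal_iff hnn).1 hfatou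

end IsFisherDensity

/-! ### Integration by parts against the score -/

/-- The measure with density `g`. -/
noncomputable def densityMeasure (g : V → ℝ) : Measure V :=
  volume.withDensity fun v => ENNReal.ofReal (g v)

/-- Centred probability densities of energy `3` with a weak logarithmic gradient. -/
structure IsCenteredDensity (g : V → ℝ) (ξ : V → V) : Prop where
  nonneg : ∀ v, 0 ≤ g v
  integrable : Integrable g
  mass : ∫ v, g v = 1
  momentum : ∫ v, g v • v = 0
  integrable_norm_sq : Integrable fun v => g v * ‖v‖ ^ 2
  energy : ∫ v, g v * ‖v‖ ^ 2 = 3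
  aestronglyMeasurable : AEStronglyMeasurable ξ
  weak : IsWeakLogGradient g ξ

namespace IsCenteredDensity
variable {g : V → ℝ} {ξ : V → V}

lemma aemeasurable_ofReal (h : IsCenteredDensity g ξ) :
    AEMeasurable fun v => ENNReal.ofReal (g v) :=
  h.integrable.aestronglyMeasurable.aemeasurable.ennreal_ofReal

lemma integral_eq (h : IsCenteredDensity g ξ) (f : V → ℝ) :
    ∫ v, f v ∂densityMeasure g = ∫ v, g v * f v := by
  rw [densityMeasure, integral_withDensity_eq_integral_toReal_smul₀ h.aemeasurable_ofReal
    (by simp)]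
  simp [ENNReal.toReal_ofReal (h.nonneg _)]

lemma integrable_iff (h : IsCenteredDensity g ξ) (f : V → ℝ) :
    Integrable f (densityMeasure g) ↔ Integrable fun v => g v * f v := by
  rw [densityMeasure, integrable_withDensity_iff_integrable_smul₀' h.aemeasurable_ofReal
    (by simp)]
  simp [ENNReal.toReal_ofReal (h.nonneg _)]

lemma lintegral_eq (h : IsCenteredDensity g ξ) {f : V → ℝ≥0∞} (hf : AEMeasurable f) :
    ∫⁻ v, f v ∂densityMeasure g = ∫⁻ v, ENNReal.ofReal (g v) * f v :=
  lintegral_withDensity_eq_lintegral_mul₀ h.aemeasurable_ofReal hf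

lemma absolutelyContinuous (g : V → ℝ) : densityMeasure g ≪ volume :=
  withDensity_absolutelyContinuous _ _

lemma isProbabilityMeasure (h : IsCenteredDensity g ξ) :
    IsProbabilityMeasure (densityMeasure g) := by
  constructor
  rw [densityMeasure, withDensity_apply _ MeasurableSet.univ, setLIntegral_univ,
    ← ofReal_integral_eq_lintegral_ofReal h.integrable (Eventually.of_forall h.nonneg), h.mass]
  simp

lemma integrable_one_add (h : IsCenteredDensity g ξ) :
    Integrable (fun v => 1 + ‖v‖ ^ 2) (densityMeasure g) := by
  rw [h.integrable_iff]
  refine (h.integrable.add h.integrable_norm_sq).congr (Eventually.of_forall fun v => ?_)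
  simp only [Pi.add_apply]; ring

lemma integrable_of_bound (h : IsCenteredDensity g ξ) {f : V → ℝ} (hf : Continuous f) {C : ℝ}
    (hC : ∀ v, |f v| ≤ C * (1 + ‖v‖ ^ 2)) : Integrable f (densityMeasure g) :=
  (h.integrable_one_add.const_mul C).mono' hf.aestronglyMeasurable (Eventually.of_forall hC)

lemma hasWeakGradient (h : IsCenteredDensity g ξ) : HasWeakGradient g fun v => g v • ξ v :=
  h.weak.hasWeakGradient h.integrable.locallyIntegrable

lemma integrable_mul_score (h : IsCenteredDensity g ξ) {φ : V → ℝ} (hφ : Continuous φ)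
    (hφc : HasCompactSupport φ) (a : V) :
    Integrable (fun v => φ v * inner ℝ a (ξ v)) (densityMeasure g) := by
  rw [h.integrable_iff]
  refine (h.hasWeakGradient.integrable_mul hφ hφc a).congr (Eventually.of_forall fun v => ?_)
  simp only [real_inner_smul_right]; ring

lemma integral_score (h : IsCenteredDensity g ξ) {φ : V → ℝ} (hφ : ContDiff ℝ ∞ φ)
    (hφc : HasCompactSupport φ) (a : V) :
    ∫ v, φ v * inner ℝ a (ξ v) ∂densityMeasure g = -∫ v, fderiv ℝ φ v a ∂densityMeasure g := by
  rw [h.integral_eq, h.integral_eq, h.hasWeakGradient.integral_eq φ hφ hφc a, neg_neg]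
  congr 1; ext v
  rw [real_inner_smul_right]; ring

lemma tendsto_integral_cutoff (h : IsCenteredDensity g ξ) {f : V → ℝ} (hf : Continuous f) {C : ℝ}
    (hC : ∀ v, |f v| ≤ C * (1 + ‖v‖ ^ 2)) :
    Tendsto (fun n => ∫ v, cutoff n v * f v ∂densityMeasure g) atTop
      (𝓝 (∫ v, f v ∂densityMeasure g)) := by
  refine tendsto_integral_of_dominated_convergence _ (fun n =>
    ((contDiff_cutoff n).continuous.mul hf).aestronglyMeasurable)
    (h.integrable_one_add.const_mul C) (fun n => Eventually.of_forall fun v => ?_)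
    (Eventually.of_forall fun v => ?_)
  · rw [norm_mul, Real.norm_of_nonneg (cutoff_nonneg n v)]
    exact (mul_le_of_le_one_left (norm_nonneg _) (cutoff_le_one n v)).trans (hC v)
  · simpa using (tendsto_cutoff v).mul_const (f v)

/-- Integration by parts against the score for test functions of quadratic growth. -/
lemma tendsto_integral_cutoff_score (h : IsCenteredDensity g ξ) {f : V → ℝ}
    (hf : ContDiff ℝ ∞ f) (a : V) {C : ℝ} (hC : ∀ v, |f v| ≤ C * (1 + ‖v‖ ^ 2))
    (hC' : ∀ v, |fderiv ℝ f v a| ≤ C * (1 + ‖v‖ ^ 2)) :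
    Tendsto (fun n => ∫ v, cutoff n v * f v * inner ℝ a (ξ v) ∂densityMeasure g) atTop
      (𝓝 (-∫ v, fderiv ℝ f v a ∂densityMeasure g)) := by
  obtain ⟨K, hK0, hK⟩ := exists_norm_fderiv_cutoff_le
  have hC0 : 0 ≤ C := by simpa using (abs_nonneg _).trans (hC 0)
  have e : ∀ n, ∫ v, cutoff n v * f v * inner ℝ a (ξ v) ∂densityMeasure g
      = -∫ v, (cutoff n v * fderiv ℝ f v a + f v * fderiv ℝ (cutoff n) v a)
        ∂densityMeasure g := by
    intro n
    rw [h.integral_score ((contDiff_cutoff n).mul hf) (hasCompactSupport_cutoff n).mul_right a]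
    congr 2; ext v
    rw [(((contDiff_cutoff n).differentiable (by simp) v).hasFDerivAt.fun_mul
      (hf.differentiable (by simp) v).hasFDerivAt).fderiv]
    simp
  simp_rw [e]
  have hfa : Continuous fun v => fderiv ℝ f v a :=
    (hf.continuous_fderiv (by simp)).clm_apply continuous_const
  refine Tendsto.neg (tendsto_integral_of_dominated_convergence
    (fun v => (C + C * (K * ‖a‖)) * (1 + ‖v‖ ^ 2)) (fun n => ?_)
    (h.integrable_one_add.const_mul _) (fun n => Eventually.of_forall fun v => ?_)
    (Eventually.of_forall fun v => ?_))
  · exact (((contDiff_cutoff n).continuous.mul hfa).add (hf.continuous.mul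
      (((contDiff_cutoff n).continuous_fderiv (by simp)).clm_apply
        continuous_const))).aestronglyMeasurable
  · have h1 : |fderiv ℝ (cutoff n) v a| ≤ K * ‖a‖ := by
      refine ((fderiv ℝ (cutoff n) v).le_opNorm a).trans ?_
      gcongr
      refine (hK n v).trans (div_le_self hK0 (by simp))
    rw [Real.norm_eq_abs]
    refine (abs_add_le _ _).trans ?_
    rw [abs_mul, abs_mul, abs_of_nonneg (cutoff_nonneg n v)]
    calc _ ≤ 1 * (C * (1 + ‖v‖ ^ 2)) + (C * (1 + ‖v‖ ^ 2)) * (K * ‖a‖) := by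
          gcongr
          · exact cutoff_le_one n v
          · exact hC' v
          · exact hC v
      _ = _ := by ring
  -- Near a fixed point the cutoffs are eventually constant, so their derivatives vanish there;
  -- dominated convergence removes the commutator term.
  · have h1 : Tendsto (fun n => fderiv ℝ (cutoff n) v a) atTop (𝓝 0) := by
      refine tendsto_const_nhds.congr' ?_
      filter_upwards [eventually_cutoff_eq_one v 1] with n hn
      have : cutoff n =ᶠ[𝓝 v] fun _ => 1 := by
        filter_upwards [Metric.ball_mem_nhds v one_pos] with y hy using hn y hy
      rw [this.fderiv_eq]; simp
    simpa using ((tendsto_cutoff v).mul_const (fderiv ℝ f v a)).add (h1.const_mul (f v))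

end IsCenteredDensity

/-! ### Recovering the score from the cross products -/

/-- The `(a, b)` component of `(v - w) × (ξ(v) - ξ(w))`. -/
noncomputable def crossTerm (ξ : V → V) (a b v w : V) : ℝ :=
  inner ℝ a (v - w) * inner ℝ b (ξ v - ξ w) - inner ℝ b (v - w) * inner ℝ a (ξ v - ξ w)

/-- The part of (twice) the entropy production carried by the `(a, b)` component. -/
noncomputable def crossEnergy (γ : ℝ) (g : V → ℝ) (ξ : V → V) (a b : V) : ℝ≥0∞ :=
  ∫⁻ v, ∫⁻ w, ENNReal.ofReal (‖v - w‖ ^ γ * crossTerm ξ a b v w ^ 2)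
    ∂densityMeasure g ∂densityMeasure g

lemma one_le_bracket (v : V) : 1 ≤ bracket v := by
  unfold bracket
  rw [Real.one_le_sqrt]
  nlinarith [sq_nonneg ‖v‖]

lemma norm_le_bracket (v : V) : ‖v‖ ≤ bracket v := by
  unfold bracket
  exact Real.le_sqrt_of_sq_le (by linarith)

lemma continuous_bracket : Continuous bracket := by unfold bracket; fun_prop

namespace IsCenteredDensity
variable {g : V → ℝ} {ξ : V → V} {γ : ℝ}

lemma aestronglyMeasurable_score (h : IsCenteredDensity g ξ) :
    AEStronglyMeasurable ξ (densityMeasure g) :=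
  h.aestronglyMeasurable.mono_ac (absolutelyContinuous g)

lemma aemeasurable_inner_score (h : IsCenteredDensity g ξ) (a : V) :
    AEMeasurable (fun v => inner ℝ a (ξ v)) (densityMeasure g) :=
  ((innerSL ℝ a).continuous.comp_aestronglyMeasurable h.aestronglyMeasurable_score).aemeasurable

lemma aemeasurable_crossTerm (h : IsCenteredDensity g ξ) (a b v : V) :
    AEMeasurable (fun w => crossTerm ξ a b v w) (densityMeasure g) := by
  have ha := h.aemeasurable_inner_score a
  have hb := h.aemeasurable_inner_score b
  have hm : ∀ c : V, AEMeasurable (fun w : V => inner ℝ c (v - w)) (densityMeasure g) :=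
    fun c => (Continuous.measurable (by fun_prop)).aemeasurable
  simp only [crossTerm, inner_sub_right _ (ξ v)]
  exact ((hm a).mul (hb.const_sub _)).sub ((hm b).mul (ha.const_sub _))

lemma aestronglyMeasurable_crossTerm_prod (h : IsCenteredDensity g ξ) (a b : V) :
    AEStronglyMeasurable (fun p : V × V => crossTerm ξ a b p.1 p.2)
      ((densityMeasure g).prod (densityMeasure g)) := by
  have := h.isProbabilityMeasure
  have h4 : ∀ c : V, AEStronglyMeasurable (fun p : V × V => inner ℝ c (ξ p.1 - ξ p.2))
      ((densityMeasure g).prod (densityMeasure g)) := fun c =>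
    (innerSL ℝ c).continuous.comp_aestronglyMeasurable
      (h.aestronglyMeasurable_score.comp_fst.sub h.aestronglyMeasurable_score.comp_snd)
  have h5 : ∀ c : V, AEStronglyMeasurable (fun p : V × V => inner ℝ c (p.1 - p.2))
      ((densityMeasure g).prod (densityMeasure g)) := fun c =>
    Continuous.aestronglyMeasurable (by fun_prop)
  exact ((h5 a).mul (h4 b)).sub ((h5 b).mul (h4 a))

lemma aemeasurable_crossEnergy_prod (h : IsCenteredDensity g ξ) (γ : ℝ) (a b : V) :
    AEMeasurable (fun p : V × V =>
      ENNReal.ofReal (‖p.1 - p.2‖ ^ γ * crossTerm ξ a b p.1 p.2 ^ 2))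
      ((densityMeasure g).prod (densityMeasure g)) := by
  have : Measurable fun p : V × V => ‖p.1 - p.2‖ := Continuous.measurable (by fun_prop)
  exact ((this.pow_const γ).aemeasurable.mul
    ((h.aestronglyMeasurable_crossTerm_prod a b).aemeasurable.pow_const 2)).ennreal_ofReal

/-- In $\mathscr I_\gamma$ the prefactor $\langle v\rangle^\gamma$ is at least $1$ for $\gamma\ge0$
and can be dropped. -/
lemma lintegral_weight_le (h : IsCenteredDensity g ξ) (hγ : 0 ≤ γ) {ψ : V → ℝ}
    (hψ : Continuous ψ) (hψb : ∀ w, |ψ w| ≤ bracket w) (v : V) :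
    ∫⁻ w, ENNReal.ofReal (‖v - w‖ ^ (-γ) * ψ w ^ 2) ∂densityMeasure g ≤ iConst γ g := by
  rw [h.lintegral_eq]
  · calc _ ≤ ∫⁻ w, ENNReal.ofReal (g w * ‖w - v‖ ^ (-γ) * bracket w ^ 2) := by
          refine lintegral_mono fun w => ?_
          rw [← ENNReal.ofReal_mul (h.nonneg w), norm_sub_rev v w, ← mul_assoc]
          apply ENNReal.ofReal_le_ofReal
          have := h.nonneg w
          have h2 : ψ w ^ 2 ≤ bracket w ^ 2 := sq_le_sq' (by linarith [neg_abs_le (ψ w), hψb w])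
            ((le_abs_self _).trans (hψb w))
          gcongr
      _ ≤ ENNReal.ofReal (bracket v ^ γ) *
            ∫⁻ w, ENNReal.ofReal (g w * ‖w - v‖ ^ (-γ) * bracket w ^ 2) := by
          refine le_mul_of_one_le_left zero_le ?_
          rw [ENNReal.one_le_ofReal]
          exact Real.one_le_rpow (one_le_bracket v) hγ
      _ ≤ iConst γ g := le_iSup (fun v => ENNReal.ofReal (bracket v ^ γ) *
            ∫⁻ w, ENNReal.ofReal (g w * ‖w - v‖ ^ (-γ) * bracket w ^ 2)) v
  · have : Measurable fun w : V => ‖v - w‖ := (Continuous.measurable (by fun_prop))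
    exact ((this.pow_const _).mul (hψ.measurable.pow_const 2)).ennreal_ofReal.aemeasurable

/-- The weighted Cauchy–Schwarz inequality in the variable `w`. -/
lemma ofReal_sq_integral_crossTerm_le (h : IsCenteredDensity g ξ) (hγ : 0 ≤ γ) {ψ : V → ℝ}
    (hψ : Continuous ψ) (hψb : ∀ w, |ψ w| ≤ bracket w) (a b v : V) :
    ENNReal.ofReal ((∫ w, crossTerm ξ a b v w * ψ w ∂densityMeasure g) ^ 2)
      ≤ (∫⁻ w, ENNReal.ofReal (‖v - w‖ ^ γ * crossTerm ξ a b v w ^ 2) ∂densityMeasure g)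
        * iConst γ g := by
  set μ := densityMeasure g
  set q := crossTerm ξ a b v
  have hq : AEMeasurable q μ := h.aemeasurable_crossTerm a b v
  have hz : Measurable fun w : V => ‖v - w‖ := Continuous.measurable (by fun_prop)
  let F : V → ℝ≥0∞ := fun w => ENNReal.ofReal (‖v - w‖ ^ (γ / 2) * |q w|)
  let H : V → ℝ≥0∞ := fun w => ENNReal.ofReal (‖v - w‖ ^ (-γ / 2) * |ψ w|)
  have hF : AEMeasurable F μ :=
    ((hz.pow_const _).aemeasurable.mul hq.norm).ennreal_ofReal
  have hH : AEMeasurable H μ :=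
    ((hz.pow_const _).aemeasurable.mul hψ.measurable.norm.aemeasurable).ennreal_ofReal
  -- The weights $|v-w|^{\pm\gamma/2}$ cancel only off $w=v$, a null set since $\mu$ has a density.
  have hne : ∀ᵐ w ∂μ, w ≠ v := by
    refine (absolutelyContinuous g).ae_le ?_
    exact compl_mem_ae_iff.2 (measure_singleton v)
  have h1 : ‖∫ w, q w * ψ w ∂μ‖ₑ ≤ ∫⁻ w, (F * H) w ∂μ := by
    refine (enorm_integral_le_lintegral_enorm _).trans (le_of_eq (lintegral_congr_ae ?_))
    filter_upwards [hne] with w hw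
    have hpos : 0 < ‖v - w‖ := norm_pos_iff.2 (sub_ne_zero.2 hw.symm)
    have e : ‖v - w‖ ^ (γ / 2) * ‖v - w‖ ^ (-γ / 2) = 1 := by
      rw [← Real.rpow_add hpos]; simp [neg_div]
    simp only [Pi.mul_apply, F, H]
    rw [← ENNReal.ofReal_mul (by positivity), ← ofReal_norm, norm_mul,
      Real.norm_eq_abs, Real.norm_eq_abs]
    congr 1
    linear_combination (-(|q w| * |ψ w|)) * e
  have h2 := ENNReal.lintegral_mul_le_Lp_mul_Lq μ Real.HolderConjugate.two_two hF hH
  have sqF : ∀ w, F w ^ (2 : ℝ) = ENNReal.ofReal (‖v - w‖ ^ γ * q w ^ 2) := by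
    intro w
    simp only [F]
    rw [ENNReal.ofReal_rpow_of_nonneg (by positivity) (by norm_num), Real.rpow_two, mul_pow,
      sq_abs, ← Real.rpow_natCast, ← Real.rpow_mul (norm_nonneg _)]
    norm_num
  have sqH : ∀ w, H w ^ (2 : ℝ) = ENNReal.ofReal (‖v - w‖ ^ (-γ) * ψ w ^ 2) := by
    intro w
    simp only [H]
    rw [ENNReal.ofReal_rpow_of_nonneg (by positivity) (by norm_num), Real.rpow_two, mul_pow,
      sq_abs, ← Real.rpow_natCast, ← Real.rpow_mul (norm_nonneg _)]
    norm_num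
  simp_rw [sqF, sqH] at h2
  set A := ∫⁻ w, ENNReal.ofReal (‖v - w‖ ^ γ * q w ^ 2) ∂μ
  have h3 := h.lintegral_weight_le hγ hψ hψb v
  set B := ∫⁻ w, ENNReal.ofReal (‖v - w‖ ^ (-γ) * ψ w ^ 2) ∂μ
  have hsq : ∀ X : ℝ≥0∞, (X ^ (1 / 2 : ℝ)) ^ 2 = X := by
    intro X
    rw [← ENNReal.rpow_natCast, ← ENNReal.rpow_mul]; norm_num
  calc ENNReal.ofReal ((∫ w, q w * ψ w ∂μ) ^ 2) = ‖∫ w, q w * ψ w ∂μ‖ₑ ^ 2 := by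
        rw [← ofReal_norm, ← ENNReal.ofReal_pow (norm_nonneg _), Real.norm_eq_abs, sq_abs]
    _ ≤ (A ^ (1 / 2 : ℝ) * B ^ (1 / 2 : ℝ)) ^ 2 := by gcongr; exact h1.trans h2
    _ = A * B := by rw [mul_pow, hsq, hsq]
    _ ≤ _ := by gcongr

lemma abs_inner_le_one_add {b : V} (hb : ‖b‖ = 1) (w : V) : |inner ℝ b w| ≤ 1 * (1 + ‖w‖ ^ 2) := by
  have h1 := abs_real_inner_le_norm b w
  rw [hb, one_mul] at h1
  nlinarith [sq_nonneg (‖w‖ - 1)]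

lemma abs_inner_mul_inner_le {a b : V} (ha : ‖a‖ = 1) (hb : ‖b‖ = 1) (w : V) :
    |inner ℝ a w * inner ℝ b w| ≤ 1 * (1 + ‖w‖ ^ 2) := by
  have h1 := abs_real_inner_le_norm a w
  have h2 := abs_real_inner_le_norm b w
  rw [ha, one_mul] at h1
  rw [hb, one_mul] at h2
  rw [abs_mul]
  nlinarith [mul_le_mul h1 h2 (abs_nonneg _) (norm_nonneg w)]

lemma integral_inner (h : IsCenteredDensity g ξ) (a : V) :
    ∫ v, inner ℝ a v ∂densityMeasure g = 0 := by
  rw [h.integral_eq]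
  have hi : Integrable fun v => g v • v := by
    refine (h.integrable.add h.integrable_norm_sq).mono'
      (h.integrable.aestronglyMeasurable.smul aestronglyMeasurable_id)
      (Eventually.of_forall fun v => ?_)
    have := h.nonneg v
    rw [norm_smul, Real.norm_of_nonneg this]
    simp only [Pi.add_apply]
    nlinarith [mul_nonneg this (sq_nonneg (‖v‖ - 1)), mul_nonneg this (sq_nonneg ‖v‖)]
  have := _root_.integral_inner (𝕜 := ℝ) hi a
  rw [h.momentum, inner_zero_right] at this
  rw [← this]
  congr 1; ext v; rw [real_inner_smul_right]

/-- Expanding the product gives seven integrals. Those with no score of $w$ are moments of $g$: the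
mean and the mixed covariance vanish, leaving $t_b\,a\cdot\xi(v)$. Those with $\xi(w)$ are
integrated by parts: only $\int g\,(b\cdot w)(b\cdot\xi)=-1$ survives and gives $a\cdot v$. The
cutoff is needed because $g\,\xi$ is so far only locally integrable. -/
lemma tendsto_integral_crossTerm (h : IsCenteredDensity g ξ) {a b : V} (ha : ‖a‖ = 1)
    (hb : ‖b‖ = 1) (hab : inner ℝ a b = 0)
    (hT : ∫ v, inner ℝ a v * inner ℝ b v ∂densityMeasure g = 0) (v : V) :
    Tendsto (fun n => ∫ w, crossTerm ξ a b v w * (cutoff n w * inner ℝ b w) ∂densityMeasure g)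
      atTop (𝓝 ((∫ w, inner ℝ b w * inner ℝ b w ∂densityMeasure g) * inner ℝ a (ξ v)
        + inner ℝ a v)) := by
  have := h.isProbabilityMeasure
  have hba : inner ℝ b a = 0 := by rw [real_inner_comm, hab]
  have hbb : inner ℝ b b = 1 := by rw [real_inner_self_eq_norm_sq, hb]; norm_num
  have sm : ∀ c : V, ContDiff ℝ ∞ fun w : V => inner ℝ c w := fun c => (innerSL ℝ c).contDiff
  have hd : ∀ c w : V, HasFDerivAt (fun w : V => inner ℝ c w) (innerSL ℝ c) w :=
    fun c w => (innerSL ℝ c).hasFDerivAt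
  have d1 : ∀ c e w : V, fderiv ℝ (fun w : V => inner ℝ c w) w e = inner ℝ c e := by
    intro c e w; rw [(hd c w).fderiv]; rfl
  have d2 : ∀ c d e w : V, fderiv ℝ (fun w : V => inner ℝ c w * inner ℝ d w) w e
      = inner ℝ c w * inner ℝ d e + inner ℝ d w * inner ℝ c e := by
    intro c d e w
    rw [((hd c w).fun_mul (hd d w)).fderiv]; simp
  have cw : ∀ {f : V → ℝ} (n : ℕ), Continuous f →
      Integrable (fun w => cutoff n w * f w) (densityMeasure g) := by
    intro f n hf
    rw [h.integrable_iff]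
    refine (integrable_mul_of_compactSupport h.integrable.locallyIntegrable
      ((contDiff_cutoff n).continuous.mul hf) (hasCompactSupport_cutoff n).mul_right).congr
      (Eventually.of_forall fun v => ?_)
    simp only [Pi.mul_apply]; ring
  have cs : ∀ {f : V → ℝ} (n : ℕ) (c : V), Continuous f →
      Integrable (fun w => cutoff n w * f w * inner ℝ c (ξ w)) (densityMeasure g) :=
    fun n c hf => h.integrable_mul_score ((contDiff_cutoff n).continuous.mul hf)
      (hasCompactSupport_cutoff n).mul_right c
  have one_le : ∀ w : V, (1 : ℝ) ≤ 2 * (1 + ‖w‖ ^ 2) := fun w => by nlinarith [sq_nonneg ‖w‖]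
  have t1 : Tendsto (fun n => ∫ w, cutoff n w * inner ℝ b w ∂densityMeasure g) atTop (𝓝 0) := by
    have := h.tendsto_integral_cutoff (sm b).continuous (abs_inner_le_one_add hb)
    rwa [h.integral_inner] at this
  have t2 : Tendsto (fun n => ∫ w, cutoff n w * (inner ℝ a w * inner ℝ b w) ∂densityMeasure g)
      atTop (𝓝 0) := by
    have := h.tendsto_integral_cutoff ((sm a).mul (sm b)).continuous
      (abs_inner_mul_inner_le ha hb)
    rwa [hT] at this
  have t3 := h.tendsto_integral_cutoff ((sm b).mul (sm b)).continuous
    (abs_inner_mul_inner_le hb hb)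
  have t4 : Tendsto (fun n => ∫ w, cutoff n w * inner ℝ b w * inner ℝ b (ξ w) ∂densityMeasure g)
      atTop (𝓝 (-1)) := by
    have := h.tendsto_integral_cutoff_score (sm b) b (C := 2)
      (fun w => (abs_inner_le_one_add hb w).trans (by gcongr; norm_num))
      (fun w => by rw [d1, hbb, abs_one]; exact one_le w)
    simpa [d1, hb] using this
  have t5 : Tendsto (fun n => ∫ w, cutoff n w * inner ℝ b w * inner ℝ a (ξ w) ∂densityMeasure g)
      atTop (𝓝 0) := by
    have := h.tendsto_integral_cutoff_score (sm b) a (C := 2)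
      (fun w => (abs_inner_le_one_add hb w).trans (by gcongr; norm_num))
      (fun w => by rw [d1, hba, abs_zero]; positivity)
    simpa [d1, hba] using this
  have t6 : Tendsto (fun n => ∫ w, cutoff n w * (inner ℝ a w * inner ℝ b w) * inner ℝ b (ξ w)
      ∂densityMeasure g) atTop (𝓝 0) := by
    have := h.tendsto_integral_cutoff_score ((sm a).mul (sm b)) b (C := 1)
      (abs_inner_mul_inner_le ha hb)
      (fun w => by rw [d2, hbb, hab, mul_one, mul_zero, add_zero]; exact abs_inner_le_one_add ha w)
    simpa [d2, hb, hab, h.integral_inner] using this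
  have t7 : Tendsto (fun n => ∫ w, cutoff n w * (inner ℝ b w * inner ℝ b w) * inner ℝ a (ξ w)
      ∂densityMeasure g) atTop (𝓝 0) := by
    have := h.tendsto_integral_cutoff_score ((sm b).mul (sm b)) a (C := 1)
      (abs_inner_mul_inner_le hb hb)
      (fun w => by rw [d2, hba]; simp; positivity)
    simpa [d2, hba] using this
  have ca := (sm a).continuous
  have cb := (sm b).continuous
  have cab : Continuous fun w => inner ℝ a w * inner ℝ b w := ca.mul cb
  have cbb : Continuous fun w => inner ℝ b w * inner ℝ b w := cb.mul cb
  have hexp : ∀ n, ∫ w, crossTerm ξ a b v w * (cutoff n w * inner ℝ b w) ∂densityMeasure g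
      = (inner ℝ a v * inner ℝ b (ξ v) - inner ℝ b v * inner ℝ a (ξ v)) *
          (∫ w, cutoff n w * inner ℝ b w ∂densityMeasure g)
        + (-inner ℝ b (ξ v)) * (∫ w, cutoff n w * (inner ℝ a w * inner ℝ b w) ∂densityMeasure g)
        + inner ℝ a (ξ v) * (∫ w, cutoff n w * (inner ℝ b w * inner ℝ b w) ∂densityMeasure g)
        + (-inner ℝ a v) *
          (∫ w, cutoff n w * inner ℝ b w * inner ℝ b (ξ w) ∂densityMeasure g)
        + inner ℝ b v * (∫ w, cutoff n w * inner ℝ b w * inner ℝ a (ξ w) ∂densityMeasure g)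
        + (∫ w, cutoff n w * (inner ℝ a w * inner ℝ b w) * inner ℝ b (ξ w) ∂densityMeasure g)
        - (∫ w, cutoff n w * (inner ℝ b w * inner ℝ b w) * inner ℝ a (ξ w)
            ∂densityMeasure g) := by
    intro n
    simp_rw [← integral_const_mul]
    have I1 := (cw n cb).const_mul (inner ℝ a v * inner ℝ b (ξ v) - inner ℝ b v * inner ℝ a (ξ v))
    have I2 := (cw n cab).const_mul (-inner ℝ b (ξ v))
    have I3 := (cw n cbb).const_mul (inner ℝ a (ξ v))
    have I4 := (cs n b cb).const_mul (-inner ℝ a v)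
    have I5 := (cs n a cb).const_mul (inner ℝ b v)
    have I6 := cs n b cab
    have I7 := cs n a cbb
    rw [← integral_add I1 I2, ← integral_add (I1.fun_add I2) I3,
      ← integral_add ((I1.fun_add I2).fun_add I3) I4,
      ← integral_add (((I1.fun_add I2).fun_add I3).fun_add I4) I5,
      ← integral_add ((((I1.fun_add I2).fun_add I3).fun_add I4).fun_add I5) I6,
      ← integral_sub (((((I1.fun_add I2).fun_add I3).fun_add I4).fun_add I5).fun_add I6) I7]
    congr 1; ext w
    simp only [crossTerm, inner_sub_right]; ring
  simp_rw [hexp]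
  have := ((((((t1.const_mul (inner ℝ a v * inner ℝ b (ξ v) - inner ℝ b v * inner ℝ a (ξ v))).add
    (t2.const_mul (-inner ℝ b (ξ v)))).add (t3.const_mul (inner ℝ a (ξ v)))).add
    (t4.const_mul (-inner ℝ a v))).add (t5.const_mul (inner ℝ b v))).add t6).sub t7
  convert this using 2
  ring

/-- The key estimate: every off-diagonal pair of directions controls one component of the score. -/
lemma lintegral_score_le (h : IsCenteredDensity g ξ) (hγ : 0 ≤ γ) {a b : V} (ha : ‖a‖ = 1)
    (hb : ‖b‖ = 1) (hab : inner ℝ a b = 0)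
    (hT : ∫ v, inner ℝ a v * inner ℝ b v ∂densityMeasure g = 0) :
    ∫⁻ v, ENNReal.ofReal (((∫ w, inner ℝ b w * inner ℝ b w ∂densityMeasure g)
        * inner ℝ a (ξ v) + inner ℝ a v) ^ 2) ∂densityMeasure g
      ≤ crossEnergy γ g ξ a b * iConst γ g := by
  have := h.isProbabilityMeasure
  set μ := densityMeasure g
  let Q : ℕ → V → ℝ := fun n v => ∫ w, crossTerm ξ a b v w * (cutoff n w * inner ℝ b w) ∂μ
  have hψ : ∀ n, Continuous fun w => cutoff n w * inner ℝ b w := fun n =>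
    (contDiff_cutoff n).continuous.mul (by fun_prop)
  have hψb : ∀ n w, |cutoff n w * inner ℝ b w| ≤ bracket w := by
    intro n w
    rw [abs_mul, abs_of_nonneg (cutoff_nonneg n w)]
    have h1 := abs_real_inner_le_norm b w
    rw [hb, one_mul] at h1
    exact (mul_le_of_le_one_left (abs_nonneg _) (cutoff_le_one n w)).trans
      (h1.trans (norm_le_bracket w))
  have hQm : ∀ n, AEMeasurable (Q n) μ := by
    intro n
    have h6 : AEStronglyMeasurable (fun p : V × V => cutoff n p.2 * inner ℝ b p.2)
        (μ.prod μ) := ((hψ n).comp continuous_snd).aestronglyMeasurable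
    have h7 : AEStronglyMeasurable (fun p : V × V =>
        crossTerm ξ a b p.1 p.2 * (cutoff n p.2 * inner ℝ b p.2)) (μ.prod μ) :=
      (h.aestronglyMeasurable_crossTerm_prod a b).mul h6
    exact h7.integral_prod_right'.aemeasurable
  -- The bound for the truncated weights does not depend on $n$, so Fatou's lemma transfers it to
  -- the limit, with no integrability of the score assumed.
  calc _ = ∫⁻ v, liminf (fun n => ENNReal.ofReal (Q n v ^ 2)) atTop ∂μ := by
        refine lintegral_congr fun v => (Tendsto.liminf_eq ?_).symm
        exact ENNReal.tendsto_ofReal ((h.tendsto_integral_crossTerm ha hb hab hT v).pow 2)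
    _ ≤ liminf (fun n => ∫⁻ v, ENNReal.ofReal (Q n v ^ 2) ∂μ) atTop :=
        lintegral_liminf_le' fun n => ((hQm n).pow_const 2).ennreal_ofReal
    _ ≤ liminf (fun _ : ℕ => crossEnergy γ g ξ a b * iConst γ g) atTop := by
        refine liminf_le_liminf (Eventually.of_forall fun n => ?_)
        simp only [Q]
        rw [crossEnergy]
        refine (lintegral_mono fun v =>
          h.ofReal_sq_integral_crossTerm_le hγ (hψ n) (hψb n) a b v).trans ?_
        rw [lintegral_mul_const'' _ (h.aemeasurable_crossEnergy_prod γ a b).lintegral_prod_right']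
    _ = _ := by simp

end IsCenteredDensity

/-! ### Entropy production as a sum of three components -/

lemma crossTerm_sq_comm (ξ : V → V) (a b v w : V) :
    crossTerm ξ a b v w ^ 2 = crossTerm ξ b a v w ^ 2 := by
  unfold crossTerm; ring

lemma crossEnergy_comm (γ : ℝ) (g : V → ℝ) (ξ : V → V) (a b : V) :
    crossEnergy γ g ξ a b = crossEnergy γ g ξ b a := by
  unfold crossEnergy
  simp_rw [crossTerm_sq_comm ξ a b]

lemma norm_sq_mul_norm_proj_sq {z : V} (hz : z ≠ 0) (y : V) :
    ‖z‖ ^ 2 * ‖proj z y‖ ^ 2 = ‖z‖ ^ 2 * ‖y‖ ^ 2 - inner ℝ z y ^ 2 := by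
  have hn : 0 < ‖z‖ := norm_pos_iff.2 hz
  unfold proj
  rw [norm_sub_sq_real, norm_smul, real_inner_smul_right, mul_pow, Real.norm_eq_abs, sq_abs,
    real_inner_comm z y]
  field_simp
  ring

/-- Lagrange's identity for the projected difference of the scores. -/
lemma norm_rpow_mul_norm_proj_sq (b : OrthonormalBasis (Fin 3) ℝ V) {γ : ℝ} (hγ : 0 ≤ γ)
    (ξ : V → V) (v w : V) :
    ‖v - w‖ ^ (γ + 2) * ‖proj (v - w) (ξ v - ξ w)‖ ^ 2
      = ‖v - w‖ ^ γ * crossTerm ξ (b 0) (b 1) v w ^ 2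
        + ‖v - w‖ ^ γ * crossTerm ξ (b 0) (b 2) v w ^ 2
        + ‖v - w‖ ^ γ * crossTerm ξ (b 1) (b 2) v w ^ 2 := by
  unfold crossTerm
  generalize v - w = z
  generalize ξ v - ξ w = y
  by_cases hz : z = 0
  -- On the diagonal both sides vanish: the exponent $\gamma+2$ is positive, and each cross term is
  -- linear in $z$.
  · have : γ + 2 ≠ 0 := by positivity
    simp [hz, Real.zero_rpow this]
  · have hn : 0 < ‖z‖ := norm_pos_iff.2 hz
    rw [Real.rpow_add hn, Real.rpow_two, mul_assoc, ← mul_add, ← mul_add]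
    congr 1
    have h1 := norm_sq_mul_norm_proj_sq hz y
    have hz2 : ‖z‖ ^ 2 = inner ℝ (b 0) z ^ 2 + inner ℝ (b 1) z ^ 2 + inner ℝ (b 2) z ^ 2 := by
      have := b.sum_sq_norm_inner_right z
      simpa [Fin.sum_univ_three] using this.symm
    have hy2 : ‖y‖ ^ 2 = inner ℝ (b 0) y ^ 2 + inner ℝ (b 1) y ^ 2 + inner ℝ (b 2) y ^ 2 := by
      have := b.sum_sq_norm_inner_right y
      simpa [Fin.sum_univ_three] using this.symm
    have hzy : inner ℝ z y = inner ℝ (b 0) z * inner ℝ (b 0) y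
        + inner ℝ (b 1) z * inner ℝ (b 1) y + inner ℝ (b 2) z * inner ℝ (b 2) y := by
      have := b.sum_inner_mul_inner z y
      simpa [Fin.sum_univ_three, real_inner_comm z] using this.symm
    rw [h1, hz2, hy2, hzy]
    ring

/-- The kernel of a nonzero linear form is a proper subspace, hence a Lebesgue null set. This is
what excludes degenerate covariances. -/
lemma ae_inner_ne_zero {a : V} (ha : a ≠ 0) : ∀ᵐ v : V, inner ℝ a v ≠ 0 := by
  have hs : LinearMap.ker (innerSL ℝ a : V →ₗ[ℝ] ℝ) ≠ ⊤ := by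
    intro h
    have : a ∈ LinearMap.ker (innerSL ℝ a : V →ₗ[ℝ] ℝ) := h ▸ Submodule.mem_top
    exact ha (by simpa using this)
  have := Measure.addHaar_submodule (volume : Measure V) _ hs
  rw [ae_iff]
  convert this using 2
  ext v; simp

namespace IsCenteredDensity
variable {g : V → ℝ} {ξ : V → V} {γ : ℝ}

/-- Lagrange's identity integrated against $g\otimes g$. The factor $2$ undoes the $\frac12$ in the
entropy production. -/
lemma two_mul_entropyProduction (h : IsCenteredDensity g ξ) (hγ : 0 ≤ γ)
    (b : OrthonormalBasis (Fin 3) ℝ V) :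
    crossEnergy γ g ξ (b 0) (b 1) + crossEnergy γ g ξ (b 0) (b 2) + crossEnergy γ g ξ (b 1) (b 2)
      = 2 * entropyProduction γ g ξ := by
  have := h.isProbabilityMeasure
  set μ := densityMeasure g with hμ
  have hm := h.aemeasurable_crossEnergy_prod γ
  have hk : ∀ a c : V, crossEnergy γ g ξ a c = ∫⁻ p, ENNReal.ofReal
      (‖p.1 - p.2‖ ^ γ * crossTerm ξ a c p.1 p.2 ^ 2) ∂μ.prod μ := fun a c =>
    (lintegral_prod _ (hm a c)).symm
  have hadd : AEMeasurable (fun p : V × V =>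
      ENNReal.ofReal (‖p.1 - p.2‖ ^ γ * crossTerm ξ (b 0) (b 1) p.1 p.2 ^ 2)
        + ENNReal.ofReal (‖p.1 - p.2‖ ^ γ * crossTerm ξ (b 0) (b 2) p.1 p.2 ^ 2)) (μ.prod μ) :=
    (hm _ _).add (hm _ _)
  rw [hk, hk, hk, ← lintegral_add_left' (hm _ _), ← lintegral_add_left' hadd,
    entropyProduction, ← mul_assoc, ENNReal.mul_inv_cancel (by simp) (by simp), one_mul]
  have hprod : μ.prod μ = (volume : Measure (V × V)).withDensity
      fun p => ENNReal.ofReal (g p.1) * ENNReal.ofReal (g p.2) := by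
    rw [hμ, densityMeasure, prod_withDensity₀ h.aemeasurable_ofReal h.aemeasurable_ofReal]; rfl
  have hdm : AEMeasurable (fun p : V × V => ENNReal.ofReal (g p.1) * ENNReal.ofReal (g p.2))
      volume := h.aemeasurable_ofReal.comp_fst.mul h.aemeasurable_ofReal.comp_snd
  rw [hprod, lintegral_withDensity_eq_lintegral_mul₀' hdm (by
    rw [← hprod]; exact hadd.add (hm _ _))]
  refine lintegral_congr fun p => ?_
  have e := norm_rpow_mul_norm_proj_sq b hγ ξ p.1 p.2
  have hg := mul_nonneg (h.nonneg p.1) (h.nonneg p.2)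
  have e2 : ‖p.1 - p.2‖ ^ (γ + 2) * (g p.1 * g p.2 * ‖proj (p.1 - p.2) (ξ p.1 - ξ p.2)‖ ^ 2)
      = g p.1 * g p.2 * (‖p.1 - p.2‖ ^ (γ + 2) * ‖proj (p.1 - p.2) (ξ p.1 - ξ p.2)‖ ^ 2) := by ring
  simp only [Pi.mul_apply]
  rw [e2, e, ← ENNReal.ofReal_mul (h.nonneg _), ← ENNReal.ofReal_add (by positivity) (by positivity),
    ← ENNReal.ofReal_add (by positivity) (by positivity), ← ENNReal.ofReal_mul hg]

/-! ### Covariance, directional Fisher information and score bounds -/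

lemma memLp_inner (h : IsCenteredDensity g ξ) (a : V) :
    MemLp (fun v => inner ℝ a v) 2 (densityMeasure g) := by
  rw [memLp_two_iff_integrable_sq (Continuous.aestronglyMeasurable (by fun_prop))]
  refine h.integrable_of_bound (by fun_prop) (C := ‖a‖ ^ 2) fun v => ?_
  have h1 := abs_real_inner_le_norm a v
  rw [abs_of_nonneg (sq_nonneg _), ← sq_abs]
  have h2 : |inner ℝ a v| ^ 2 ≤ (‖a‖ * ‖v‖) ^ 2 := by gcongr
  nlinarith [sq_nonneg ‖a‖]

lemma not_ae_eq_zero (h : IsCenteredDensity g ξ) {f : V → ℝ} (hf : ∀ᵐ v, f v ≠ 0) :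
    ¬ ∀ᵐ v ∂densityMeasure g, f v = 0 := by
  have := h.isProbabilityMeasure
  intro h0
  have h1 := (absolutelyContinuous g).ae_le hf
  obtain ⟨v, hv0, hv1⟩ := (h0.and h1).exists
  exact hv1 hv0

/-- The density does not charge zero sets of nonzero linear forms. -/
lemma integral_inner_mul_inner_pos (h : IsCenteredDensity g ξ) {a : V} (ha : a ≠ 0) :
    0 < ∫ v, inner ℝ a v * inner ℝ a v ∂densityMeasure g := by
  have hne := h.not_ae_eq_zero (ae_inner_ne_zero ha)
  refine lt_of_le_of_ne (integral_nonneg fun v => mul_self_nonneg _) fun h0 => hne ?_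
  rw [eq_comm, integral_eq_zero_iff_of_nonneg (fun v => mul_self_nonneg _)
    ((h.memLp_inner a).integrable_mul (h.memLp_inner a))] at h0
  filter_upwards [h0] with v hv
  exact mul_self_eq_zero.1 hv

/-- Integration by parts of $a\cdot v$ against $\partial_a g$. Square integrability of the score
component allows the cutoff to be removed from the left-hand side. -/
lemma integral_inner_mul_score (h : IsCenteredDensity g ξ) {a : V} (ha : ‖a‖ = 1)
    (hξ : MemLp (fun v => inner ℝ a (ξ v)) 2 (densityMeasure g)) :
    ∫ v, inner ℝ a v * inner ℝ a (ξ v) ∂densityMeasure g = -1 := by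
  have := h.isProbabilityMeasure
  have hi : Integrable (fun v => inner ℝ a v * inner ℝ a (ξ v)) (densityMeasure g) :=
    (h.memLp_inner a).integrable_mul hξ
  have hd : ∀ w e : V, fderiv ℝ (fun w : V => inner ℝ a w) w e = inner ℝ a e := by
    intro w e; rw [((innerSL ℝ a).hasFDerivAt (x := w)).fderiv (f := fun w => inner ℝ a w)]; rfl
  have haa : inner ℝ a a = 1 := by rw [real_inner_self_eq_norm_sq, ha]; norm_num
  have t1 := h.tendsto_integral_cutoff_score (innerSL ℝ a).contDiff a (C := 2)
    (fun w => (abs_inner_le_one_add ha w).trans (by gcongr; norm_num))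
    (fun w => by
      have : fderiv ℝ (innerSL ℝ a) w a = 1 := (hd w a).trans haa
      rw [this, abs_one]; nlinarith [sq_nonneg ‖w‖])
  have e1 : ∫ w, fderiv ℝ (innerSL ℝ a) w a ∂densityMeasure g = 1 := by
    have : ∀ w, fderiv ℝ (innerSL ℝ a) w a = 1 := fun w => (hd w a).trans haa
    rw [integral_congr_ae (Eventually.of_forall this)]; simp
  rw [e1] at t1
  have t2 : Tendsto (fun n => ∫ v, cutoff n v * inner ℝ a v * inner ℝ a (ξ v) ∂densityMeasure g)
      atTop (𝓝 (∫ v, inner ℝ a v * inner ℝ a (ξ v) ∂densityMeasure g)) := by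
    refine tendsto_integral_of_dominated_convergence _ (fun n => ?_) hi.norm
      (fun n => Eventually.of_forall fun v => ?_) (Eventually.of_forall fun v => ?_)
    · simp_rw [mul_assoc]
      exact (contDiff_cutoff n).continuous.aestronglyMeasurable.mul hi.aestronglyMeasurable
    · rw [mul_assoc, norm_mul, Real.norm_of_nonneg (cutoff_nonneg n v)]
      exact mul_le_of_le_one_left (norm_nonneg _) (cutoff_le_one n v)
    · simpa [mul_assoc] using (tendsto_cutoff v).mul_const (inner ℝ a v * inner ℝ a (ξ v))
  exact tendsto_nhds_unique t2 t1

/-- Consequences of finite entropy production for one pair of orthogonal directions. -/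
lemma score_bound (h : IsCenteredDensity g ξ) (hγ : 0 ≤ γ) {a b : V} (ha : ‖a‖ = 1)
    (hb : ‖b‖ = 1) (hab : inner ℝ a b = 0)
    (hT : ∫ v, inner ℝ a v * inner ℝ b v ∂densityMeasure g = 0)
    (hfin : crossEnergy γ g ξ a b * iConst γ g ≠ ⊤) :
    MemLp (fun v => inner ℝ a (ξ v)) 2 (densityMeasure g) ∧
    (∫ v, inner ℝ b v * inner ℝ b v ∂densityMeasure g) ^ 2
        * (∫ v, inner ℝ a (ξ v) ^ 2 ∂densityMeasure g)
      - 2 * (∫ v, inner ℝ b v * inner ℝ b v ∂densityMeasure g)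
      + ∫ v, inner ℝ a v * inner ℝ a v ∂densityMeasure g
      ≤ (crossEnergy γ g ξ a b * iConst γ g).toReal := by
  have hle := h.lintegral_score_le hγ ha hb hab hT
  set μ := densityMeasure g
  set t := ∫ v, inner ℝ b v * inner ℝ b v ∂μ
  have ht : 0 < t := h.integral_inner_mul_inner_pos (by rintro rfl; simp at hb)
  have hRm : AEStronglyMeasurable (fun v => t * inner ℝ a (ξ v) + inner ℝ a v) μ :=
    (((h.aemeasurable_inner_score a).const_mul t).add
      (Continuous.measurable (by fun_prop)).aemeasurable).aestronglyMeasurable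
  have hRi : Integrable (fun v => (t * inner ℝ a (ξ v) + inner ℝ a v) ^ 2) μ := by
    refine ⟨hRm.pow 2, ?_⟩
    rw [hasFiniteIntegral_iff_ofReal (Eventually.of_forall fun v => sq_nonneg _)]
    exact hle.trans_lt (lt_top_iff_ne_top.2 hfin)
  have hR : MemLp (fun v => t * inner ℝ a (ξ v) + inner ℝ a v) 2 μ :=
    (memLp_two_iff_integrable_sq hRm).2 hRi
  have hξ : MemLp (fun v => inner ℝ a (ξ v)) 2 μ := by
    -- Since $t>0$, the combination $t\,a\cdot\xi+a\cdot v$ and the finite second moment together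
    -- return $a\cdot\xi$ in $L^2(g)$.
    refine ((hR.sub (h.memLp_inner a)).const_mul t⁻¹).ae_eq (Eventually.of_forall fun v => ?_)
    simp only [Pi.sub_apply, add_sub_cancel_right]
    field_simp
  refine ⟨hξ, ?_⟩
  have i1 := hξ.integrable_sq
  have i2 : Integrable (fun v => inner ℝ a v * inner ℝ a (ξ v)) μ :=
    (h.memLp_inner a).integrable_mul hξ
  have i3 : Integrable (fun v => inner ℝ a v * inner ℝ a v) μ :=
    (h.memLp_inner a).integrable_mul (h.memLp_inner a)
  have e : ∫ v, (t * inner ℝ a (ξ v) + inner ℝ a v) ^ 2 ∂μ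
      = t ^ 2 * (∫ v, inner ℝ a (ξ v) ^ 2 ∂μ) - 2 * t + ∫ v, inner ℝ a v * inner ℝ a v ∂μ := by
    have e1 : ∀ v, (t * inner ℝ a (ξ v) + inner ℝ a v) ^ 2 = t ^ 2 * inner ℝ a (ξ v) ^ 2
        + (2 * t) * (inner ℝ a v * inner ℝ a (ξ v)) + inner ℝ a v * inner ℝ a v :=
      fun v => by ring
    simp_rw [e1]
    rw [integral_add ((i1.const_mul _).fun_add (i2.const_mul _)) i3,
      integral_add (i1.const_mul _) (i2.const_mul _), integral_const_mul, integral_const_mul,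
      h.integral_inner_mul_score ha hξ]
    ring
  rw [← e, ← ENNReal.ofReal_le_iff_le_toReal hfin,
    ofReal_integral_eq_lintegral_ofReal hRi (Eventually.of_forall fun v => sq_nonneg _)]
  exact hle

/-- The Cramér–Rao inequality: Cauchy–Schwarz applied to $\int g\,(a\cdot v)(a\cdot\xi)=-1$. -/
lemma one_le_fisher_mul (h : IsCenteredDensity g ξ) {a : V} (ha : ‖a‖ = 1)
    (hξ : MemLp (fun v => inner ℝ a (ξ v)) 2 (densityMeasure g)) :
    1 ≤ (∫ v, inner ℝ a (ξ v) ^ 2 ∂densityMeasure g)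
      * ∫ v, inner ℝ a v * inner ℝ a v ∂densityMeasure g := by
  have i3 := (h.memLp_inner a).integrable_sq
  have := sq_integral_mul_le i3 hξ.integrable_sq ((h.memLp_inner a).integrable_mul hξ)
  rw [h.integral_inner_mul_score ha hξ] at this
  simp_rw [← pow_two]
  linarith

/-- The covariance form is diagonal in some orthonormal basis. -/
lemma exists_orthonormalBasis (h : IsCenteredDensity g ξ) :
    ∃ b : OrthonormalBasis (Fin 3) ℝ V, ∀ i j, i ≠ j →
      ∫ v, inner ℝ (b i) v * inner ℝ (b j) v ∂densityMeasure g = 0 := by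
  -- An eigenbasis of the symmetric covariance matrix makes the mixed moments vanish.
  let A : Matrix (Fin 3) (Fin 3) ℝ := fun i j => ∫ v : V, v i * v j ∂densityMeasure g
  have hA : A.IsHermitian := by
    refine Matrix.IsHermitian.ext fun i j => ?_
    simp only [A, star_trivial]
    exact integral_congr_ae (Eventually.of_forall fun v => mul_comm _ _)
  refine ⟨hA.eigenvectorBasis, fun i j hij => ?_⟩
  set b := hA.eigenvectorBasis with hb
  have hi : ∀ k l : Fin 3, Integrable (fun v : V => v k * v l) (densityMeasure g) := by
    intro k l
    refine h.integrable_of_bound (by fun_prop) (C := 1) fun v => ?_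
    have h1 : |v k| ≤ ‖v‖ := PiLp.norm_apply_le v k
    have h2 : |v l| ≤ ‖v‖ := PiLp.norm_apply_le v l
    rw [abs_mul]
    nlinarith [mul_le_mul h1 h2 (abs_nonneg _) (norm_nonneg v)]
  have e : ∀ a c : V, ∫ v, inner ℝ a v * inner ℝ c v ∂densityMeasure g
      = ∑ k, a k * ∑ l, A k l * c l := by
    intro a c
    have e1 : ∀ v : V, inner ℝ a v * inner ℝ c v
        = ∑ k, ∑ l, (a k * c l) * (v k * v l) := by
      intro v
      rw [PiLp.inner_apply, PiLp.inner_apply, Finset.sum_mul_sum]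
      refine Finset.sum_congr rfl fun k _ => Finset.sum_congr rfl fun l _ => ?_
      simp; ring
    simp_rw [e1]
    rw [integral_finsetSum _ fun k _ => integrable_finsetSum _ fun l _ => (hi k l).const_mul _]
    refine Finset.sum_congr rfl fun k _ => ?_
    rw [integral_finsetSum _ fun l _ => (hi k l).const_mul _, Finset.mul_sum]
    refine Finset.sum_congr rfl fun l _ => ?_
    rw [integral_const_mul]; simp only [A]; ring
  rw [e]
  have hev := hA.mulVec_eigenvectorBasis j
  have hk : ∀ k, ∑ l, A k l * (b j) l = hA.eigenvalues j * (b j) k := by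
    intro k
    have := congrFun hev k
    simpa [Matrix.mulVec, dotProduct] using this
  simp_rw [hk]
  have h0 : inner ℝ (b i) (b j) = 0 := b.orthonormal.2 hij
  rw [PiLp.inner_apply] at h0
  have : ∑ k, (b i) k * (hA.eigenvalues j * (b j) k)
      = hA.eigenvalues j * ∑ k, inner ℝ ((b i) k) ((b j) k) := by
    rw [Finset.mul_sum]
    refine Finset.sum_congr rfl fun k _ => ?_
    simp; ring
  rw [this, h0, mul_zero]

lemma sum_covariance (h : IsCenteredDensity g ξ) (b : OrthonormalBasis (Fin 3) ℝ V) :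
    ∑ i, ∫ v, inner ℝ (b i) v * inner ℝ (b i) v ∂densityMeasure g = 3 := by
  have hi : ∀ i, Integrable (fun v => inner ℝ (b i) v * inner ℝ (b i) v) (densityMeasure g) :=
    fun i => (h.memLp_inner (b i)).integrable_mul (h.memLp_inner (b i))
  rw [← integral_finsetSum _ fun i _ => hi i, ← h.energy, h.integral_eq]
  congr 1; ext v
  rw [← b.sum_sq_norm_inner_right v]
  simp [pow_two]

end IsCenteredDensity

/-! ### The algebraic inequality behind the constant 510 -/

/-- The bound when the covariance is close to rank one. -/
lemma le_mul_of_eigenvalue_gt {t₀ t₁ t₂ F₀ F₁ F₂ κ₁ κ₂ X H : ℝ} (h0 : 29 / 10 < t₀) (h1 : 0 < t₁)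
    (h2 : 0 < t₂) (hs : t₀ + t₁ + t₂ = 3) (hF1 : 1 ≤ F₁ * t₁) (hF2 : 1 ≤ F₂ * t₂)
    (k01 : t₁ ^ 2 * F₀ - 2 * t₁ + t₀ ≤ κ₁) (k10 : t₀ ^ 2 * F₁ - 2 * t₀ + t₁ ≤ κ₁)
    (k02 : t₂ ^ 2 * F₀ - 2 * t₂ + t₀ ≤ κ₂) (k20 : t₀ ^ 2 * F₂ - 2 * t₀ + t₂ ≤ κ₂)
    (hF0 : 0 ≤ F₀) (hκ : κ₁ + κ₂ ≤ 2 * X)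
    (hH : ∀ τ, 0 < τ → H ≤ τ / 2 * (F₀ + F₁ + F₂) - 3 / 2 - 3 / 2 * Real.log τ) :
    H ≤ 510 * X := by
  set s := t₁ + t₂ with hsd
  have hs0 : 0 < s := by positivity
  have hs1 : s < 1 / 10 := by linarith
  have hf1 : 1 / t₁ ≤ F₁ := by rw [div_le_iff₀ h1]; exact hF1
  have hf2 : 1 / t₂ ≤ F₂ := by rw [div_le_iff₀ h2]; exact hF2
  -- Cramér–Rao forces large Fisher information in the two thin directions, as $1/t_1+1/t_2\ge4/s$.
  have hG : 4 / s ≤ F₁ + F₂ := by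
    refine le_trans ?_ (add_le_add hf1 hf2)
    rw [div_add_div _ _ h1.ne' h2.ne', div_le_div_iff₀ hs0 (by positivity)]
    nlinarith [sq_nonneg (t₁ - t₂)]
  have hG40 : 40 ≤ 4 / s := by rw [le_div_iff₀ hs0]; linarith
  have ht0 : t₀ ≤ 3 := by linarith
  -- Adding `k10` and `k20` gives $t_0^2(F_1+F_2)-4t_0+s\le2X$. Here $t_0^2\ge8.41$ and
  -- $4t_0\le12\le0.3\,(F_1+F_2)$.
  have hX : 4 * (F₁ + F₂) ≤ X := by
    have : (8.41 : ℝ) ≤ t₀ ^ 2 := by nlinarith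
    have := mul_le_mul_of_nonneg_right this (by linarith : 0 ≤ F₁ + F₂)
    nlinarith
  have hX0 : s ^ 2 * F₀ ≤ 4 * X := by
    have : s ^ 2 / 2 ≤ t₁ ^ 2 + t₂ ^ 2 := by nlinarith [sq_nonneg (t₁ - t₂)]
    have := mul_le_mul_of_nonneg_right this hF0
    nlinarith
  have hlog : -Real.log s ≤ 1 / s := by
    have := Real.log_le_sub_one_of_pos (inv_pos.2 hs0)
    rw [Real.log_inv] at this
    rw [one_div]; linarith
  have h4 : 4 / s = 4 * (1 / s) := by ring
  -- In the long direction only $s^2F_0\lesssim X$ is available, so $\tau=s^2$ is the natural scale.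
  -- The logarithm then costs $-3\log s\le3/s$, which is absorbed by $F_1+F_2\ge4/s$.
  have := hH (s ^ 2) (by positivity)
  rw [Real.log_pow] at this
  push_cast at this
  have hs2 : s ^ 2 * (F₁ + F₂) ≤ 1 * (F₁ + F₂) :=
    mul_le_mul_of_nonneg_right (by nlinarith) (by linarith)
  nlinarith

/-- The algebraic step from directional score bounds to the entropy bound. -/
lemma le_mul_of_score_bounds {t₀ t₁ t₂ F₀ F₁ F₂ κ₀₁ κ₀₂ κ₁₂ X H : ℝ} (h0 : 0 < t₀) (h1 : 0 < t₁)
    (h2 : 0 < t₂) (hs : t₀ + t₁ + t₂ = 3)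
    (hF0 : 1 ≤ F₀ * t₀) (hF1 : 1 ≤ F₁ * t₁) (hF2 : 1 ≤ F₂ * t₂)
    (k01 : t₁ ^ 2 * F₀ - 2 * t₁ + t₀ ≤ κ₀₁) (k10 : t₀ ^ 2 * F₁ - 2 * t₀ + t₁ ≤ κ₀₁)
    (k02 : t₂ ^ 2 * F₀ - 2 * t₂ + t₀ ≤ κ₀₂) (k20 : t₀ ^ 2 * F₂ - 2 * t₀ + t₂ ≤ κ₀₂)
    (k12 : t₂ ^ 2 * F₁ - 2 * t₂ + t₁ ≤ κ₁₂) (k21 : t₁ ^ 2 * F₂ - 2 * t₁ + t₂ ≤ κ₁₂)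
    (hκ : κ₀₁ + κ₀₂ + κ₁₂ ≤ 2 * X)
    (hH : ∀ τ, 0 < τ → H ≤ τ / 2 * (F₀ + F₁ + F₂) - 3 / 2 - 3 / 2 * Real.log τ) :
    H ≤ 510 * X := by
  have hf : ∀ {F t : ℝ}, 0 < t → 1 ≤ F * t → 1 / t ≤ F := fun ht h => by
    rwa [div_le_iff₀ ht]
  have f0 := hf h0 hF0
  have f1 := hf h1 hF1
  have f2 := hf h2 hF2
  have p0 : 0 < 1 / t₀ := by positivity
  have p1 : 0 < 1 / t₁ := by positivity
  have p2 : 0 < 1 / t₂ := by positivity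
  have hn : ∀ {t u F : ℝ}, 0 < t → 1 / t ≤ F → 0 ≤ u ^ 2 * F - 2 * u + t := fun {t u F} ht h => by
    have e : u ^ 2 * (1 / t) - 2 * u + t = (u - t) ^ 2 / t := by field_simp; ring
    have := mul_le_mul_of_nonneg_left h (sq_nonneg u)
    have : 0 ≤ (u - t) ^ 2 / t := by positivity
    linarith
  have n01 := (hn h0 f0).trans k01
  have n02 := (hn h0 f0).trans k02
  have n12 := (hn h1 f1).trans k12
  by_cases c0 : 29 / 10 < t₀
  · exact le_mul_of_eigenvalue_gt c0 h1 h2 hs hF1 hF2 k01 k10 k02 k20 (by linarith)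
      (by linarith) hH
  by_cases c1 : 29 / 10 < t₁
  · exact le_mul_of_eigenvalue_gt c1 h0 h2 (by linarith) hF0 hF2 k10 k01 k12 k21 (by linarith)
      (by linarith) (by simpa only [add_comm F₁ F₀] using hH)
  by_cases c2 : 29 / 10 < t₂
  · refine le_mul_of_eigenvalue_gt c2 h0 h1 (by linarith) hF0 hF1 k20 k02 k21 k12 (by linarith)
      (by linarith) fun τ hτ => ?_
    rw [show F₂ + F₀ + F₁ = F₀ + F₁ + F₂ by ring]
    exact hH τ hτ
  push Not at c0 c1 c2
  -- Here $u+w\ge1/10$, hence $u^2+w^2\ge(1/10)^2/2=0.005$.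
  have hP : ∀ {t u w : ℝ}, t ≤ 29 / 10 → t + u + w = 3 → 0.005 ≤ u ^ 2 + w ^ 2 :=
    fun {t u w} ht h => by nlinarith [sq_nonneg (u - w)]
  have q0 := mul_le_mul_of_nonneg_right (hP c0 hs) (sub_nonneg.2 f0)
  have q1 := mul_le_mul_of_nonneg_right (hP c1 (show t₁ + t₀ + t₂ = 3 by linarith))
    (sub_nonneg.2 f1)
  have q2 := mul_le_mul_of_nonneg_right (hP c2 (show t₂ + t₀ + t₁ = 3 by linarith))
    (sub_nonneg.2 f2)
  set P := t₀ ^ 2 + t₁ ^ 2 + t₂ ^ 2 with hPd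
  set S := 1 / t₀ + 1 / t₁ + 1 / t₂ with hSd
  -- Both $P\ge3$ and $S\ge3$ follow from $t_0+t_1+t_2=3$ by convexity; they make
  -- $PS-9\ge3(S-3)\ge0$.
  have hP3 : 3 ≤ P := by
    nlinarith [sq_nonneg (t₀ - t₁), sq_nonneg (t₁ - t₂), sq_nonneg (t₀ - t₂)]
  have hS : 3 ≤ S := by
    have : ∀ t : ℝ, 0 < t → 2 - t ≤ 1 / t := fun t ht => by
      rw [le_div_iff₀ ht]; nlinarith [sq_nonneg (t - 1)]
    linarith [this t₀ h0, this t₁ h1, this t₂ h2]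
  have e0 : t₀ ^ 2 * (1 / t₀) = t₀ := by field_simp
  have e1 : t₁ ^ 2 * (1 / t₁) = t₁ := by field_simp
  have e2 : t₂ ^ 2 * (1 / t₂) = t₂ := by field_simp
  have hPS : 3 * S ≤ P * S := mul_le_mul_of_nonneg_right hP3 (by linarith)
  -- Sum of all six score bounds, with each $F_i$ split into its Cramér–Rao minimum $1/t_i$ and an
  -- excess. The excesses have coefficients at least $0.005$, so $\sum F_i-3\le800\,X$, and $\tau=1$
  -- yields $H\le400\,X$.
  have key : P * S - 9 + ((t₁ ^ 2 + t₂ ^ 2) * (F₀ - 1 / t₀) + (t₀ ^ 2 + t₂ ^ 2) * (F₁ - 1 / t₁)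
      + (t₀ ^ 2 + t₁ ^ 2) * (F₂ - 1 / t₂)) ≤ 4 * X := by
    have : P * S = (t₁ ^ 2 + t₂ ^ 2) * (1 / t₀) + (t₀ ^ 2 + t₂ ^ 2) * (1 / t₁)
      + (t₀ ^ 2 + t₁ ^ 2) * (1 / t₂) + (t₀ ^ 2 * (1 / t₀) + t₁ ^ 2 * (1 / t₁)
      + t₂ ^ 2 * (1 / t₂)) := by rw [hPd, hSd]; ring
    rw [e0, e1, e2] at this
    rw [this]
    linarith
  have := hH 1 one_pos
  rw [Real.log_one] at this
  linarith

/-! ### From score bounds to the entropy inequality -/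

namespace IsCenteredDensity
variable {g : V → ℝ} {ξ : V → V} {γ : ℝ}

lemma integral_mul_log_div (h : IsCenteredDensity g ξ)
    (he : Integrable fun v => g v * Real.log (g v)) {τ : ℝ} (hτ : 0 < τ) :
    ∫ v, g v * Real.log (g v / gaussDensity τ v) = (∫ v, g v * Real.log (g v))
      + (3 / 2) * Real.log (2 * Real.pi * τ) + (2 * τ)⁻¹ * 3 := by
  simp_rw [fun v => mul_log_div_gaussDensity hτ (h.nonneg v) v]
  rw [integral_add (he.fun_add (h.integrable.const_mul _)) (h.integrable_norm_sq.const_mul _),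
    integral_add he (h.integrable.const_mul _), integral_const_mul, integral_const_mul, h.mass,
    h.energy, mul_one]

/-- Expansion in the basis: each direction contributes $-2c$ through $\int g\,(b_i\cdot
v)(b_i\cdot\xi)=-1$, and the variances sum to $3$. -/
lemma integral_norm_score_add_sq (h : IsCenteredDensity g ξ) (b : OrthonormalBasis (Fin 3) ℝ V)
    (hξ : ∀ i, MemLp (fun v => inner ℝ (b i) (ξ v)) 2 (densityMeasure g)) (c : ℝ) :
    Integrable (fun v => ‖ξ v + c • v‖ ^ 2) (densityMeasure g) ∧
    ∫ v, ‖ξ v + c • v‖ ^ 2 ∂densityMeasure g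
      = (∑ i, ∫ v, inner ℝ (b i) (ξ v) ^ 2 ∂densityMeasure g) - 6 * c + 3 * c ^ 2 := by
  set μ := densityMeasure g
  have i1 : ∀ i, Integrable (fun v => inner ℝ (b i) (ξ v) ^ 2) μ := fun i => (hξ i).integrable_sq
  have i2 : ∀ i, Integrable (fun v => inner ℝ (b i) v * inner ℝ (b i) (ξ v)) μ := fun i =>
    (h.memLp_inner (b i)).integrable_mul (hξ i)
  have i3 : ∀ i, Integrable (fun v => inner ℝ (b i) v * inner ℝ (b i) v) μ := fun i =>
    (h.memLp_inner (b i)).integrable_mul (h.memLp_inner (b i))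
  have e : ∀ v, ‖ξ v + c • v‖ ^ 2 = ∑ i, (inner ℝ (b i) (ξ v) ^ 2
      + 2 * c * (inner ℝ (b i) v * inner ℝ (b i) (ξ v))
      + c ^ 2 * (inner ℝ (b i) v * inner ℝ (b i) v)) := by
    intro v
    rw [← b.sum_sq_norm_inner_right]
    refine Finset.sum_congr rfl fun i _ => ?_
    rw [inner_add_right, real_inner_smul_right, Real.norm_eq_abs, sq_abs]
    ring
  have hi : ∀ i, Integrable (fun v => inner ℝ (b i) (ξ v) ^ 2
      + 2 * c * (inner ℝ (b i) v * inner ℝ (b i) (ξ v))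
      + c ^ 2 * (inner ℝ (b i) v * inner ℝ (b i) v)) μ := fun i =>
    ((i1 i).fun_add ((i2 i).const_mul _)).fun_add ((i3 i).const_mul _)
  simp_rw [e]
  refine ⟨integrable_finsetSum _ fun i _ => hi i, ?_⟩
  rw [integral_finsetSum _ fun i _ => hi i]
  have e2 : ∀ i, ∫ v, (inner ℝ (b i) (ξ v) ^ 2
      + 2 * c * (inner ℝ (b i) v * inner ℝ (b i) (ξ v))
      + c ^ 2 * (inner ℝ (b i) v * inner ℝ (b i) v)) ∂μ
      = (∫ v, inner ℝ (b i) (ξ v) ^ 2 ∂μ) - 2 * c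
        + c ^ 2 * ∫ v, inner ℝ (b i) v * inner ℝ (b i) v ∂μ := by
    intro i
    rw [integral_add ((i1 i).fun_add ((i2 i).const_mul _)) ((i3 i).const_mul _),
      integral_add (i1 i) ((i2 i).const_mul _), integral_const_mul, integral_const_mul,
      h.integral_inner_mul_score (b.orthonormal.1 i) (hξ i)]
    ring
  simp_rw [e2]
  have hs := h.sum_covariance b
  rw [Finset.sum_add_distrib, ← Finset.mul_sum, hs, Finset.sum_sub_distrib]
  simp
  ring

/-- The entropy–entropy production inequality with the singular moment as only constant. -/
theorem relative_entropy_le (h : IsCenteredDensity g ξ) (hγ : 0 ≤ γ)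
    (he : Integrable fun v => g v * Real.log (g v)) (hD : entropyProduction γ g ξ ≠ ⊤)
    (hI : iConst γ g ≠ ⊤) :
    ∫ v, g v * Real.log (g v / gaussDensity 1 v)
      ≤ 510 * (entropyProduction γ g ξ * iConst γ g).toReal := by
  obtain ⟨b, hb⟩ := h.exists_orthonormalBasis
  have hsum := h.two_mul_entropyProduction hγ b
  have h2D : 2 * entropyProduction γ g ξ ≠ ⊤ := ENNReal.mul_ne_top (by simp) hD
  rw [← hsum] at h2D
  simp only [ne_eq, ENNReal.add_eq_top, not_or] at h2D
  obtain ⟨⟨hE01, hE02⟩, hE12⟩ := h2D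
  have hK01 := ENNReal.mul_ne_top hE01 hI
  have hK02 := ENNReal.mul_ne_top hE02 hI
  have hK12 := ENNReal.mul_ne_top hE12 hI
  have hn := b.orthonormal.1
  have hsb : ∀ {i j}, i ≠ j → crossEnergy γ g ξ (b i) (b j) * iConst γ g ≠ ⊤ → _ :=
    fun {i j} hij hk => h.score_bound hγ (hn i) (hn j) (b.orthonormal.2 hij) (hb i j hij) hk
  obtain ⟨m0, s01⟩ := hsb (i := 0) (j := 1) (by decide) hK01
  obtain ⟨-, s02⟩ := hsb (i := 0) (j := 2) (by decide) hK02
  obtain ⟨m1, s12⟩ := hsb (i := 1) (j := 2) (by decide) hK12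
  obtain ⟨-, s10⟩ := hsb (i := 1) (j := 0) (by decide) (by rwa [crossEnergy_comm])
  obtain ⟨m2, s20⟩ := hsb (i := 2) (j := 0) (by decide) (by rwa [crossEnergy_comm])
  obtain ⟨-, s21⟩ := hsb (i := 2) (j := 1) (by decide) (by rwa [crossEnergy_comm])
  rw [crossEnergy_comm] at s10 s20 s21
  have hm : ∀ i, MemLp (fun v => inner ℝ (b i) (ξ v)) 2 (densityMeasure g) := fun i => by
    fin_cases i <;> assumption
  have hpos : ∀ i, 0 < ∫ v, inner ℝ (b i) v * inner ℝ (b i) v ∂densityMeasure g := fun i =>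
    h.integral_inner_mul_inner_pos fun h0 => by simpa [h0] using hn i
  have htr := h.sum_covariance b
  rw [Fin.sum_univ_three] at htr
  have hfisher : Integrable fun v => g v * ‖ξ v‖ ^ 2 := by
    have := (h.integral_norm_score_add_sq b hm 0).1
    rw [h.integrable_iff] at this
    simpa using this
  have hF : IsFisherDensity g ξ := ⟨h.nonneg, h.integrable, h.mass, h.integrable_norm_sq, he,
    h.aestronglyMeasurable, h.weak, hfisher⟩
  refine le_mul_of_score_bounds (hpos 0) (hpos 1) (hpos 2) htr (h.one_le_fisher_mul (hn 0) (hm 0))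
    (h.one_le_fisher_mul (hn 1) (hm 1)) (h.one_le_fisher_mul (hn 2) (hm 2)) s01 s10 s02 s20 s12 s21
    ?_ fun τ hτ => ?_
  · rw [← ENNReal.toReal_add hK01 hK02, ← ENNReal.toReal_add (by simp [hK01, hK02]) hK12,
      ← add_mul, ← add_mul, hsum, mul_assoc, ENNReal.toReal_mul]
    simp
  -- The inequality relative to covariance $\tau\,\mathrm{Id}$ is converted to one relative to
  -- $\mathcal M_0$; the two relative entropies differ by explicit terms because mass and energy are
  -- fixed, and the terms $\frac{3}{2\tau}$ cancel.
  · have hls := hF.logSobolev hτ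
    have e := (h.integral_norm_score_add_sq b hm τ⁻¹).2
    rw [h.integral_eq, Fin.sum_univ_three] at e
    have hpi := Real.pi_pos
    rw [e, h.integral_mul_log_div he hτ, Real.log_mul (by positivity) hτ.ne'] at hls
    rw [h.integral_mul_log_div he one_pos, mul_one]
    have e1 : τ / 2 * τ⁻¹ = 1 / 2 := by field_simp
    have e2 : τ / 2 * (τ⁻¹) ^ 2 = (2 * τ)⁻¹ := by field_simp
    nlinarith

end IsCenteredDensity

/-! ### Reduction to a measurable score -/

/-- Values of the score on the zero set of the density do not matter; this choice of them makes
it measurable. -/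
noncomputable def normalizedScore (g : V → ℝ) (ξ : V → V) : V → V :=
  fun v => (g v)⁻¹ • (g v • ξ v)

lemma normalizedScore_eq {g : V → ℝ} (ξ : V → V) {v : V} (hv : g v ≠ 0) :
    normalizedScore g ξ v = ξ v := by
  rw [normalizedScore, smul_smul, inv_mul_cancel₀ hv, one_smul]

lemma smul_normalizedScore (g : V → ℝ) (ξ : V → V) (v : V) :
    g v • normalizedScore g ξ v = g v • ξ v := by
  by_cases hv : g v = 0
  · simp [hv]
  · rw [normalizedScore_eq ξ hv]

lemma IsWeakLogGradient.normalizedScore {g : V → ℝ} {ξ : V → V} (h : IsWeakLogGradient g ξ) :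
    IsWeakLogGradient g (normalizedScore g ξ) := by
  refine ⟨by simpa only [smul_normalizedScore] using h.1, fun φ hφ hc i => ?_⟩
  rw [h.2 φ hφ hc i]
  congr 2; ext v
  have := congrArg (fun x : V => x i) (smul_normalizedScore g ξ v)
  simp only [PiLp.smul_apply, smul_eq_mul] at this
  rw [this]

lemma entropyProduction_normalizedScore (γ : ℝ) (g : V → ℝ) (ξ : V → V) :
    entropyProduction γ g (normalizedScore g ξ) = entropyProduction γ g ξ := by
  unfold entropyProduction
  congr 2; ext p
  by_cases h1 : g p.1 = 0
  · simp [h1]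
  by_cases h2 : g p.2 = 0
  · simp [h2]
  rw [normalizedScore_eq ξ h1, normalizedScore_eq ξ h2]

lemma ClassY0.isCenteredDensity {fin g : V → ℝ} {ξ : V → V} (hg : ClassY0 fin g)
    (hn : IsNormalized fin) (hξ : IsWeakLogGradient g ξ) :
    IsCenteredDensity g (normalizedScore g ξ) where
  nonneg := hg.nonneg
  integrable := hg.memL1.1
  mass := hg.mass.trans hn.mass
  momentum := hg.momentum.trans hn.momentum
  integrable_norm_sq := by
    -- A non-integrable function has Bochner integral $0$, which contradicts the prescribed energy
    -- $3$.
    by_contra h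
    have := integral_undef h
    rw [hg.energy, hn.energy] at this
    norm_num at this
  energy := hg.energy.trans hn.energy
  aestronglyMeasurable :=
    (hg.memL1.1.aestronglyMeasurable.aemeasurable.inv.aestronglyMeasurable).smul
      hξ.1.aestronglyMeasurable
  weak := hξ.normalizedScore

/-! ### Size and positivity of $\lambda(g)$, and the conclusion -/

namespace IsCenteredDensity
variable {g : V → ℝ} {ξ : V → V} {γ : ℝ}

lemma lintegral_mul_sq (h : IsCenteredDensity g ξ) {f : V → ℝ} (hf : Measurable f) :
    ∫⁻ v, ENNReal.ofReal (g v * f v ^ 2)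
      = ∫⁻ v, ENNReal.ofReal (f v ^ 2) ∂densityMeasure g := by
  rw [h.lintegral_eq (hf.pow_const 2).ennreal_ofReal.aemeasurable]
  exact lintegral_congr fun v => ENNReal.ofReal_mul (h.nonneg v)

lemma lintegral_mul_sq_ne_zero (h : IsCenteredDensity g ξ) {f : V → ℝ} (hf : Measurable f)
    (hne : ∀ᵐ v, f v ≠ 0) : ∫⁻ v, ENNReal.ofReal (g v * f v ^ 2) ≠ 0 := by
  rw [h.lintegral_mul_sq hf]
  intro h0
  rw [lintegral_eq_zero_iff (hf.pow_const 2).ennreal_ofReal] at h0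
  refine h.not_ae_eq_zero hne ?_
  filter_upwards [h0] with v hv
  have : f v ^ 2 ≤ 0 := by simpa using hv
  nlinarith [sq_nonneg (f v), pow_eq_zero_iff (M₀ := ℝ) (a := f v) two_ne_zero]

/-- A single directional energy is at most the total energy $3$. -/
lemma one_le_eConst (h : IsCenteredDensity g ξ) : 1 ≤ eConst g := by
  rw [eConst, ENNReal.one_le_inv]
  refine (iInf_le _ 0).trans ?_
  calc 3⁻¹ * ∫⁻ v, ENNReal.ofReal (g v * v 0 ^ 2)
      ≤ 3⁻¹ * ∫⁻ v, ENNReal.ofReal (g v * ‖v‖ ^ 2) := by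
        refine mul_le_mul' le_rfl (lintegral_mono fun v => ENNReal.ofReal_le_ofReal
          (mul_le_mul_of_nonneg_left (sq_le_sq' (neg_le_of_abs_le ?_) (le_of_abs_le ?_))
            (h.nonneg v))) <;> exact PiLp.norm_apply_le v 0
    _ = 1 := by
        rw [← ofReal_integral_eq_lintegral_ofReal h.integrable_norm_sq
          (Eventually.of_forall fun v => mul_nonneg (h.nonneg v) (sq_nonneg _)), h.energy]
        rw [show ENNReal.ofReal 3 = 3 by simp]
        exact ENNReal.inv_mul_cancel (by simp) (by simp)

lemma eConst_ne_top (h : IsCenteredDensity g ξ) : eConst g ≠ ⊤ := by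
  rw [eConst, ne_eq, ENNReal.inv_eq_top]
  obtain ⟨i, hi⟩ := exists_eq_ciInf_of_finite
    (f := fun i : Fin 3 => 3⁻¹ * ∫⁻ v : V, ENNReal.ofReal (g v * v i ^ 2))
  rw [← hi]
  refine mul_ne_zero (by simp) (h.lintegral_mul_sq_ne_zero (by fun_prop) ?_)
  have := ae_inner_ne_zero (a := EuclideanSpace.single i (1 : ℝ)) (by simp)
  simpa [EuclideanSpace.inner_single_left] using this

/-- Positivity of the quadratic form in the definition of `B_γ`, uniformly on the unit circle. -/
lemma exists_pos_le_lintegral (h : IsCenteredDensity g ξ) {i j : Fin 3} (hij : i ≠ j) :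
    ∃ c : ℝ≥0∞, 0 < c ∧ ∀ σ ∈ Metric.sphere (0 : EuclideanSpace ℝ (Fin 2)) 1,
      c ≤ ∫⁻ v, ENNReal.ofReal
        (|σ 0 * (v i / bracket v) - σ 1 * (v j / bracket v)| ^ 2 * g v) := by
  have := h.isProbabilityMeasure
  have hbc := continuous_bracket
  have hb0 : ∀ v, bracket v ≠ 0 := fun v => (zero_lt_one.trans_le (one_le_bracket v)).ne'
  set p : Fin 3 → V → ℝ := fun k v => v k / bracket v with hp
  have hpc : ∀ k, Continuous (p k) := fun k => by
    simp only [hp]; exact Continuous.div (by fun_prop) hbc hb0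
  have hp1 : ∀ k v, |p k v| ≤ 1 := fun k v => by
    simp only [hp]
    rw [abs_div, abs_of_pos (zero_lt_one.trans_le (one_le_bracket v)),
      div_le_one (zero_lt_one.trans_le (one_le_bracket v))]
    exact (PiLp.norm_apply_le v k).trans (norm_le_bracket v)
  have hpi : ∀ k l, Integrable (fun v => p k v * p l v) (densityMeasure g) := fun k l => by
    refine (integrable_const (1 : ℝ)).mono' ((hpc k).mul (hpc l)).aestronglyMeasurable
      (Eventually.of_forall fun v => ?_)
    rw [Real.norm_eq_abs, abs_mul]
    exact mul_le_one₀ (hp1 k v) (abs_nonneg _) (hp1 l v)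
  let Q : EuclideanSpace ℝ (Fin 2) → ℝ := fun σ =>
    σ 0 ^ 2 * (∫ v, p i v * p i v ∂densityMeasure g)
      + (-2 * σ 0 * σ 1) * (∫ v, p i v * p j v ∂densityMeasure g)
      + σ 1 ^ 2 * (∫ v, p j v * p j v ∂densityMeasure g)
  -- The integral is a quadratic form in $\sigma$ with finite coefficients, hence continuous; being
  -- positive at every point of the compact circle, it has a positive minimum.
  have hQ : ∀ σ : EuclideanSpace ℝ (Fin 2), ∫⁻ v, ENNReal.ofReal
      (|σ 0 * (v i / bracket v) - σ 1 * (v j / bracket v)| ^ 2 * g v)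
      = ENNReal.ofReal (Q σ) := by
    intro σ
    have e : ∀ v, (σ 0 * p i v - σ 1 * p j v) ^ 2 = σ 0 ^ 2 * (p i v * p i v)
      + (-2 * σ 0 * σ 1) * (p i v * p j v) + σ 1 ^ 2 * (p j v * p j v) := fun v => by ring
    have hi : Integrable (fun v => (σ 0 * p i v - σ 1 * p j v) ^ 2) (densityMeasure g) := by
      simp_rw [e]
      exact (((hpi i i).const_mul _).add ((hpi i j).const_mul _)).add ((hpi j j).const_mul _)
    calc _ = ∫⁻ v, ENNReal.ofReal (g v * (σ 0 * p i v - σ 1 * p j v) ^ 2) := by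
          refine lintegral_congr fun v => ?_
          rw [sq_abs, mul_comm]
      _ = _ := by
          rw [h.lintegral_mul_sq (f := fun v => σ 0 * p i v - σ 1 * p j v)
            (((hpc i).const_mul _).sub ((hpc j).const_mul _)).measurable,
            ← ofReal_integral_eq_lintegral_ofReal hi (Eventually.of_forall fun v => sq_nonneg _)]
          simp_rw [e]
          rw [integral_add (((hpi i i).const_mul _).fun_add ((hpi i j).const_mul _))
            ((hpi j j).const_mul _), integral_add ((hpi i i).const_mul _) ((hpi i j).const_mul _),
            integral_const_mul, integral_const_mul, integral_const_mul]
  have hQpos : ∀ σ ∈ Metric.sphere (0 : EuclideanSpace ℝ (Fin 2)) 1, 0 < Q σ := by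
    intro σ hσ
    rw [← ENNReal.ofReal_pos, ← hQ, pos_iff_ne_zero]
    -- The integrand vanishes only where the linear form $\sigma_0v_i-\sigma_1v_j$ does. That form
    -- is nonzero because $i\ne j$ and $\sigma\ne0$.
    have ha : σ 0 • EuclideanSpace.single i (1 : ℝ) - σ 1 • EuclideanSpace.single j (1 : ℝ)
        ≠ 0 := by
      intro h0
      have h1 := congrArg (fun x : V => x i) h0
      have h2 := congrArg (fun x : V => x j) h0
      simp [hij, hij.symm] at h1 h2
      have : σ = 0 := by ext k; fin_cases k <;> simp [h1, h2]
      simp [this] at hσ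
    have := h.lintegral_mul_sq_ne_zero (f := fun v => σ 0 * p i v - σ 1 * p j v)
      (((hpc i).const_mul _).sub ((hpc j).const_mul _)).measurable (by
        filter_upwards [ae_inner_ne_zero ha] with v hv
        simp only [inner_sub_left, real_inner_smul_left, EuclideanSpace.inner_single_left] at hv
        simp only [hp]
        rw [← mul_div_assoc, ← mul_div_assoc, ← sub_div]
        exact div_ne_zero (by simpa using hv) (hb0 v))
    convert this using 4 with v
    rw [sq_abs, mul_comm]
  obtain ⟨σ₀, hσ₀, hmin⟩ := (isCompact_sphere (0 : EuclideanSpace ℝ (Fin 2)) 1).exists_isMinOn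
    (NormedSpace.sphere_nonempty.2 zero_le_one) (f := Q) (by fun_prop)
  refine ⟨ENNReal.ofReal (Q σ₀), ENNReal.ofReal_pos.2 (hQpos _ hσ₀), fun σ hσ => ?_⟩
  rw [hQ]
  exact ENNReal.ofReal_le_ofReal (hmin hσ)

lemma bConst_ne_top (h : IsCenteredDensity g ξ) : bConst g ≠ ⊤ := by
  rw [bConst, ne_eq, ENNReal.inv_eq_top, ← ne_eq, ← pos_iff_ne_zero]
  obtain ⟨i, hi⟩ := exists_eq_ciInf_of_finite (f := fun i : Fin 3 => ⨅ (j : Fin 3) (_ : i ≠ j)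
    (σ ∈ Metric.sphere (0 : EuclideanSpace ℝ (Fin 2)) 1), ∫⁻ v : V, ENNReal.ofReal
        (|σ 0 * (v i / bracket v) - σ 1 * (v j / bracket v)| ^ 2 * g v))
  rw [← hi]
  obtain ⟨j, hj⟩ := exists_eq_ciInf_of_finite (f := fun j : Fin 3 => ⨅ (_ : i ≠ j)
    (σ ∈ Metric.sphere (0 : EuclideanSpace ℝ (Fin 2)) 1), ∫⁻ v : V, ENNReal.ofReal
        (|σ 0 * (v i / bracket v) - σ 1 * (v j / bracket v)| ^ 2 * g v))
  rw [← hj]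
  by_cases hij : i = j
  · simp [hij]
  obtain ⟨c, hc, hle⟩ := h.exists_pos_le_lintegral hij
  exact hc.trans_le (le_iInf fun _ => le_iInf₂ hle)

lemma lam_pos (h : IsCenteredDensity g ξ) (hm : moment (2 + γ) g < ⊤) (hI : iConst γ g < ⊤) :
    0 < lam γ g := by
  rw [lam, ENNReal.inv_pos]
  have h1 := h.bConst_ne_top
  have h2 := h.eConst_ne_top
  refine ENNReal.mul_ne_top (ENNReal.mul_ne_top (ENNReal.mul_ne_top (ENNReal.mul_ne_top (by simp)
    (ENNReal.pow_ne_top h2)) ?_) ?_) hI.ne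
  · simp [h1]
  · simp [hm.ne]

/-- Every discarded factor of $1/\lambda(g)$ is at least $1$, so the bound with $\mathscr I_\gamma$
alone is stronger than the one claimed. -/
lemma lam_le (h : IsCenteredDensity g ξ) : lam γ g ≤ (510 * iConst γ g)⁻¹ := by
  rw [lam, ENNReal.inv_le_inv]
  have h1 : 1 ≤ eConst g ^ 3 := one_le_pow₀ h.one_le_eConst
  calc 510 * iConst γ g = 510 * 1 * 1 * 1 * iConst γ g := by simp
    _ ≤ _ := by gcongr <;> exact le_max_left _ _

theorem lam_mul_relative_entropy_le (h : IsCenteredDensity g ξ) (hγ : 0 ≤ γ)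
    (he : Integrable fun v => g v * Real.log (g v)) :
    lam γ g * ENNReal.ofReal (∫ v, g v * Real.log (g v / gaussDensity 1 v))
      ≤ entropyProduction γ g ξ := by
  by_cases hD : entropyProduction γ g ξ = ⊤
  · simp [hD]
  by_cases hI : iConst γ g = ⊤
  -- An infinite $\mathscr I_\gamma(g)$ forces $\lambda(g)=0$, and the inequality is trivial.
  · have := h.lam_le (γ := γ)
    rw [hI, ENNReal.mul_top (by simp), ENNReal.inv_top, nonpos_iff_eq_zero] at this
    simp [this]
  set D := entropyProduction γ g ξ
  set I := iConst γ g
  calc _ ≤ (510 * I)⁻¹ * ENNReal.ofReal (510 * (D * I).toReal) :=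
        mul_le_mul' h.lam_le (ENNReal.ofReal_le_ofReal (h.relative_entropy_le hγ he hD hI))
    _ = (510 * I)⁻¹ * (510 * I) * D := by
        rw [ENNReal.ofReal_mul (by norm_num), ENNReal.ofReal_toReal (ENNReal.mul_ne_top hD hI),
          show ENNReal.ofReal 510 = 510 by simp]
        ring
    _ ≤ 1 * D := by gcongr; exact ENNReal.inv_mul_le_one _
    _ = D := one_mul D

end IsCenteredDensity
end Landau

theorem corollary1p5 (γ : ℝ) (hγ : 0 ≤ γ)
    (fin : Landau.V → ℝ) (hfin : Landau.IsInitialDatum fin) (hnorm : Landau.IsNormalized fin)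
    (g : Landau.V → ℝ) (hg : Landau.ClassY0 fin g)
    (ξ : Landau.V → Landau.V) (hξ : Landau.IsWeakLogGradient g ξ) :
    (Landau.moment (2 + γ) g < ⊤ → Landau.iConst γ g < ⊤ → 0 < Landau.lam γ g) ∧
    Integrable (fun v => g v * Real.log (g v / Landau.maxwellian v)) ∧
    Landau.lam γ g * ENNReal.ofReal (∫ v, g v * Real.log (g v / Landau.maxwellian v))
      ≤ Landau.entropyProduction γ g ξ := by
  have h := hg.isCenteredDensity hnorm hξ
  rw [← Landau.gaussDensity_one, ← Landau.entropyProduction_normalizedScore γ g ξ]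
  exact ⟨h.lam_pos, Landau.integrable_mul_log_div_gaussDensity one_pos h.nonneg h.integrable
    h.integrable_norm_sq hg.entropy_finite, h.lam_mul_relative_entropy_le hγ hg.entropy_finite⟩
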